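/- **Theorem 4.1** (Lipschitz stability and uniqueness). Let $n\ge 1$, $B,d,\varepsilon>0$, $0<a<b$; write $x=(x_1,\dots,x_{n-1},z)\in\mathbb R^n$ and $$\Omega=\{-B<x_1,\dots,x_{n-1}<B,\ a<z<b\},\qquad \partial_2\Omega=\{-B<x_1,\dots,x_{n-1}<B,\ z=b\},$$ $$P=\{|x_1|,\dots,|x_{n-1}|<\max(B,d),\ 0<z<b\}.$$ Let $x_\alpha=(\alpha,0,\dots,0)$, assume that $x_\alpha\notin\overline\Omega$ for all $\alpha\in[-d,d]$ (automatic if $n\ge2$), and let $\nu(x,\alpha)=(x-x_\alpha)/|x-x_\alpha|$. Let $G=G(x,\alpha,\beta)\in C^1(\overline P\times[-d,d]^2)$ and let $\mu_a,\mu_s\in C(\overline P)$ be nonnegative in $P$ and zero in $P\setminus\Omega$. For functions $p,q$ of $(x,\alpha)$ put $$S(p,q)=\nu\cdot\nabla_xq+\partial_\alpha\nu\cdot\nabla_xp+e^{-p}q\,\mu_s\int_{-d}^{d}G(x,\alpha,\beta)e^{p(x,\beta)}\,d\beta-e^{-p}\mu_s\int_{-d}^{d}\partial_\alpha G(x,\alpha,\beta)e^{p(x,\beta)}\,d\beta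 .$$ For $i=1,2$ let $p_i,q_i\in C([-d,d];H^2(\Omega))\cap C(\overline\Omega\times[-d,d])$ satisfy $$-\varepsilon\Delta p_i+S(p_i,q_i)=0,\qquad -\varepsilon\Delta q_i+S(p_i,q_i)=0\qquad\text{for every }\alpha\in(-d,d)\text{ and a.e. }x\in\Omega,$$ and suppose that $p_1=p_2$ and $q_1=q_2$ on $(\partial\Omega\setminus\partial_2\Omega)\times(-d,d)$. Let $M$ be the maximum of the norms of $p_1,p_2,q_1,q_2$ in $C(\overline\Omega\times[-d,d])$. For a normed space $X$ of functions on $\Omega$ or $\partial_2\Omega$ write $\|f\|_{X\times L_2(-d,d)}=\big(\int_{-d}^{d}\|f(\cdot,\alpha)\|_X^2\,d\alpha\big)^{1/2}$, and put $$D(f)=\|f\|_{H^1(\partial_2\Omega)\times L_2(-d,d)}+\|\partial_zf\|_{L_2(\partial_2\Omega)\times L_2(-d,d)},$$ where $\partial_z f|_{\partial_2\Omega}$ is understood in the sense of traces. Then there is a constant $C_1>0$ that depends only on $\Omega$, $d$, $\varepsilon$, $M$, the norm of $G$ in $C(\overline\Omega)\times C^1([-d,d]^2)$, that is, the maximum over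 $\overline\Omega\times[-d,d]^2$ of $|G|,|\partial_\alpha G|,|\partial_\beta G|$, and the norms of $\mu_a$ and $\mu_s$ in $C(\overline\Omega)$ (it can be chosen uniformly when only upper bounds for these norms and for $M$ are prescribed), such that the following holds. 1. $$\Big(\int_{-d}^{d}\big(\|(p_1-p_2)(\cdot,\alpha)\|_{H^1(\Omega)}^2+\|(q_1-q_2)(\cdot,\alpha)\|_{H^1(\Omega)}^2\big)\,d\alpha\Big)^{1/2}\le C_1D(p_1-p_2)+C_1D(q_1-q_2).$$ 2. If, for $i=1,2$ and a.e. $x\in\Omega$, $$a_i(x)=-\frac1{2d}\int_{-d}^{d}\nu\cdot\nabla_xp_i\,d\alpha+\frac1{2d}\int_{-d}^{d}e^{-p_i(x,\alpha)}\Big(\mu_s(x)\int_{-d}^{d}G(x,\alpha,\beta)e^{p_i(x,\beta)}\,d\beta\Big)d\alpha ,$$ then $$\|a_1-a_2\|_{L_2(\Omega)}\le C_1D(p_1-p_2)+C_1D(q_1-q_2).$$ 3. If, in addition, $p_1=p_2$, $q_1=q_2$, $\partial_zp_1=\partial_zp_2$ and $\partial_zq_1=\partial_zq_2$ on $\partial_2\Omega\times(-d,d)$,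 then $p_1=p_2$ and $q_1=q_2$ on $\Omega\times(-d,d)$, and $a_1=a_2$ a.e. in $\Omega$. -/

import Mathlib

open MeasureTheory Set Filter Topology
open scoped ENNReal ContDiff

namespace RTEStability

noncomputable section

/-- `k`-dimensional Euclidean space. -/
abbrev E (k : ℕ) : Type := EuclideanSpace ℝ (Fin k)

/-! ### Weak derivatives and Sobolev norms -/

/-- `g` is the weak partial derivative of `u` in the direction of the `i`-th coordinate on the
open set `U` (both locally integrable; test functions in `C_c^∞(U)`). -/
def HasWeakPartial {k : ℕ} (U : Set (E k)) (i : Fin k) (u g : E k → ℝ) : Prop :=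
  LocallyIntegrableOn u U ∧ LocallyIntegrableOn g U ∧
    ∀ φ : E k → ℝ, ContDiff ℝ ∞ φ → HasCompactSupport φ → tsupport φ ⊆ U →
      ∫ x in U, u x * fderiv ℝ φ x (EuclideanSpace.single i 1) = - ∫ x in U, g x * φ x

/-- `g` is the weak gradient of `u` on `U`. -/
def HasWeakGrad {k : ℕ} (U : Set (E k)) (u : E k → ℝ) (g : Fin k → E k → ℝ) : Prop :=
  ∀ i, HasWeakPartial U i u (g i)

/-- The square of the `L²(U)` norm, with value `∞` if the integral diverges. -/
def l2NormSq {k : ℕ} (U : Set (E k)) (u : E k → ℝ) : ℝ≥0∞ := ∫⁻ x in U, ‖u x‖ₑ ^ 2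

/-- The square of the `H¹(U)` norm. Weak gradients are unique up to null sets, so the infimum is
over the versions of one gradient; the value is `∞` exactly when `u` is not in `H¹(U)`. -/
def h1NormSq {k : ℕ} (U : Set (E k)) (u : E k → ℝ) : ℝ≥0∞ :=
  ⨅ (g : Fin k → E k → ℝ) (_ : HasWeakGrad U u g), (l2NormSq U u + ∑ i, l2NormSq U (g i))

/-- The square of the `H²(U)` norm; the value is `∞` exactly when `u` is not in `H²(U)`. -/
def h2NormSq {k : ℕ} (U : Set (E k)) (u : E k → ℝ) : ℝ≥0∞ :=
  ⨅ (g : Fin k → E k → ℝ) (h : Fin k → Fin k → E k → ℝ) (_ : HasWeakGrad U u g)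
    (_ : ∀ i, HasWeakGrad U (g i) (h i)),
    (l2NormSq U u + ∑ i, l2NormSq U (g i) + ∑ i, ∑ j, l2NormSq U (h i j))

/-- `p ∈ C([-d,d]; H²(U))`, where `p x α` is a function of `x ∈ U` and `α ∈ [-d,d]`. -/
def IsH2Path {k : ℕ} (U : Set (E k)) (d : ℝ) (p : E k → ℝ → ℝ) : Prop :=
  (∀ α ∈ Icc (-d) d, h2NormSq U (fun x => p x α) < ⊤) ∧
    ∀ α₀ ∈ Icc (-d) d,
      Tendsto (fun α => h2NormSq U (fun x => p x α - p x α₀)) (𝓝[Icc (-d) d] α₀) (𝓝 0)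

/-- `‖f‖_{C(K)} ≤ c`. -/
def SupNormLE {X : Type*} (K : Set X) (f : X → ℝ) (c : ℝ) : Prop := ∀ x ∈ K, |f x| ≤ c

/-! ### Geometry

Points of `ℝⁿ`, `n = m + 1`, are `x = (x₁, …, x_{n-1}, z)`; the coordinate `z` is the last one. -/

/-- The cube `(-B,B)^m`, the set over which the top face is parametrized. -/
def cube (m : ℕ) (B : ℝ) : Set (E m) := {y | ∀ i, y i ∈ Ioo (-B) B}

/-- `Ω = {-B < x₁, …, x_{n-1} < B, a < z < b}`. -/
def prism (m : ℕ) (B a b : ℝ) : Set (E (m + 1)) :=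
  {x | (∀ i : Fin m, x i.castSucc ∈ Ioo (-B) B) ∧ x (Fin.last m) ∈ Ioo a b}

/-- The top face `∂₂Ω = {-B < x₁, …, x_{n-1} < B, z = b}`. -/
def topFace (m : ℕ) (B b : ℝ) : Set (E (m + 1)) :=
  {x | (∀ i : Fin m, x i.castSucc ∈ Ioo (-B) B) ∧ x (Fin.last m) = b}

/-- The point `(y, b)` of the hyperplane `z = b`. -/
def topPoint {m : ℕ} (b : ℝ) (y : E m) : E (m + 1) :=
  WithLp.toLp 2 (Fin.snoc (α := fun _ => ℝ) (fun i => y i) b)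

/-- The domain `P = {|x₁|, …, |x_{n-1}| < max(B,d), 0 < z < b}`. -/
def bigPrism (m : ℕ) (B b d : ℝ) : Set (E (m + 1)) :=
  {x | (∀ i : Fin m, |x i.castSucc| < max B d) ∧ x (Fin.last m) ∈ Ioo 0 b}

/-- The source position `x_α = (α, 0, …, 0)`. -/
def source (m : ℕ) (α : ℝ) : E (m + 1) := EuclideanSpace.single 0 α

/-- The line of sources `Φ_d`. -/
def sourceLine (m : ℕ) (d : ℝ) : Set (E (m + 1)) := source m '' Icc (-d) d

/-- The unit vector `ν(x,α) = (x - x_α) / |x - x_α|`. -/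
def nu {m : ℕ} (x : E (m + 1)) (α : ℝ) : E (m + 1) := ‖x - source m α‖⁻¹ • (x - source m α)

/-- The derivative `∂_α ν(x,α)`. -/
def nuAlpha {m : ℕ} (x : E (m + 1)) (α : ℝ) : E (m + 1) := deriv (fun t => nu x t) α

/-! ### Boundary norms on the top face -/

/-- `g ∈ L²(∂₂Ω)` is the trace on the top face of the function `v`, which has a weak derivative
`w = ∂_z v`, with `v, w ∈ L²(Ω)`: Green's formula holds for all smooth test functions whose
support is compact and meets `closure Ω` only inside `Ω ∪ ∂₂Ω`. -/
def IsTopTrace {m : ℕ} (B a b : ℝ) (v : E (m + 1) → ℝ) (g : E m → ℝ) : Prop :=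
  ∃ w : E (m + 1) → ℝ, HasWeakPartial (prism m B a b) (Fin.last m) v w ∧
    MemLp v 2 (volume.restrict (prism m B a b)) ∧
    MemLp w 2 (volume.restrict (prism m B a b)) ∧
    MemLp g 2 (volume.restrict (cube m B)) ∧
    ∀ φ : E (m + 1) → ℝ, ContDiff ℝ ∞ φ → HasCompactSupport φ →
      tsupport φ ⊆ {x | (∀ i : Fin m, x i.castSucc ∈ Ioo (-B) B) ∧ a < x (Fin.last m)} →
      (∫ x in prism m B a b, v x * fderiv ℝ φ x (EuclideanSpace.single (Fin.last m) 1)) +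
          ∫ x in prism m B a b, w x * φ x =
        ∫ y in cube m B, g y * φ (topPoint b y)

/-- `g` is the Neumann datum `∂_z u` on the top face: the trace of the weak derivative `∂_z u`. -/
def IsTopNormalDeriv {m : ℕ} (B a b : ℝ) (u : E (m + 1) → ℝ) (g : E m → ℝ) : Prop :=
  ∃ v : E (m + 1) → ℝ, HasWeakPartial (prism m B a b) (Fin.last m) u v ∧ IsTopTrace B a b v g

/-- `‖∂_z u‖²_{L²(∂₂Ω)}` (the trace is unique up to null sets). -/
def neumannNormSq {m : ℕ} (B a b : ℝ) (u : E (m + 1) → ℝ) : ℝ≥0∞ :=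
  ⨅ (g : E m → ℝ) (_ : IsTopNormalDeriv B a b u g), l2NormSq (cube m B) g

/-- `‖u‖²_{H¹(∂₂Ω)}` for a function `u` that is continuous up to the top face. -/
def dirichletNormSq {m : ℕ} (B b : ℝ) (u : E (m + 1) → ℝ) : ℝ≥0∞ :=
  h1NormSq (cube m B) (fun y => u (topPoint b y))

/-- The `L²(-d,d)` norm in `α` of a norm whose square at `α` is `N α`. -/
def alphaNorm (d : ℝ) (N : ℝ → ℝ≥0∞) : ℝ≥0∞ := (∫⁻ α in Ioo (-d) d, N α) ^ (1 / 2 : ℝ)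

/-- The norm `(∫_{-d}^d (‖p‖²_{H¹(Ω)} + ‖q‖²_{H¹(Ω)}) dα)^{1/2}` of a pair. -/
def pairNorm {m : ℕ} (B a b d : ℝ) (p q : E (m + 1) → ℝ → ℝ) : ℝ≥0∞ :=
  alphaNorm d fun α =>
    h1NormSq (prism m B a b) (fun x => p x α) + h1NormSq (prism m B a b) (fun x => q x α)

/-- The sum `‖p‖ + ‖∂_z p‖` of the norms in `H¹(∂₂Ω) × L²(-d,d)` and `L²(∂₂Ω) × L²(-d,d)`. -/
def cauchyDataNorm {m : ℕ} (B a b d : ℝ) (p : E (m + 1) → ℝ → ℝ) : ℝ≥0∞ :=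
  alphaNorm d (fun α => dirichletNormSq B b (fun x => p x α)) +
    alphaNorm d (fun α => neumannNormSq B a b (fun x => p x α))

/-! ### Coefficients and equations -/

/-- The derivative `∂_α G(x,α,β)`, one-sided at `α = ±d`. -/
def kernelAlpha {m : ℕ} (d : ℝ) (G : E (m + 1) → ℝ → ℝ → ℝ) (x : E (m + 1)) (α β : ℝ) : ℝ :=
  derivWithin (fun t => G x t β) (Icc (-d) d) α

/-- The derivative `∂_β G(x,α,β)`, one-sided at `β = ±d`. -/
def kernelBeta {m : ℕ} (d : ℝ) (G : E (m + 1) → ℝ → ℝ → ℝ) (x : E (m + 1)) (α β : ℝ) : ℝ :=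
  derivWithin (fun t => G x α t) (Icc (-d) d) β

/-- `G ∈ C¹(closure P × [-d,d]²)`. -/
def KernelRegular {m : ℕ} (B b d : ℝ) (G : E (m + 1) → ℝ → ℝ → ℝ) : Prop :=
  ContDiffOn ℝ 1 (fun y : E (m + 1) × ℝ × ℝ => G y.1 y.2.1 y.2.2)
    (closure (bigPrism m B b d) ×ˢ Icc (-d) d ×ˢ Icc (-d) d)

/-- The norm of `G` in `C(closure Ω) × C¹([-d,d]²)` (the maximum of the sup-norms of `G`, `∂_α G`
and `∂_β G`) is at most `c`. -/
def KernelNormLE {m : ℕ} (B a b d : ℝ) (G : E (m + 1) → ℝ → ℝ → ℝ) (c : ℝ) : Prop :=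
  ∀ x ∈ closure (prism m B a b), ∀ α ∈ Icc (-d) d, ∀ β ∈ Icc (-d) d,
    |G x α β| ≤ c ∧ |kernelAlpha d G x α β| ≤ c ∧ |kernelBeta d G x α β| ≤ c

/-- A coefficient is continuous on `closure P`, nonnegative in `P` and vanishes in `P \ Ω`. -/
def CoefficientAdmissible {m : ℕ} (B a b d : ℝ) (μ : E (m + 1) → ℝ) : Prop :=
  ContinuousOn μ (closure (bigPrism m B b d)) ∧ (∀ x ∈ bigPrism m B b d, 0 ≤ μ x) ∧
    ∀ x ∈ bigPrism m B b d \ prism m B a b, μ x = 0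

/-- The common part of the operators `L₁` and `L₂` at `(x,α)`,
`ν·∇q + ∂_αν·∇p + e^{-p} q μ_s ∫ G e^p dβ - e^{-p} μ_s ∫ ∂_αG e^p dβ`,
where `gp` and `gq` are the values of the gradients `∇p(x,α)` and `∇q(x,α)`. -/
def lowerOrder {m : ℕ} (d : ℝ) (G : E (m + 1) → ℝ → ℝ → ℝ) (μs : E (m + 1) → ℝ)
    (p q : E (m + 1) → ℝ → ℝ) (gp gq : Fin (m + 1) → ℝ) (x : E (m + 1)) (α : ℝ) : ℝ :=
  (∑ i, nu x α i * gq i) + (∑ i, nuAlpha x α i * gp i) +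
    Real.exp (-p x α) * q x α * μs x * (∫ β in (-d)..d, G x α β * Real.exp (p x β)) -
    Real.exp (-p x α) * μs x * ∫ β in (-d)..d, kernelAlpha d G x α β * Real.exp (p x β)

/-- `(p,q)` solves the viscosity system `L₁(p,q) = 0`, `L₂(p,q) = 0`: for every `α ∈ (-d,d)`, with
the weak derivatives `gp = ∇p`, `gq = ∇q`, `hp i = ∂ᵢ∂ᵢp`, `hq i = ∂ᵢ∂ᵢq` in `Ω` (unique up to null
sets), the equations hold for almost every `x ∈ Ω`. -/
def SolvesSystem {m : ℕ} (B a b d ε : ℝ) (G : E (m + 1) → ℝ → ℝ → ℝ) (μs : E (m + 1) → ℝ)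
    (p q : E (m + 1) → ℝ → ℝ) : Prop :=
  ∀ α ∈ Ioo (-d) d, ∃ gp gq hp hq : Fin (m + 1) → E (m + 1) → ℝ,
    HasWeakGrad (prism m B a b) (fun x => p x α) gp ∧
    HasWeakGrad (prism m B a b) (fun x => q x α) gq ∧
    (∀ i, HasWeakPartial (prism m B a b) i (gp i) (hp i)) ∧
    (∀ i, HasWeakPartial (prism m B a b) i (gq i) (hq i)) ∧
    ∀ᵐ x ∂(volume.restrict (prism m B a b)),
      -ε * (∑ i, hp i x) +
          lowerOrder d G μs p q (fun i => gp i x) (fun i => gq i x) x α = 0 ∧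
      -ε * (∑ i, hq i x) +
          lowerOrder d G μs p q (fun i => gp i x) (fun i => gq i x) x α = 0

/-- A pair `(p,q)` in `C([-d,d]; H²(Ω))`, continuous on `closure Ω × [-d,d]` with sup-norms at most
`M`, that solves the viscosity system. -/
def IsSolutionPair {m : ℕ} (B a b d ε M : ℝ) (G : E (m + 1) → ℝ → ℝ → ℝ) (μs : E (m + 1) → ℝ)
    (p q : E (m + 1) → ℝ → ℝ) : Prop :=
  IsH2Path (prism m B a b) d p ∧ IsH2Path (prism m B a b) d q ∧
  ContinuousOn (Function.uncurry p) (closure (prism m B a b) ×ˢ Icc (-d) d) ∧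
  ContinuousOn (Function.uncurry q) (closure (prism m B a b) ×ˢ Icc (-d) d) ∧
  SupNormLE (closure (prism m B a b) ×ˢ Icc (-d) d) (Function.uncurry p) M ∧
  SupNormLE (closure (prism m B a b) ×ˢ Icc (-d) d) (Function.uncurry q) M ∧
  SolvesSystem B a b d ε G μs p q

/-- `A` is the attenuation coefficient reconstructed from `p`: for almost every `x ∈ Ω`,
`A(x) = -(1/2d) ∫ ν·∇p dα + (1/2d) ∫ e^{-p(x,α)} μ_s(x) ∫ G e^{p(x,β)} dβ dα`,
where `V` is a jointly measurable version of `(x,α) ↦ ∇p(x,α)`; such a version exists for every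
`p ∈ C([-d,d]; H²(Ω))`, and `A` does not depend on it, up to null sets. -/
def IsReconstruction {m : ℕ} (B a b d : ℝ) (G : E (m + 1) → ℝ → ℝ → ℝ) (μs : E (m + 1) → ℝ)
    (p : E (m + 1) → ℝ → ℝ) (A : E (m + 1) → ℝ) : Prop :=
  ∃ V : Fin (m + 1) → E (m + 1) → ℝ → ℝ,
    (∀ i, AEStronglyMeasurable (Function.uncurry (V i))
      ((volume.restrict (prism m B a b)).prod (volume.restrict (Ioo (-d) d)))) ∧
    (∀ᵐ α ∂(volume.restrict (Ioo (-d) d)),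
      HasWeakGrad (prism m B a b) (fun x => p x α) (fun i x => V i x α)) ∧
    ∀ᵐ x ∂(volume.restrict (prism m B a b)),
      A x = -(1 / (2 * d)) * (∫ α in (-d)..d, ∑ i, nu x α i * V i x α) +
        1 / (2 * d) * ∫ α in (-d)..d,
          Real.exp (-p x α) * (μs x * ∫ β in (-d)..d, G x α β * Real.exp (p x β))

end

end RTEStability

/-! Put P = p₁ - p₂ and Q = q₁ - q₂. Both vanish on every face of the prism except the top one, and
εΔP and εΔQ both equal the difference of the two values of S. Because the solutions are bounded by
M, this difference is at most a constant times |∇P| + |∇Q| + |P| + |Q| + ∫|P| dβ pointwise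
(`abs_lowerOrder_sub_le`). What remains is a Cauchy problem for the Laplacian with data on the top
face, perturbed by first order terms and by one term that is nonlocal in α. A Carleman estimate
handles it.

The estimate (`IsAdmissible.carleman`) uses the weight w = exp(l z²): for u of class H² vanishing
off the top face, l ∫ w (|∇u|² + u²) ≤ C ∫ w |Δu|² + D(l) · (Cauchy data), with C independent of l.
Integrating by parts up to the edges of the prism with functions that are only H² is avoided by
separating variables. Expand u in products of sines of the tangential variables. The coefficient
c(z) of one such product satisfies c'' - k² c = (coefficient of Δu), where k² is the sum of the
squared frequencies, so an estimate on an interval that is uniform in k suffices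
(`carleman_estimate`, resting on the algebra of `carleman_pointwise`). Parseval's identity then sums
the modes. The derivative of u in a tangential direction i is measured against products with a
cosine in coordinate i, so Parseval is needed for all mixed systems of sines and cosines
(`parseval_cube`). It follows from Parseval on the torus by even or odd reflection in each
coordinate.

The trigonometric products are not compactly supported in the prism, so testing weak derivatives
with them is justified by cutoffs. Against a cosine, the boundary term disappears because u vanishes
on the lateral faces (`HasWeakPartial.integral_of_vanishes_on_faces`); against a sine, because the
sine does (`HasWeakPartial.integral_of_factor_vanishes`). In the vertical variable, du
Bois-Reymond's lemma turns weak derivatives into absolutely continuous functions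
(`exists_double_primitive`), and the one-sided derivative of c at z = b is the Fourier coefficient
of the Neumann trace (`topDeriv_eq`).

For the coupled system (`exists_stability`), the weight does not depend on α, so the nonlocal term
contributes the same quantity R = ∫∫ w P² dx dβ to the estimate for every α. A large l absorbs the
first order terms for each α and leaves a small multiple of R plus data; integrating in α then
absorbs R itself. The outcome holds for each α separately. Integrated, it gives the stability of the
solutions; with vanishing data it gives uniqueness for every α. The reconstruction formula is
Lipschitz in p and ∇p in the L² sense (`exists_reconstruction_bound`), which transfers both
conclusions to the attenuation coefficient. -/

namespace RTEStability

noncomputable section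

/-! ### One-dimensional weak derivatives -/

/-- `w` is the weak derivative of `v` on `(a,b)`, tested against `C_c^∞(a,b)`. -/
def HasWeakDeriv (a b : ℝ) (v w : ℝ → ℝ) : Prop :=
  ∀ η : ℝ → ℝ, ContDiff ℝ ∞ η → HasCompactSupport η → tsupport η ⊆ Ioo a b →
    ∫ z in Ioo a b, v z * deriv η z = - ∫ z in Ioo a b, w z * η z

theorem setIntegral_Ioo_eq_intervalIntegral {a b : ℝ} (hab : a ≤ b) (f : ℝ → ℝ) :
    ∫ z in Ioo a b, f z = ∫ z in a..b, f z := by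
  rw [intervalIntegral.integral_of_le hab, integral_Ioc_eq_integral_Ioo]

theorem intervalIntegrable_of_integrableOn_Ioo {a b : ℝ} (hab : a ≤ b) {f : ℝ → ℝ}
    (hf : IntegrableOn f (Ioo a b)) : IntervalIntegrable f volume a b := by
  rw [intervalIntegrable_iff_integrableOn_Ioo_of_le hab]; exact hf

theorem contDiff_absolutelyContinuousOnInterval {η : ℝ → ℝ} (h : ContDiff ℝ ∞ η) (a b : ℝ) :
    AbsolutelyContinuousOnInterval η a b :=
  ((h.of_le (by exact_mod_cast le_top)).contDiffOn).absolutelyContinuousOnInterval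

theorem ae_hasDerivAt_primitive {a b : ℝ} (hab : a ≤ b) {w : ℝ → ℝ}
    (hw : IntegrableOn w (Ioo a b)) :
    ∀ᵐ z, z ∈ Icc a b → HasDerivAt (fun x => ∫ t in a..x, w t) (w z) z := by
  have := (intervalIntegrable_of_integrableOn_Ioo hab hw).ae_hasDerivAt_integral
  filter_upwards [this] with z hz hz'
  rw [uIcc_of_le hab] at hz
  exact hz hz' a ⟨le_rfl, hab⟩

/-- Integration by parts for a primitive of an integrable function. -/
theorem integral_primitive_mul_deriv {a b : ℝ} (hab : a ≤ b) {w : ℝ → ℝ} (C : ℝ)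
    (hw : IntegrableOn w (Ioo a b)) {η : ℝ → ℝ} (hη : ContDiff ℝ ∞ η) :
    ∫ z in Ioo a b, (C + ∫ t in a..z, w t) * deriv η z =
      (C + ∫ t in a..b, w t) * η b - C * η a - ∫ z in Ioo a b, w z * η z := by
  have hwi := intervalIntegrable_of_integrableOn_Ioo hab hw
  have hW : AbsolutelyContinuousOnInterval (fun z => C + ∫ t in a..z, w t) a b := by
    have h1 := hwi.absolutelyContinuousOnInterval_intervalIntegral (c := a) (by simp)
    have h2 : AbsolutelyContinuousOnInterval (fun _ : ℝ => C) a b :=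
      contDiff_absolutelyContinuousOnInterval contDiff_const a b
    exact h2.add h1
  have := hW.integral_mul_deriv_eq_deriv_mul (contDiff_absolutelyContinuousOnInterval hη a b)
  rw [setIntegral_Ioo_eq_intervalIntegral hab, setIntegral_Ioo_eq_intervalIntegral hab, this]
  simp only [intervalIntegral.integral_same, add_zero]
  congr 1
  apply intervalIntegral.integral_congr_ae
  filter_upwards [ae_hasDerivAt_primitive hab hw] with z hz hz'
  rw [uIoc_of_le hab] at hz'
  rw [((hz ⟨hz'.1.le, hz'.2⟩).const_add C).deriv]

/-- The midpoints between the ends of the interval and the extreme points of the support leave room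
on both sides. This room gives primitives of mean zero functions compact support. -/
theorem exists_Icc_of_tsupport_subset {a b : ℝ} {φ : ℝ → ℝ} (hc : HasCompactSupport φ)
    (hs : tsupport φ ⊆ Ioo a b) (hab : a < b) :
    ∃ a' b', a < a' ∧ a' < b' ∧ b' < b ∧ ∀ z, z ∉ Icc a' b' → φ z = 0 := by
  rcases (tsupport φ).eq_empty_or_nonempty with h | h
  · have h0 : ∀ z, φ z = 0 := fun z => image_eq_zero_of_notMem_tsupport (by simp [h])
    exact ⟨a + (b - a) / 3, a + 2 * (b - a) / 3, by linarith, by linarith, by linarith,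
      fun z _ => h0 z⟩
  · have hI := hs (hc.isCompact.sInf_mem h)
    have hS := hs (hc.isCompact.sSup_mem h)
    have hbd := hc.isCompact.bddBelow
    have hba := hc.isCompact.bddAbove
    have hle : sInf (tsupport φ) ≤ sSup (tsupport φ) := csInf_le_csSup  h hbd hba
    refine ⟨(a + sInf (tsupport φ)) / 2, (b + sSup (tsupport φ)) / 2, ?_, ?_, ?_, ?_⟩
    · linarith [hI.1]
    · linarith [hI.1, hS.2]
    · linarith [hS.2]
    · intro z hz
      apply image_eq_zero_of_notMem_tsupport
      intro hz'
      apply hz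
      have h1 := csInf_le hbd hz'
      have h2 := le_csSup hba hz'
      constructor
      · linarith [hI.1]
      · linarith [hS.2]

theorem exists_bump_integral_one {a b : ℝ} (hab : a < b) :
    ∃ ρ : ℝ → ℝ, ContDiff ℝ ∞ ρ ∧ HasCompactSupport ρ ∧ tsupport ρ ⊆ Ioo a b ∧
      ∫ z in Ioo a b, ρ z = 1 := by
  let f : ContDiffBump ((a + b) / 2) := ⟨(b - a) / 8, (b - a) / 4, by linarith, by linarith⟩
  have hs : tsupport (f.normed volume) ⊆ Ioo a b := by
    rw [f.tsupport_normed_eq, Real.closedBall_eq_Icc]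
    intro z hz
    simp only [f, mem_Icc] at hz
    constructor <;> linarith [hz.1, hz.2]
  refine ⟨f.normed volume, f.contDiff_normed, f.hasCompactSupport_normed, hs, ?_⟩
  rw [setIntegral_eq_integral_of_forall_compl_eq_zero, f.integral_normed]
  intro x hx
  exact image_eq_zero_of_notMem_tsupport (fun h => hx (hs h))

/-- A smooth function with compact support and mean zero is a derivative of such a function. -/
theorem exists_compactSupport_primitive {a b : ℝ} (hab : a < b) {φ : ℝ → ℝ} (h : ContDiff ℝ ∞ φ)
    (hc : HasCompactSupport φ) (hs : tsupport φ ⊆ Ioo a b) (h0 : ∫ z in Ioo a b, φ z = 0) :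
    ∃ η : ℝ → ℝ, ContDiff ℝ ∞ η ∧ HasCompactSupport η ∧ tsupport η ⊆ Ioo a b ∧ deriv η = φ := by
  obtain ⟨a', b', h1, h2, h3, hz⟩ := exists_Icc_of_tsupport_subset hc hs hab
  have hd : ∀ z, HasDerivAt (fun z => ∫ t in a..z, φ t) (φ z) z := fun z =>
    intervalIntegral.integral_hasDerivAt_right (h.continuous.intervalIntegrable _ _)
      (h.continuous.stronglyMeasurableAtFilter _ _) h.continuous.continuousAt
  have hderiv : deriv (fun z => ∫ t in a..z, φ t) = φ := funext fun z => (hd z).deriv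
  -- To the left of the support nothing has been integrated yet. To the right of it the whole
  -- integral has been collected, and it is zero.
  have hsupp : ∀ z, z ∉ Icc a' b' → ∫ t in a..z, φ t = 0 := by
    intro z hz'
    by_cases hza : z < a'
    · apply intervalIntegral.integral_zero_ae
      refine Eventually.of_forall fun t ht => hz t fun ht' => ?_
      have := (uIoc_subset_uIcc ht).2
      have : t ≤ max a z := this
      rcases le_max_iff.1 this with h | h <;> linarith [ht'.1]
    · have hzb : b' < z := by
        by_contra hcon
        exact hz' ⟨not_lt.1 hza, not_lt.1 hcon⟩
      have e1 : ∫ t in b..z, φ t = 0 := by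
        apply intervalIntegral.integral_zero_ae
        refine Eventually.of_forall fun t ht => hz t fun ht' => ?_
        have : min b z ≤ t := (uIoc_subset_uIcc ht).1
        rcases min_le_iff.1 this with h | h <;> linarith [ht'.2]
      rw [← intervalIntegral.integral_add_adjacent_intervals
        (h.continuous.intervalIntegrable a b) (h.continuous.intervalIntegrable b z), e1,
        ← setIntegral_Ioo_eq_intervalIntegral hab.le, h0, add_zero]
  have hts : tsupport (fun z => ∫ t in a..z, φ t) ⊆ Icc a' b' := by
    apply closure_minimal _ isClosed_Icc
    intro z hz'
    by_contra hcon
    exact hz' (hsupp z hcon)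
  refine ⟨fun z => ∫ t in a..z, φ t, ?_, ?_, ?_, hderiv⟩
  · rw [contDiff_infty_iff_deriv]
    exact ⟨fun z => (hd z).differentiableAt, by rw [hderiv]; exact h⟩
  · exact HasCompactSupport.of_support_subset_isCompact isCompact_Icc
      ((subset_tsupport _).trans hts)
  · exact hts.trans fun z hz => ⟨h1.trans_le hz.1, hz.2.trans_lt h3⟩

theorem integrableOn_mul_of_continuous {a b : ℝ} {u φ : ℝ → ℝ} (hu : IntegrableOn u (Ioo a b))
    (hφ : Continuous φ) : IntegrableOn (fun z => u z * φ z) (Ioo a b) := by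
  obtain ⟨C, hC⟩ := isCompact_Icc.exists_bound_of_continuousOn (s := Icc a b) hφ.continuousOn
  refine Integrable.mul_bdd (c := C) hu hφ.aestronglyMeasurable ?_
  filter_upwards [ae_restrict_mem measurableSet_Ioo] with z hz using hC z (Ioo_subset_Icc_self hz)

/-- The lemma of du Bois-Reymond. -/
theorem HasWeakDeriv.exists_primitive {a b : ℝ} (hab : a < b) {v w : ℝ → ℝ}
    (hv : IntegrableOn v (Ioo a b)) (hw : IntegrableOn w (Ioo a b)) (h : HasWeakDeriv a b v w) :
    ∃ C, ∀ᵐ z ∂(volume.restrict (Ioo a b)), v z = C + ∫ t in a..z, w t := by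
  obtain ⟨ρ, hρ, hρc, hρs, hρ1⟩ := exists_bump_integral_one hab
  set u : ℝ → ℝ := fun z => v z - ∫ t in a..z, w t with hu_def
  have hWc : ContinuousOn (fun z => ∫ t in a..z, w t) (Icc a b) := by
    have := (intervalIntegrable_of_integrableOn_Ioo hab.le
      hw).absolutelyContinuousOnInterval_intervalIntegral (c := a) (by simp)
    have := this.continuousOn
    rwa [uIcc_of_le hab.le] at this
  have hWi : IntegrableOn (fun z => ∫ t in a..z, w t) (Ioo a b) :=
    (hWc.integrableOn_Icc).mono_set Ioo_subset_Icc_self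
  have hu : IntegrableOn u (Ioo a b) := hv.sub hWi
  have h_zero : ∀ η : ℝ → ℝ, ContDiff ℝ ∞ η → HasCompactSupport η → tsupport η ⊆ Ioo a b →
      ∫ z in Ioo a b, u z * deriv η z = 0 := by
    intro η h1 h2 h3
    have hdc : Continuous (deriv η) := h1.continuous_deriv (by simp)
    have e1 := h η h1 h2 h3
    have e2 := integral_primitive_mul_deriv hab.le 0 hw h1
    have ha : η a = 0 := image_eq_zero_of_notMem_tsupport fun hh => (lt_irrefl _ (h3 hh).1)
    have hb : η b = 0 := image_eq_zero_of_notMem_tsupport fun hh => (lt_irrefl _ (h3 hh).2)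
    simp only [zero_add, ha, hb, mul_zero, zero_sub, sub_zero] at e2
    simp only [hu_def, sub_mul]
    rw [integral_sub (integrableOn_mul_of_continuous hv hdc)
      (integrableOn_mul_of_continuous hWi hdc), e1, e2, sub_self]
  refine ⟨∫ z in Ioo a b, u z * ρ z, ?_⟩
  set C := ∫ z in Ioo a b, u z * ρ z
  have key := IsOpen.ae_eq_zero_of_integral_contDiff_smul_eq_zero (μ := volume)
    (isOpen_Ioo (a := a) (b := b)) (f := fun z => u z - C)
    ((hu.sub (integrableOn_const (by simp))).locallyIntegrableOn) ?_
  · rw [ae_restrict_iff' measurableSet_Ioo]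
    filter_upwards [key] with z hz hz'
    have := hz hz'
    simp only [hu_def] at this
    linarith
  · intro φ h1 h2 h3
    have e0 : ∫ x, φ x • (u x - C) = ∫ x in Ioo a b, φ x * (u x - C) := by
      symm
      apply setIntegral_eq_integral_of_forall_compl_eq_zero
      intro x hx
      rw [image_eq_zero_of_notMem_tsupport (fun hh => hx (h3 hh)), zero_mul]
    -- Subtracting `I * ρ` makes the test function mean zero, hence a derivative η'. As u
    -- annihilates such derivatives, ∫ u φ = I ∫ u ρ = ∫ C φ, which singles out the constant.
    set I := ∫ z in Ioo a b, φ z with hI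
    have hψ : ContDiff ℝ ∞ (fun z => φ z - I * ρ z) := h1.sub (contDiff_const.mul hρ)
    have hψc : HasCompactSupport (fun z => φ z - I * ρ z) :=
      HasCompactSupport.sub h2 (hρc.mul_left)
    have hψs : tsupport (fun z => φ z - I * ρ z) ⊆ Ioo a b := by
      refine (tsupport_sub _ _).trans (union_subset h3 ?_)
      exact (tsupport_mul_subset_right).trans hρs
    have hφi : IntegrableOn φ (Ioo a b) :=
      (h1.continuous.integrable_of_hasCompactSupport h2).integrableOn
    have hρi : IntegrableOn ρ (Ioo a b) :=
      (hρ.continuous.integrable_of_hasCompactSupport hρc).integrableOn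
    have hψ0 : ∫ z in Ioo a b, (φ z - I * ρ z) = 0 := by
      rw [integral_sub hφi (hρi.const_mul I), integral_const_mul, hρ1, mul_one, sub_self]
    obtain ⟨η, g1, g2, g3, g4⟩ := exists_compactSupport_primitive hab hψ hψc hψs hψ0
    have := h_zero η g1 g2 g3
    rw [g4] at this
    have e5 : ∫ z in Ioo a b, u z * (φ z - I * ρ z) =
        (∫ z in Ioo a b, u z * φ z) - I * C := by
      rw [← integral_const_mul, ← integral_sub (integrableOn_mul_of_continuous hu h1.continuous)
        ((integrableOn_mul_of_continuous hu hρ.continuous).const_mul I)]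
      congr 1; ext z; ring
    have e6 : ∫ x in Ioo a b, φ x * (u x - C) = (∫ z in Ioo a b, u z * φ z) - I * C := by
      rw [hI, ← integral_mul_const, ← integral_sub (integrableOn_mul_of_continuous hu h1.continuous)
        (hφi.mul_const C)]
      congr 1; ext z; ring
    rw [e0, e6, ← e5, this]

/-! ### A one-dimensional Carleman estimate, uniform in the frequency -/

/-- The pointwise inequality behind the Carleman estimate; `y = v'` and the last bracket is the
derivative of the boundary form. -/
theorem carleman_pointwise {a b l k z v y g dy : ℝ} (ha : 0 < a) (haz : a ≤ z) (hzb : z ≤ b)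
    (hl : 1 ≤ l)
    (hg : g = dy - 2 * l * z * y + (l ^ 2 * z ^ 2 - l - k ^ 2) * v) {T : ℝ}
    (hT : T = 1 / 4 + (3 * b ^ 2 + 2) / (8 * a ^ 2)) :
    l * ((y - l * z * v) ^ 2 + k ^ 2 * v ^ 2 + v ^ 2) ≤ (T + 1 / 2) * g ^ 2 +
      (l * (y * y + v * dy - l * v ^ 2 - 2 * l * z * v * y) -
        4 * T * (-l * y ^ 2 - 2 * l * z * y * dy - l * y ^ 2 - l * v * dy -
          l * (3 * l ^ 2 * z ^ 2 - k ^ 2) * v ^ 2 - 2 * l * (l ^ 2 * z ^ 2 - k ^ 2) * z * v * y)) := by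
  have hz0 : 0 < z := ha.trans_le haz
  -- The two summands of T play separate roles: 1/4 lets the term 8 l y² of the first identity pay
  -- for 2 l y², and the fraction lets 8 l³ z² v² pay for (3b² + 2) l³ v², since z ≥ a.
  have hT4 : 1 / 4 ≤ T := by rw [hT]; have : 0 ≤ (3 * b ^ 2 + 2) / (8 * a ^ 2) := by positivity
                             linarith
  have hTa : 3 * b ^ 2 + 2 ≤ T * (8 * a ^ 2) := by
    rw [hT, add_mul, div_mul_cancel₀ _ (by positivity)]; nlinarith [sq_nonneg a]
  have hdy : dy = g + 2 * l * z * y - (l ^ 2 * z ^ 2 - l - k ^ 2) * v := by rw [hg]; ring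
  -- the first multiplier identity
  have hA : 4 * (-l * y ^ 2 - 2 * l * z * y * dy - l * y ^ 2 - l * v * dy -
          l * (3 * l ^ 2 * z ^ 2 - k ^ 2) * v ^ 2 - 2 * l * (l ^ 2 * z ^ 2 - k ^ 2) * z * v * y) +
        8 * l * y ^ 2 + 8 * l ^ 3 * z ^ 2 * v ^ 2 ≤ g ^ 2 := by
    -- Split the conjugated operator as g = X - Y with symmetric part X = y' + (l²z² - k²) v and
    -- antisymmetric part Y = 2 l z y + l v. Then g² = (X + Y)² - 4XY, and -4XY is an exact
    -- derivative plus the two positive terms.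
    have : g ^ 2 - (4 * (-l * y ^ 2 - 2 * l * z * y * dy - l * y ^ 2 - l * v * dy -
          l * (3 * l ^ 2 * z ^ 2 - k ^ 2) * v ^ 2 - 2 * l * (l ^ 2 * z ^ 2 - k ^ 2) * z * v * y) +
        8 * l * y ^ 2 + 8 * l ^ 3 * z ^ 2 * v ^ 2) =
        ((dy + (l ^ 2 * z ^ 2 - k ^ 2) * v) + (2 * l * z * y + l * v)) ^ 2 := by
      rw [hg]; ring
    nlinarith [sq_nonneg ((dy + (l ^ 2 * z ^ 2 - k ^ 2) * v) + (2 * l * z * y + l * v))]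
  -- the second multiplier identity
  have hB : l * (y * y + v * dy - l * v ^ 2 - 2 * l * z * v * y) =
      l * y ^ 2 + l * (v * g) - l ^ 3 * z ^ 2 * v ^ 2 + l * k ^ 2 * v ^ 2 := by rw [hdy]; ring
  -- This costs only l² v², one power of l below what the first identity provides. The second
  -- identity is there to gain l k² v², which the first one lacks.
  have hvg : -(l * (v * g)) ≤ 1 / 2 * g ^ 2 + 1 / 2 * (l ^ 2 * v ^ 2) := by
    nlinarith [sq_nonneg (g + l * v)]
  have hl2 : l ^ 2 ≤ l ^ 3 := by nlinarith [sq_nonneg l]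
  have hl3 : l ≤ l ^ 3 := by nlinarith [sq_nonneg l]
  have hzz : z ^ 2 ≤ b ^ 2 := by nlinarith
  have haa : a ^ 2 ≤ z ^ 2 := by nlinarith
  have hv2 := sq_nonneg v
  have s1 : l * (y - l * z * v) ^ 2 ≤ 2 * l * y ^ 2 + 2 * (l ^ 3 * z ^ 2 * v ^ 2) := by
    nlinarith [mul_nonneg (zero_le_one.trans hl) (sq_nonneg (y + l * z * v))]
  have p3 : 0 ≤ l ^ 3 * v ^ 2 := by positivity
  have s2 : l ^ 3 * z ^ 2 * v ^ 2 ≤ b ^ 2 * (l ^ 3 * v ^ 2) := by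
    have := mul_le_mul_of_nonneg_right hzz p3
    linarith
  have s3 : l ^ 2 * v ^ 2 ≤ l ^ 3 * v ^ 2 := mul_le_mul_of_nonneg_right hl2 hv2
  have s4 : l * v ^ 2 ≤ l ^ 3 * v ^ 2 := mul_le_mul_of_nonneg_right hl3 hv2
  have s5 : (3 * b ^ 2 + 2) * (l ^ 3 * v ^ 2) ≤ T * (8 * l ^ 3 * z ^ 2 * v ^ 2) := by
    calc (3 * b ^ 2 + 2) * (l ^ 3 * v ^ 2) ≤ (T * (8 * a ^ 2)) * (l ^ 3 * v ^ 2) :=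
          mul_le_mul_of_nonneg_right hTa p3
      _ ≤ (T * (8 * z ^ 2)) * (l ^ 3 * v ^ 2) := by
          apply mul_le_mul_of_nonneg_right _ p3
          apply mul_le_mul_of_nonneg_left _ (by linarith)
          linarith
      _ = _ := by ring
  have s6 : 2 * (l * y ^ 2) ≤ T * (8 * l * y ^ 2) := by
    have h0 : 0 ≤ l * y ^ 2 := by positivity
    have := mul_le_mul_of_nonneg_right hT4 h0
    linarith
  have hTA := mul_le_mul_of_nonneg_left hA (show 0 ≤ T by linarith)
  have hTA' : T * (8 * l * y ^ 2) + T * (8 * l ^ 3 * z ^ 2 * v ^ 2) ≤ T * g ^ 2 - 4 * T *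
      (-l * y ^ 2 - 2 * l * z * y * dy - l * y ^ 2 - l * v * dy -
          l * (3 * l ^ 2 * z ^ 2 - k ^ 2) * v ^ 2 -
          2 * l * (l ^ 2 * z ^ 2 - k ^ 2) * z * v * y) := by linarith
  rw [hB]
  generalize (-l * y ^ 2 - 2 * l * z * y * dy - l * y ^ 2 - l * v * dy -
          l * (3 * l ^ 2 * z ^ 2 - k ^ 2) * v ^ 2 -
          2 * l * (l ^ 2 * z ^ 2 - k ^ 2) * z * v * y) = Q at *
  have e1 : l * ((y - l * z * v) ^ 2 + k ^ 2 * v ^ 2 + v ^ 2) =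
    l * (y - l * z * v) ^ 2 + l * k ^ 2 * v ^ 2 + l * v ^ 2 := by ring
  have e2 : (3 * b ^ 2 + 2) * (l ^ 3 * v ^ 2) =
    3 * (b ^ 2 * (l ^ 3 * v ^ 2)) + 2 * (l ^ 3 * v ^ 2) := by ring
  have e3 : (T + 1 / 2) * g ^ 2 = T * g ^ 2 + 1 / 2 * g ^ 2 := by ring
  rw [e1, e3]
  rw [e2] at s5
  have s7 : 0 ≤ l * y ^ 2 := by positivity
  linarith

section Form

variable {a b : ℝ}

/-- The boundary form of the Carleman estimate. -/
def carlemanForm (l k T z v y : ℝ) : ℝ :=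
  l * (v * y - l * z * v ^ 2) -
    4 * T * (-l * z * y ^ 2 - l * v * y - l * (l ^ 2 * z ^ 2 - k ^ 2) * z * v ^ 2)

/-- The frequency enters the form only through -4 T l k² z v², which has a good sign at the top. The
bound is therefore uniform in k, and no tangential derivative of the Dirichlet datum is needed. -/
theorem carlemanForm_top_le {l k T s c V : ℝ} (hb : 0 < b) (hl : 1 ≤ l) (hT : 0 ≤ T) :
    carlemanForm l k T b (s * c) (s * (V + l * b * c)) ≤
      (l + 4 * T * l * (b + 1 + l ^ 2 * b ^ 3)) * s ^ 2 * (3 + 2 * l ^ 2 * b ^ 2) *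
        (c ^ 2 + V ^ 2) := by
  set v := s * c with hv
  set y := s * (V + l * b * c) with hy
  have hl0 : 0 < l := by linarith
  have hy2 : y ^ 2 ≤ s ^ 2 * (2 * V ^ 2 + 2 * l ^ 2 * b ^ 2 * c ^ 2) := by
    rw [hy]; nlinarith [mul_nonneg (sq_nonneg s) (sq_nonneg (V - l * b * c))]
  have hv2 : v ^ 2 = s ^ 2 * c ^ 2 := by rw [hv]; ring
  have h1 : v * y ≤ v ^ 2 + y ^ 2 := by nlinarith [sq_nonneg (v - y), sq_nonneg v, sq_nonneg y]
  have h2 : carlemanForm l k T b v y ≤ (l + 4 * T * l * (b + 1 + l ^ 2 * b ^ 3)) * (v ^ 2 + y ^ 2) := by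
    unfold carlemanForm
    have q1 : 0 ≤ T * l * k ^ 2 * b * v ^ 2 := by positivity
    have q2 : 0 ≤ l * b * l * v ^ 2 := by positivity
    have q3 : 0 ≤ T * l * b * v ^ 2 := by positivity
    have q4 : 0 ≤ T * l * (l ^ 2 * b ^ 3) * y ^ 2 := by positivity
    have q5 := mul_le_mul_of_nonneg_left h1 hl0.le
    have q6 := mul_le_mul_of_nonneg_left h1 (show 0 ≤ 4 * T * l by positivity)
    nlinarith
  refine h2.trans ?_
  rw [mul_assoc _ (s ^ 2), mul_assoc _ (s ^ 2 * _)]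
  apply mul_le_mul_of_nonneg_left _ (by positivity)
  rw [hv2]
  have q0 := sq_nonneg s
  have : s ^ 2 * c ^ 2 + s ^ 2 * (2 * V ^ 2 + 2 * l ^ 2 * b ^ 2 * c ^ 2) ≤
      s ^ 2 * ((3 + 2 * l ^ 2 * b ^ 2) * (c ^ 2 + V ^ 2)) := by
    rw [← mul_add]
    apply mul_le_mul_of_nonneg_left _ q0
    have : 0 ≤ l ^ 2 * b ^ 2 * V ^ 2 := by positivity
    nlinarith [sq_nonneg c, sq_nonneg V]
  linarith

/-- The weight of the Carleman estimate. -/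
def carlemanWeight (l z : ℝ) : ℝ := Real.exp (l * z ^ 2)

theorem contDiff_carlemanWeight (l : ℝ) : ContDiff ℝ ∞ (carlemanWeight l) := by
  unfold carlemanWeight
  fun_prop

theorem carlemanWeight_pos (l z : ℝ) : 0 < carlemanWeight l z := Real.exp_pos _

/-- The constant in front of the right-hand side of the Carleman estimate. -/
def carlemanConst (a b : ℝ) : ℝ := 1 / 4 + (3 * b ^ 2 + 2) / (8 * a ^ 2) + 1 / 2

/-- The constant in front of the Cauchy data in the Carleman estimate. -/
def carlemanDataConst (a b l : ℝ) : ℝ :=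
  (l + 4 * (1 / 4 + (3 * b ^ 2 + 2) / (8 * a ^ 2)) * l * (b + 1 + l ^ 2 * b ^ 3)) *
    carlemanWeight l b * (3 + 2 * l ^ 2 * b ^ 2)

theorem carlemanConst_pos : 0 < carlemanConst a b := by
  unfold carlemanConst; positivity

theorem carlemanDataConst_pos (hb : 0 < b) {l : ℝ} (hl : 1 ≤ l) : 0 < carlemanDataConst a b l := by
  have := carlemanWeight_pos l b
  unfold carlemanDataConst; positivity

theorem integrable_mul_sq_of_continuousOn {f w : ℝ → ℝ} (hw : ContinuousOn w (Icc a b))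
    (hf : MemLp f 2 (volume.restrict (Ioo a b))) :
    IntegrableOn (fun z => w z * f z ^ 2) (Ioo a b) := by
  obtain ⟨C, hC⟩ := isCompact_Icc.exists_bound_of_continuousOn hw
  refine Integrable.bdd_mul (c := C) hf.integrable_sq
    ((hw.mono Ioo_subset_Icc_self).aestronglyMeasurable measurableSet_Ioo) ?_
  filter_upwards [ae_restrict_mem measurableSet_Ioo] with z hz using hC z (Ioo_subset_Icc_self hz)

/-- Integrate `carleman_pointwise` for v = s c, where s² is the weight. The boundary form is
nonnegative at a because c vanishes there, and at b it is bounded by the Cauchy data. Neither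
constant depends on k. -/
theorem carleman_estimate (ha : 0 < a) (hab : a < b) {l : ℝ} (hl : 1 ≤ l) (k : ℝ)
    {c V W : ℝ → ℝ} (hc : AbsolutelyContinuousOnInterval c a b)
    (hV : AbsolutelyContinuousOnInterval V a b)
    (hcV : ∀ᵐ z, z ∈ Icc a b → HasDerivAt c (V z) z)
    (hVW : ∀ᵐ z, z ∈ Icc a b → HasDerivAt V (W z) z) (hca : c a = 0)
    (hW : MemLp W 2 (volume.restrict (Ioo a b))) :
    l * ∫ z in Ioo a b, carlemanWeight l z * (V z ^ 2 + k ^ 2 * c z ^ 2 + c z ^ 2) ≤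
      carlemanConst a b * (∫ z in Ioo a b, carlemanWeight l z * (W z - k ^ 2 * c z) ^ 2) +
        carlemanDataConst a b l * (c b ^ 2 + V b ^ 2) := by
  have hb : 0 < b := ha.trans hab
  set T : ℝ := 1 / 4 + (3 * b ^ 2 + 2) / (8 * a ^ 2) with hT
  have hT0 : 0 ≤ T := by positivity
  set s : ℝ → ℝ := fun z => Real.exp (l * z ^ 2 / 2) with hs
  have hs2 : ∀ z, s z ^ 2 = carlemanWeight l z := by
    intro z
    simp only [hs, carlemanWeight, sq, ← Real.exp_add]
    congr 1; ring
  have hsd : ∀ z, HasDerivAt s (l * z * s z) z := by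
    intro z
    have h1 : HasDerivAt (fun z : ℝ => l * z ^ 2 / 2) (l * z) z := by
      have := (((hasDerivAt_id z).pow 2).const_mul l).div_const 2
      refine this.congr_deriv ?_
      simp; ring
    have := h1.exp
    simp only [hs]
    refine this.congr_deriv ?_
    ring
  have hsC : ContDiff ℝ ∞ s := by simp only [hs]; fun_prop
  have hcc : ContinuousOn c (Icc a b) := by simpa [uIcc_of_le hab.le] using hc.continuousOn
  have hVc : ContinuousOn V (Icc a b) := by simpa [uIcc_of_le hab.le] using hV.continuousOn
  set v : ℝ → ℝ := fun z => s z * c z with hv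
  set y : ℝ → ℝ := fun z => s z * (V z + l * z * c z) with hy
  have hACs := contDiff_absolutelyContinuousOnInterval hsC a b
  have hACz : AbsolutelyContinuousOnInterval (fun z : ℝ => z) a b :=
    contDiff_absolutelyContinuousOnInterval contDiff_id a b
  have hvAC : AbsolutelyContinuousOnInterval v a b := hACs.mul hc
  have hyAC : AbsolutelyContinuousOnInterval y a b :=
    hACs.mul (hV.add ((hACz.const_mul l).mul hc))
  have hΘAC : AbsolutelyContinuousOnInterval
      (fun z => carlemanForm l k T z (v z) (y z)) a b := by
    -- Rewritten as sums and products of absolutely continuous functions, the form itself is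
    -- absolutely continuous, so it is the integral of its derivative.
    have e : (fun z => carlemanForm l k T z (v z) (y z)) =
        fun z => l * (v z * y z - l * (z * (v z * v z))) -
        4 * T * ((-l) * (z * (y z * y z)) - l * (v z * y z) -
          l * ((l ^ 2 * (z * z) - k ^ 2) * (z * (v z * v z)))) := by
      ext z; unfold carlemanForm; ring
    have hk : AbsolutelyContinuousOnInterval (fun _ : ℝ => k ^ 2) a b :=
      contDiff_absolutelyContinuousOnInterval contDiff_const a b
    rw [e]
    have hvy := hvAC.mul hyAC
    have hzvv := hACz.mul (hvAC.mul hvAC)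
    have hzyy := hACz.mul (hyAC.mul hyAC)
    exact ((hvy.sub (hzvv.const_mul l)).const_mul l).sub
      ((((hzyy.const_mul (-l)).sub (hvy.const_mul l)).sub
        (((((hACz.mul hACz).const_mul (l ^ 2)).sub hk).mul hzvv).const_mul l)).const_mul (4 * T))
  have hint := hΘAC.integral_deriv_eq_sub
  -- Since v(a) = 0, only 4 T l a y(a)² survives, with the sign that allows it to be dropped.
  have hΘa : 0 ≤ carlemanForm l k T a (v a) (y a) := by
    have : v a = 0 := by simp [hv, hca]
    rw [this]; unfold carlemanForm
    have : 0 ≤ T * (l * a * y a ^ 2) := by positivity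
    nlinarith
  have hΘb := carlemanForm_top_le (b := b) (k := k) (s := s b) (c := c b) (V := V b) hb hl hT0
  have hpt : ∀ᵐ z ∂(volume.restrict (Ioo a b)),
      l * (carlemanWeight l z * (V z ^ 2 + k ^ 2 * c z ^ 2 + c z ^ 2)) ≤
      carlemanConst a b * (carlemanWeight l z * (W z - k ^ 2 * c z) ^ 2) +
        deriv (fun z => carlemanForm l k T z (v z) (y z)) z := by
    rw [ae_restrict_iff' measurableSet_Ioo]
    filter_upwards [hcV, hVW] with z h1 h2 hz
    have hz' := Ioo_subset_Icc_self hz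
    have hcd := h1 hz'
    have hVd := h2 hz'
    have hzd := hasDerivAt_id' z
    have hvd : HasDerivAt v (y z) z := by
      refine ((hsd z).mul hcd).congr_deriv ?_
      simp only [hy]; ring
    have hyd : HasDerivAt y (s z * (W z + 2 * l * z * V z + (l + l ^ 2 * z ^ 2) * c z)) z := by
      refine ((hsd z).mul (hVd.add ((hzd.const_mul l).mul hcd))).congr_deriv ?_
      simp; ring
    set dy := s z * (W z + 2 * l * z * V z + (l + l ^ 2 * z ^ 2) * c z) with hdy
    have hΘd : HasDerivAt (fun z => carlemanForm l k T z (v z) (y z))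
        (l * (y z * y z + v z * dy - l * v z ^ 2 - 2 * l * z * v z * y z) -
        4 * T * (-l * y z ^ 2 - 2 * l * z * y z * dy - l * y z ^ 2 - l * v z * dy -
          l * (3 * l ^ 2 * z ^ 2 - k ^ 2) * v z ^ 2 -
          2 * l * (l ^ 2 * z ^ 2 - k ^ 2) * z * v z * y z)) z := by
      unfold carlemanForm
      have A := ((hvd.mul hyd).sub ((hzd.const_mul l).mul (hvd.pow 2))).const_mul l
      have Bq := ((((hzd.const_mul (-l)).mul (hyd.pow 2)).sub ((hvd.const_mul l).mul hyd)).sub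
        (((((hzd.pow 2).const_mul (l ^ 2)).sub_const (k ^ 2)).const_mul l).mul hzd |>.mul
          (hvd.pow 2))).const_mul (4 * T)
      refine (A.sub Bq).congr_deriv ?_
      simp; ring
    rw [hΘd.deriv]
    -- For v = s c, conjugation gives s (c'' - k² c) = v'' - 2 l z v' + (l² z² - l - k²) v, which is
    -- the required relation between g, v, y and dy.
    have := carleman_pointwise (a := a) (b := b) (l := l) (k := k) (z := z) (v := v z) (y := y z)
      (g := s z * (W z - k ^ 2 * c z)) (dy := dy) ha hz'.1 hz'.2 hl
      (by simp only [hdy, hv, hy]; ring) hT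
    have e1 : l * (carlemanWeight l z * (V z ^ 2 + k ^ 2 * c z ^ 2 + c z ^ 2)) =
        l * ((y z - l * z * v z) ^ 2 + k ^ 2 * v z ^ 2 + v z ^ 2) := by
      rw [← hs2]; simp only [hv, hy]; ring
    have e2 : carlemanConst a b * (carlemanWeight l z * (W z - k ^ 2 * c z) ^ 2) =
        (T + 1 / 2) * (s z * (W z - k ^ 2 * c z)) ^ 2 := by
      rw [← hs2, carlemanConst, ← hT]; ring
    rw [e1, e2]; exact this
  have hwc := (contDiff_carlemanWeight l).continuous.continuousOn (s := Icc a b)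
  have hi1 : IntegrableOn (fun z => carlemanWeight l z * (V z ^ 2 + k ^ 2 * c z ^ 2 + c z ^ 2))
      (Ioo a b) := by
    have : ContinuousOn (fun z => carlemanWeight l z * (V z ^ 2 + k ^ 2 * c z ^ 2 + c z ^ 2))
      (Icc a b) := by fun_prop
    exact this.integrableOn_Icc.mono_set Ioo_subset_Icc_self
  have hcL : MemLp c 2 (volume.restrict (Ioo a b)) := by
    obtain ⟨C, hC⟩ := isCompact_Icc.exists_bound_of_continuousOn hcc
    refine MemLp.of_bound ((hcc.mono Ioo_subset_Icc_self).aestronglyMeasurable measurableSet_Ioo) C ?_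
    filter_upwards [ae_restrict_mem measurableSet_Ioo] with z hz using hC z (Ioo_subset_Icc_self hz)
  have hi2 : IntegrableOn (fun z => carlemanWeight l z * (W z - k ^ 2 * c z) ^ 2) (Ioo a b) :=
    integrable_mul_sq_of_continuousOn hwc (hW.sub (hcL.const_mul (k ^ 2)))
  have hi3 : IntegrableOn (deriv (fun z => carlemanForm l k T z (v z) (y z))) (Ioo a b) := by
    have := hΘAC.intervalIntegrable_deriv
    rwa [intervalIntegrable_iff_integrableOn_Ioo_of_le hab.le] at this
  have := integral_mono_ae (hi1.const_mul l) ((hi2.const_mul (carlemanConst a b)).add hi3) hpt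
  simp only [Pi.add_apply] at this
  rw [integral_const_mul, integral_add (hi2.const_mul _) hi3, integral_const_mul,
    setIntegral_Ioo_eq_intervalIntegral hab.le (deriv _), hint] at this
  have e : carlemanDataConst a b l * (c b ^ 2 + V b ^ 2) =
      (l + 4 * T * l * (b + 1 + l ^ 2 * b ^ 3)) * s b ^ 2 * (3 + 2 * l ^ 2 * b ^ 2) *
        (c b ^ 2 + V b ^ 2) := by
    rw [hs2, carlemanDataConst, ← hT]
  rw [e]
  linarith

end Form

/-! ### Parseval's identity for mixed sine and cosine products on a cube -/

/-- The function `cos (n θ)` or `sin (n θ)` with `θ = π (t + B) / (2 B)`. -/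
def trig (B : ℝ) (isCos : Bool) (n : ℤ) (t : ℝ) : ℝ :=
  if isCos then Real.cos (n * (Real.pi * (t + B) / (2 * B)))
  else Real.sin (n * (Real.pi * (t + B) / (2 * B)))

/-- The products of sines and cosines; `σ` marks the coordinates that carry a cosine. -/
def trigProd {m : ℕ} (B : ℝ) (σ : Fin m → Bool) (n : Fin m → ℤ) (y : E m) : ℝ :=
  ∏ j, trig B (σ j) (n j) (y j)

theorem abs_trig_le_one (B : ℝ) (s : Bool) (n : ℤ) (t : ℝ) : |trig B s n t| ≤ 1 := by
  unfold trig
  split_ifs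
  · exact Real.abs_cos_le_one _
  · exact Real.abs_sin_le_one _

theorem contDiff_trig (B : ℝ) (s : Bool) (n : ℤ) : ContDiff ℝ ∞ (trig B s n) := by
  unfold trig
  cases s
  · simp only [Bool.false_eq_true, if_false]; fun_prop
  · simp only [if_true]; fun_prop

theorem continuous_trigProd {m : ℕ} (B : ℝ) (σ : Fin m → Bool) (n : Fin m → ℤ) :
    Continuous (trigProd B σ n) := by
  unfold trigProd
  refine continuous_finsetProd _ fun j _ => ?_
  have h := (contDiff_trig B (σ j) (n j)).continuous
  have h2 : Continuous fun y : E m => y j := by fun_prop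
  exact h.comp h2

theorem abs_trigProd_le_one {m : ℕ} (B : ℝ) (σ : Fin m → Bool) (n : Fin m → ℤ) (y : E m) :
    |trigProd B σ n y| ≤ 1 := by
  unfold trigProd
  rw [Finset.abs_prod]
  exact Finset.prod_le_one (fun _ _ => abs_nonneg _) fun j _ => abs_trig_le_one _ _ _ _

section Torus

-- Fourier series on the torus are taken with respect to the Haar probability measure, so `volume`
-- is made to denote that measure here.
local instance : MeasureSpace UnitAddCircle := ⟨AddCircle.haarAddCircle⟩

local instance : Measure.IsAddHaarMeasure (volume : Measure UnitAddCircle) :=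
  inferInstanceAs (Measure.IsAddHaarMeasure AddCircle.haarAddCircle)

local instance : IsProbabilityMeasure (volume : Measure UnitAddCircle) :=
  inferInstanceAs (IsProbabilityMeasure AddCircle.haarAddCircle)

/-- The two-to-one map of the circle onto `[-B,B]`. -/
def fold1 (B : ℝ) (x : UnitAddCircle) : ℝ := 4 * B * ‖x‖ - B

theorem continuous_fold1 (B : ℝ) : Continuous (fold1 B) := by unfold fold1; fun_prop

theorem volume_closedBall_unitAddCircle (r : ℝ) :
    (volume : Measure UnitAddCircle) (Metric.closedBall 0 r) = ENNReal.ofReal (min 1 (2 * r)) := by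
  have h := AddCircle.volume_closedBall (T := 1) (x := 0) r
  rw [AddCircle.volume_eq_smul_haarAddCircle, ENNReal.ofReal_one, one_smul] at h
  exact h

/-- Finite measures on the line are determined by half-lines, and the preimage of a half-line under
the folding map is a ball centred at 0, whose measure is explicit. -/
theorem map_fold1 {B : ℝ} (hB : 0 < B) :
    (volume : Measure UnitAddCircle).map (fold1 B) =
      (ENNReal.ofReal (2 * B))⁻¹ • (volume : Measure ℝ).restrict (Ioo (-B) B) := by
  have hm := (continuous_fold1 B).measurable
  have : IsProbabilityMeasure ((volume : Measure UnitAddCircle).map (fold1 B)) :=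
    Measure.isProbabilityMeasure_map hm.aemeasurable
  apply Measure.ext_of_Iic
  intro t
  rw [Measure.map_apply hm measurableSet_Iic]
  have e1 : fold1 B ⁻¹' Iic t = Metric.closedBall 0 ((t + B) / (4 * B)) := by
    ext x
    simp only [fold1, mem_preimage, mem_Iic, Metric.mem_closedBall, dist_zero_right]
    rw [le_div_iff₀ (by positivity)]
    constructor <;> intro h <;> linarith
  rw [e1, volume_closedBall_unitAddCircle, Measure.smul_apply, Measure.restrict_apply measurableSet_Iic,
    smul_eq_mul]
  have e2 : volume (Iic t ∩ Ioo (-B) B) = ENNReal.ofReal (min (2 * B) (t + B)) := by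
    rw [Measure.restrict_apply measurableSet_Iic |>.symm,
      Measure.restrict_congr_set (Ioo_ae_eq_Ioc (a := -B) (b := B)),
      Measure.restrict_apply measurableSet_Iic]
    have : Iic t ∩ Ioc (-B) B = Ioc (-B) (min B t) := by
      ext x; simp only [mem_inter_iff, mem_Iic, mem_Ioc, le_min_iff]; tauto
    rw [this, Real.volume_Ioc]
    congr 1
    rw [sub_neg_eq_add, ← min_add_add_right]
    ring_nf
  rw [e2, ← ENNReal.ofReal_inv_of_pos (by positivity), ← ENNReal.ofReal_mul (by positivity)]
  congr 1
  rw [mul_min_of_nonneg _ _ (by positivity)]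
  congr 1
  · field_simp
  · field_simp; ring

/-- The map of the torus onto the closed cube that folds every coordinate. -/
def fold (m : ℕ) (B : ℝ) (x : UnitAddTorus (Fin m)) : E m :=
  WithLp.toLp 2 fun j => fold1 B (x j)

theorem cube_eq_preimage (m : ℕ) (B : ℝ) :
    (WithLp.toLp 2 : (Fin m → ℝ) → E m) ⁻¹' cube m B = univ.pi fun _ => Ioo (-B) B := by
  ext x; simp [cube]

theorem measurableSet_cube (m : ℕ) (B : ℝ) : MeasurableSet (cube m B) := by
  have : cube m B = ⋂ i, (fun y : E m => y i) ⁻¹' Ioo (-B) B := by ext y; simp [cube]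
  rw [this]
  refine MeasurableSet.iInter fun i => ?_
  have : Measurable fun y : E m => y i := by fun_prop
  exact this measurableSet_Ioo

theorem measurePreserving_fold (m : ℕ) {B : ℝ} (hB : 0 < B) :
    MeasurePreserving (fold m B) volume
      ((ENNReal.ofReal (2 * B))⁻¹ ^ m • (volume : Measure (E m)).restrict (cube m B)) := by
  have h1 : MeasurePreserving (fun (x : UnitAddTorus (Fin m)) j => fold1 B (x j)) volume
      (Measure.pi fun _ : Fin m =>
        (ENNReal.ofReal (2 * B))⁻¹ • (volume : Measure ℝ).restrict (Ioo (-B) B)) := by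
    have : SigmaFinite ((ENNReal.ofReal (2 * B))⁻¹ • (volume : Measure ℝ).restrict (Ioo (-B) B)) := by
      rw [← map_fold1 hB]
      have : IsProbabilityMeasure ((volume : Measure UnitAddCircle).map (fold1 B)) :=
        Measure.isProbabilityMeasure_map (continuous_fold1 B).measurable.aemeasurable
      infer_instance
    exact measurePreserving_pi _ _ fun _ => ⟨(continuous_fold1 B).measurable, map_fold1 hB⟩
  have hfin : (ENNReal.ofReal (2 * B))⁻¹ ≠ ⊤ := by
    rw [ne_eq, ENNReal.inv_eq_top, ENNReal.ofReal_eq_zero, not_le]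
    positivity
  have h2 : (Measure.pi fun _ : Fin m =>
        (ENNReal.ofReal (2 * B))⁻¹ • (volume : Measure ℝ).restrict (Ioo (-B) B)) =
      (ENNReal.ofReal (2 * B))⁻¹ ^ m •
        (volume : Measure (Fin m → ℝ)).restrict (univ.pi fun _ => Ioo (-B) B) := by
    have : IsFiniteMeasure
        ((ENNReal.ofReal (2 * B))⁻¹ • (volume : Measure ℝ).restrict (Ioo (-B) B)) :=
      Measure.smul_finite _ hfin
    apply Measure.pi_eq
    intro s hs
    rw [volume_pi, Measure.restrict_pi_pi]
    simp [Measure.smul_apply, Measure.pi_pi, Finset.prod_mul_distrib]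
  rw [h2] at h1
  have h3 := ((PiLp.volume_preserving_toLp (ι := Fin m)).restrict_preimage
    (measurableSet_cube m B))
  rw [cube_eq_preimage] at h3
  exact (h3.smul_measure ((ENNReal.ofReal (2 * B))⁻¹ ^ m)).comp h1

/-! ### Parity and reflection on the torus. -/

theorem exists_rep (x : UnitAddCircle) : ∃ r : ℝ, (r : UnitAddCircle) = x ∧ |r| ≤ 1 / 2 ∧ ‖x‖ = |r| := by
  obtain ⟨s, rfl⟩ := QuotientAddGroup.mk_surjective x
  refine ⟨s - round s, ?_, abs_sub_round s, UnitAddCircle.norm_eq⟩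
  have : ((round s : ℝ) : UnitAddCircle) = 0 := by
    rw [AddCircle.coe_eq_zero_iff]; exact ⟨round s, by simp⟩
  rw [AddCircle.coe_sub, this, sub_zero]

/-- The sign of `sin (2 π x)` for a sine factor, the constant `1` for a cosine factor. -/
def parity (isCos : Bool) (x : UnitAddCircle) : ℝ :=
  if isCos then 1 else SignType.sign (fourier 1 x).im

theorem fourier_coe_eq (n : ℤ) (r : ℝ) : fourier n (r : UnitAddCircle) =
    (Real.cos (2 * Real.pi * n * r) : ℂ) + (Real.sin (2 * Real.pi * n * r) : ℂ) * Complex.I := by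
  rw [fourier_coe_apply]
  have : 2 * (Real.pi : ℂ) * Complex.I * n * r / (1 : ℝ) =
      ((2 * Real.pi * n * r : ℝ) : ℂ) * Complex.I := by
    push_cast; ring
  rw [this, Complex.exp_mul_I, Complex.ofReal_cos, Complex.ofReal_sin]

theorem fourier_coe_im (n : ℤ) (r : ℝ) :
    (fourier n (r : UnitAddCircle)).im = Real.sin (2 * Real.pi * n * r) := by
  rw [fourier_coe_eq, Complex.add_im, Complex.ofReal_im, Complex.mul_im]
  simp only [Complex.ofReal_im, Complex.ofReal_re, Complex.I_im, Complex.I_re]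
  ring

theorem trig_fold1 {B : ℝ} (hB : 0 < B) (s : Bool) (n : ℤ) (r : ℝ) (x : UnitAddCircle)
    (h : ‖x‖ = |r|) : trig B s n (fold1 B x) =
      if s then Real.cos (2 * Real.pi * n * |r|) else Real.sin (2 * Real.pi * n * |r|) := by
  have : (n : ℝ) * (Real.pi * (fold1 B x + B) / (2 * B)) = 2 * Real.pi * n * |r| := by
    rw [fold1, h]; field_simp; ring
  unfold trig; rw [this]

/-- The sine is odd, so multiplying by the sign of `sin (2πr)` replaces r by |r|. At r = 0 and r =
±1/2 that sign is 0, and so is the right-hand side. -/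
theorem sign_sin_mul {r : ℝ} (hr : |r| ≤ 1 / 2) (n : ℤ) :
    (SignType.sign (Real.sin (2 * Real.pi * (1 : ℤ) * r)) : ℝ) * Real.sin (2 * Real.pi * n * r) =
      Real.sin (2 * Real.pi * n * |r|) := by
  have hpi := Real.pi_pos
  obtain ⟨h1, h2⟩ := abs_le.1 hr
  rcases lt_trichotomy r 0 with h | h | h
  · rcases eq_or_lt_of_le h1 with h3 | h3
    · have e1 : Real.sin (2 * Real.pi * n * |r|) = 0 := by
        have : 2 * Real.pi * n * |r| = n * Real.pi := by rw [abs_of_neg h, ← h3]; ring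
        rw [this, Real.sin_int_mul_pi]
      have e2 : 2 * Real.pi * (1 : ℤ) * r = - Real.pi := by rw [← h3]; push_cast; ring
      rw [e1, e2]; simp
    · have : Real.sin (2 * Real.pi * (1 : ℤ) * r) < 0 :=
        Real.sin_neg_of_neg_of_neg_pi_lt (by push_cast; nlinarith) (by push_cast; nlinarith)
      rw [sign_neg this, abs_of_neg h]
      simp
  · simp [h]
  · rcases eq_or_lt_of_le h2 with h3 | h3
    · have e1 : Real.sin (2 * Real.pi * n * |r|) = 0 := by
        have : 2 * Real.pi * n * |r| = n * Real.pi := by rw [abs_of_pos h, h3]; ring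
        rw [this, Real.sin_int_mul_pi]
      have e2 : 2 * Real.pi * (1 : ℤ) * r = Real.pi := by rw [h3]; push_cast; ring
      rw [e1, e2]; simp
    · have : 0 < Real.sin (2 * Real.pi * (1 : ℤ) * r) :=
        Real.sin_pos_of_pos_of_lt_pi (by push_cast; nlinarith) (by push_cast; nlinarith)
      rw [sign_pos this, abs_of_pos h]
      simp

/-- The even part of a Fourier monomial times its parity factor. -/
theorem even_part_fourier {B : ℝ} (hB : 0 < B) (s : Bool) (n : ℤ) (x : UnitAddCircle) :
    (parity s x : ℂ) * fourier (-n) x + (parity s (-x) : ℂ) * fourier (-n) (-x) =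
      2 * ((if s then 1 else -Complex.I) * (trig B s n (fold1 B x) : ℂ)) := by
  obtain ⟨r, rfl, hr, hn⟩ := exists_rep x
  rw [trig_fold1 hB s n r _ hn, ← AddCircle.coe_neg]
  cases s
  · simp only [parity, Bool.false_eq_true, if_false, fourier_coe_im]
    rw [← sign_sin_mul hr n]
    have e : (SignType.sign (Real.sin (2 * Real.pi * (1 : ℤ) * -r)) : ℝ) =
        -(SignType.sign (Real.sin (2 * Real.pi * (1 : ℤ) * r)) : ℝ) := by
      rw [mul_neg, Real.sin_neg, Left.sign_neg]; simp
    rw [e, fourier_coe_eq, fourier_coe_eq]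
    have c1 : (2 * Real.pi * ((-n : ℤ) : ℝ) * r) = -(2 * Real.pi * n * r) := by push_cast; ring
    have c2 : (2 * Real.pi * ((-n : ℤ) : ℝ) * -r) = 2 * Real.pi * n * r := by push_cast; ring
    rw [c1, c2, Real.cos_neg, Real.sin_neg]
    push_cast
    ring
  · simp only [parity, if_true]
    have : Real.cos (2 * Real.pi * n * |r|) = Real.cos (2 * Real.pi * n * r) := by
      rcases abs_choice r with h | h <;> rw [h]
      rw [mul_neg, Real.cos_neg]
    rw [this, fourier_coe_eq, fourier_coe_eq]
    have c1 : (2 * Real.pi * ((-n : ℤ) : ℝ) * r) = -(2 * Real.pi * n * r) := by push_cast; ring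
    have c2 : (2 * Real.pi * ((-n : ℤ) : ℝ) * -r) = 2 * Real.pi * n * r := by push_cast; ring
    rw [c1, c2, Real.cos_neg, Real.sin_neg]
    push_cast
    ring

/-- The sign can vanish only at the fixed points 0 and 1/2 of the reflection, and these are folded
onto the ends -B and B. -/
theorem parity_sq {B : ℝ} (hB : 0 < B) (s : Bool) (x : UnitAddCircle) (hx : fold1 B x ∈ Ioo (-B) B) :
    parity s x ^ 2 = 1 := by
  obtain ⟨r, rfl, hr, hn⟩ := exists_rep x
  cases s
  · simp only [parity, Bool.false_eq_true, if_false, fourier_coe_im]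
    have h := sign_sin_mul hr 1
    have h0 : 0 < |r| := by
      have := hx.1; rw [fold1, hn] at this; by_contra hc; nlinarith [abs_nonneg r]
    have h1 : |r| < 1 / 2 := by
      have := hx.2; rw [fold1, hn] at this; by_contra hc; nlinarith
    have hpi := Real.pi_pos
    have hpos : 0 < Real.sin (2 * Real.pi * (1 : ℤ) * |r|) :=
      Real.sin_pos_of_pos_of_lt_pi (by push_cast; positivity) (by push_cast; nlinarith)
    rcases lt_trichotomy (Real.sin (2 * Real.pi * (1 : ℤ) * r)) 0 with h2 | h2 | h2
    · rw [sign_neg h2]; simp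
    · rw [h2] at h; simp at h; simp at hpos; linarith
    · rw [sign_pos h2]; simp
  · simp [parity]

theorem measurable_parity (s : Bool) : Measurable (parity s) := by
  unfold parity
  cases s
  · simp only [Bool.false_eq_true, if_false]
    have h1 : Measurable fun x : UnitAddCircle => (fourier 1 x).im :=
      (Complex.continuous_im.comp (fourier 1).continuous).measurable
    have h2 : Measurable fun t : ℝ => (SignType.sign t : ℝ) := by
      have : (fun t : ℝ => (SignType.sign t : ℝ)) = fun t => if 0 < t then 1 else if t < 0 then -1 else 0 := by
        ext t
        rcases lt_trichotomy t 0 with h | h | h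
        · simp [sign_neg h, h, h.not_gt]
        · simp [h]
        · simp [sign_pos h, h]
      rw [this]
      exact Measurable.ite measurableSet_Ioi measurable_const
        (Measurable.ite measurableSet_Iio measurable_const measurable_const)
    exact h2.comp h1
  · simp

theorem abs_parity_le (s : Bool) (x : UnitAddCircle) : |parity s x| ≤ 1 := by
  unfold parity
  split_ifs
  · simp
  · generalize SignType.sign (fourier 1 x).im = t
    cases t <;> simp

/-- The reflection of the coordinates marked by `ε`. -/
def flip {m : ℕ} (ε : Fin m → Bool) (x : UnitAddTorus (Fin m)) : UnitAddTorus (Fin m) :=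
  fun j => if ε j then -x j else x j

theorem measurePreserving_flip {m : ℕ} (ε : Fin m → Bool) :
    MeasurePreserving (flip ε) (volume : Measure (UnitAddTorus (Fin m))) volume := by
  refine measurePreserving_pi (fun _ => (volume : Measure UnitAddCircle)) (fun _ => volume)
    (f := fun j x => if ε j then -x else x) fun j => ?_
  cases h : ε j
  · simp only [Bool.false_eq_true, if_false]
    exact MeasurePreserving.id (volume : Measure UnitAddCircle)
  · simp only [if_true]
    exact Measure.measurePreserving_neg (volume : Measure UnitAddCircle)

/-- The extension of a function on the cube to the torus with the given parities. -/
def torusExt {m : ℕ} (B : ℝ) (σ : Fin m → Bool) (h : E m → ℝ) (x : UnitAddTorus (Fin m)) : ℂ :=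
  (h (fold m B x) : ℂ) * ∏ j, (parity (σ j) (x j) : ℂ)

theorem memLp_comp_fold {m : ℕ} {B : ℝ} (hB : 0 < B) {h : E m → ℝ}
    (hh : MemLp h 2 (volume.restrict (cube m B))) : MemLp (fun x => h (fold m B x)) 2 volume := by
  have h1 : MemLp h 2 ((ENNReal.ofReal (2 * B))⁻¹ ^ m • (volume : Measure (E m)).restrict (cube m B)) :=
    hh.smul_measure (by simp [hB])
  exact h1.comp_measurePreserving (measurePreserving_fold m hB)

theorem memLp_torusExt {m : ℕ} {B : ℝ} (hB : 0 < B) (σ : Fin m → Bool) {h : E m → ℝ}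
    (hh : MemLp h 2 (volume.restrict (cube m B))) : MemLp (torusExt B σ h) 2 volume := by
  have h1 := (memLp_comp_fold hB hh).ofReal (K := ℂ)
  refine h1.of_le ?_ ?_
  · refine h1.aestronglyMeasurable.mul ?_
    refine Measurable.aestronglyMeasurable ?_
    exact Finset.measurable_fun_prod _ fun j _ =>
      Complex.measurable_ofReal.comp ((measurable_parity _).comp (measurable_pi_apply j))
  · refine Eventually.of_forall fun x => ?_
    simp only [torusExt, norm_mul, norm_prod]
    refine mul_le_of_le_one_right (norm_nonneg _) ?_
    refine Finset.prod_le_one (fun _ _ => norm_nonneg _) fun j _ => ?_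
    rw [Complex.norm_real]; exact abs_parity_le _ _

/-- Averaging the integrand over the 2^m coordinate reflections leaves its integral unchanged. The
folding map is invariant under them, so the average factorizes over the coordinates by
`even_part_fourier`. Each sine contributes a unimodular factor -i, which is harmless in Parseval's
identity. -/
theorem mFourierCoeff_torusExt {m : ℕ} {B : ℝ} (hB : 0 < B) (σ : Fin m → Bool) {h : E m → ℝ}
    (hh : MemLp h 2 (volume.restrict (cube m B))) (n : Fin m → ℤ) :
    UnitAddTorus.mFourierCoeff (torusExt B σ h) n =
      (∏ j, (if σ j then 1 else -Complex.I)) *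
        ((∫ x, h (fold m B x) * trigProd B σ n (fold m B x) : ℝ) : ℂ) := by
  set Φ : UnitAddTorus (Fin m) → ℂ := fun x => UnitAddTorus.mFourier (-n) x • torusExt B σ h x with hΦ
  have hΦi : Integrable Φ := by
    have h1 : Integrable (torusExt B σ h) := (memLp_torusExt hB σ hh).integrable (by norm_num)
    refine h1.bdd_mul (c := 1) (UnitAddTorus.mFourier (-n)).continuous.aestronglyMeasurable ?_
    refine Eventually.of_forall fun x => ?_
    exact ((UnitAddTorus.mFourier (-n)).norm_coe_le_norm x).trans_eq UnitAddTorus.mFourier_norm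
  have hflip : ∀ ε : Fin m → Bool, ∫ x, Φ (flip ε x) = ∫ x, Φ x := fun ε => by
    have hmp := measurePreserving_flip ε
    have := integral_map (μ := volume) (f := Φ) hmp.measurable.aemeasurable
      (by rw [hmp.map_eq]; exact hΦi.aestronglyMeasurable)
    rw [← this, hmp.map_eq]
  have hsum : ∫ x, ∑ ε : Fin m → Bool, Φ (flip ε x) = 2 ^ m * ∫ x, Φ x := by
    rw [integral_finsetSum _ fun ε _ => ?_]
    · simp only [hflip, Finset.sum_const, Finset.card_univ, nsmul_eq_mul]
      simp
    · exact (measurePreserving_flip ε).integrable_comp_of_integrable hΦi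
  have hpt : ∀ x, ∑ ε : Fin m → Bool, Φ (flip ε x) =
      2 ^ m * ((∏ j, (if σ j then 1 else -Complex.I)) *
        ((h (fold m B x) * trigProd B σ n (fold m B x) : ℝ) : ℂ)) := by
    intro x
    have e1 : ∀ ε : Fin m → Bool, Φ (flip ε x) = (h (fold m B x) : ℂ) *
        ∏ j, ((parity (σ j) (if ε j then -x j else x j) : ℂ) *
          fourier (-n j) (if ε j then -x j else x j)) := by
      intro ε
      have hf : fold m B (flip ε x) = fold m B x := by
        simp only [fold, flip]
        congr 1; ext j
        unfold fold1; split_ifs <;> simp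
      simp only [hΦ, torusExt, hf, smul_eq_mul, UnitAddTorus.mFourier, ContinuousMap.coe_mk, flip,
        Finset.prod_mul_distrib, Pi.neg_apply]
      ring
    simp only [e1, ← Finset.mul_sum]
    -- A sum over all reflection patterns of a product is the product over the coordinates of
    -- two-term sums.
    have e2 := Finset.prod_univ_sum (fun _ : Fin m => (Finset.univ : Finset Bool))
      (fun j e => ((parity (σ j) (if e then -x j else x j) : ℂ) *
          fourier (-n j) (if e then -x j else x j)))
    simp only [Fintype.piFinset_univ] at e2
    rw [← e2]
    have e3 : ∀ j, ∑ e : Bool, ((parity (σ j) (if e then -x j else x j) : ℂ) *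
          fourier (-n j) (if e then -x j else x j)) =
        2 * ((if σ j then 1 else -Complex.I) * (trig B (σ j) (n j) (fold1 B (x j)) : ℂ)) := by
      intro j
      rw [← even_part_fourier hB]
      simp only [Fintype.sum_bool, if_true, Bool.false_eq_true, if_false]
      ring
    simp only [e3, Finset.prod_mul_distrib, Finset.prod_const, Finset.card_univ, Fintype.card_fin,
      trigProd, fold]
    push_cast
    ring
  simp only [hpt] at hsum
  rw [integral_const_mul] at hsum
  have := mul_left_cancel₀ (pow_ne_zero m two_ne_zero) hsum
  rw [integral_const_mul, integral_complex_ofReal] at this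
  exact this.symm

/-- The extension has modulus |h ∘ fold| almost everywhere, and its Fourier coefficients are the
trigonometric integrals up to unimodular factors. Indexing by all integer vectors, with n and -n
both present, is what keeps frequency-dependent normalizations out of the identity. -/
theorem parseval_torus {m : ℕ} {B : ℝ} (hB : 0 < B) (σ : Fin m → Bool) {h : E m → ℝ}
    (hh : MemLp h 2 (volume.restrict (cube m B))) :
    HasSum (fun n => (∫ x, h (fold m B x) * trigProd B σ n (fold m B x)) ^ 2)
      (∫ x, h (fold m B x) ^ 2) := by
  have hL := memLp_torusExt hB σ hh
  have h1 := UnitAddTorus.hasSum_sq_mFourierCoeff (hL.toLp _)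
  have e1 : ∀ n, UnitAddTorus.mFourierCoeff (hL.toLp _) n = UnitAddTorus.mFourierCoeff (torusExt B σ h) n := by
    intro n
    apply integral_congr_ae
    filter_upwards [hL.coeFn_toLp] with x hx
    rw [hx]
  have e2 : ∫ t, ‖hL.toLp _ t‖ ^ 2 = ∫ x, h (fold m B x) ^ 2 := by
    apply integral_congr_ae
    have hc : ∀ᵐ x, fold m B x ∈ cube m B := by
      have hae : ∀ᵐ y ∂((ENNReal.ofReal (2 * B))⁻¹ ^ m • (volume : Measure (E m)).restrict (cube m B)),
        y ∈ cube m B := Measure.ae_smul_measure (ae_restrict_mem (measurableSet_cube m B)) _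
      exact (measurePreserving_fold m hB).quasiMeasurePreserving.ae hae
    filter_upwards [hL.coeFn_toLp, hc] with x hx hxc
    rw [hx]
    simp only [torusExt, norm_mul, norm_prod, mul_pow, Complex.norm_real, Real.norm_eq_abs, sq_abs,
      ← Finset.prod_pow]
    have : ∀ j, parity (σ j) (x j) ^ 2 = 1 := fun j => parity_sq hB _ _ (hxc j)
    simp [this]
  rw [e2] at h1
  refine h1.congr_fun fun n => ?_
  rw [e1, mFourierCoeff_torusExt hB σ hh, norm_mul, norm_prod]
  have : ∀ j, ‖(if σ j then 1 else -Complex.I : ℂ)‖ = 1 := by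
    intro j; split_ifs <;> simp
  simp only [this, Finset.prod_const_one, one_mul, Complex.norm_real, Real.norm_eq_abs, sq_abs]

theorem integral_comp_fold {m : ℕ} {B : ℝ} (hB : 0 < B) {h : E m → ℝ}
    (hh : AEStronglyMeasurable h (volume.restrict (cube m B))) :
    ∫ x, h (fold m B x) = ((2 * B) ^ m)⁻¹ * ∫ y in cube m B, h y := by
  have hmp := measurePreserving_fold m hB
  have h1 : AEStronglyMeasurable h (Measure.map (fold m B) volume) := by
    rw [hmp.map_eq]; exact hh.smul_measure _
  rw [← integral_map hmp.measurable.aemeasurable h1, hmp.map_eq, integral_smul_measure]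
  rw [ENNReal.toReal_pow, ENNReal.toReal_inv,
    ENNReal.toReal_ofReal (show (0 : ℝ) ≤ 2 * B by positivity), inv_pow, smul_eq_mul]

/-- **Parseval's identity** on the cube. -/
theorem parseval_cube {m : ℕ} {B : ℝ} (hB : 0 < B) (σ : Fin m → Bool) {h : E m → ℝ}
    (hh : MemLp h 2 (volume.restrict (cube m B))) :
    ∑' n, ENNReal.ofReal ((∫ y in cube m B, h y * trigProd B σ n y) ^ 2) =
      ENNReal.ofReal ((2 * B) ^ m) * l2NormSq (cube m B) h := by
  have hp := parseval_torus hB σ hh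
  have hpos : 0 < (2 * B) ^ m := by positivity
  rw [integral_comp_fold hB (h := fun y => h y ^ 2) (hh.aestronglyMeasurable.pow 2)] at hp
  have h2 : ∀ n, ∫ x, h (fold m B x) * trigProd B σ n (fold m B x) =
      ((2 * B) ^ m)⁻¹ * ∫ y in cube m B, h y * trigProd B σ n y := fun n =>
    integral_comp_fold hB (h := fun y => h y * trigProd B σ n y)
      (hh.aestronglyMeasurable.mul (continuous_trigProd B σ n).aestronglyMeasurable)
  simp only [h2] at hp
  have hp2 := hp.mul_left (((2 * B) ^ m) ^ 2)
  have e : ∀ n, ((2 * B) ^ m) ^ 2 * (((2 * B) ^ m)⁻¹ * ∫ y in cube m B, h y * trigProd B σ n y) ^ 2 =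
      (∫ y in cube m B, h y * trigProd B σ n y) ^ 2 := by
    intro n; field_simp
  simp only [e] at hp2
  rw [← ENNReal.ofReal_tsum_of_nonneg (fun _ => sq_nonneg _) hp2.summable, hp2.tsum_eq]
  have e3 : l2NormSq (cube m B) h = ENNReal.ofReal (∫ y in cube m B, h y ^ 2) := by
    rw [ofReal_integral_eq_lintegral_ofReal hh.integrable_sq (Eventually.of_forall fun _ => sq_nonneg _)]
    unfold l2NormSq
    congr 1; ext y
    rw [← enorm_pow, Real.enorm_of_nonneg (sq_nonneg _)]
  rw [e3, ← ENNReal.ofReal_mul hpos.le]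
  congr 1
  field_simp

end Torus

/-! ### Cutoff functions on an interval -/

/-- Outside [0,1] the transition function is locally constant, so a bound on this compact interval
is global. -/
theorem exists_bound_deriv_smoothTransition :
    ∃ C, 0 ≤ C ∧ (∀ t, |deriv Real.smoothTransition t| ≤ C) := by
  have hc : Continuous (deriv Real.smoothTransition) :=
    (Real.smoothTransition.contDiff (n := 1)).continuous_deriv le_rfl
  obtain ⟨C, hC⟩ := isCompact_Icc.exists_bound_of_continuousOn (s := Icc (0 : ℝ) 1) hc.continuousOn
  refine ⟨C, (norm_nonneg _).trans (hC 0 (by simp)), fun t => ?_⟩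
  by_cases ht : t ∈ Icc (0 : ℝ) 1
  · exact hC t ht
  have h0 : deriv Real.smoothTransition t = 0 := by
    rw [mem_Icc, not_and_or, not_le, not_le] at ht
    rcases ht with h | h
    · have : Real.smoothTransition =ᶠ[𝓝 t] fun _ => 0 := by
        filter_upwards [Iio_mem_nhds h] with s hs
        exact Real.smoothTransition.zero_of_nonpos (le_of_lt hs)
      rw [this.deriv_eq]; simp
    · have : Real.smoothTransition =ᶠ[𝓝 t] fun _ => 1 := by
        filter_upwards [Ioi_mem_nhds h] with s hs
        exact Real.smoothTransition.one_of_one_le (le_of_lt hs)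
      rw [this.deriv_eq]; simp
  rw [h0, abs_zero]
  exact (norm_nonneg _).trans (hC 0 (by simp))

/-- A smooth cutoff function: `1` on `[l + 2δ, r - 2δ]` and `0` outside `[l + δ, r - δ]`. -/
def cutoff (l r δ t : ℝ) : ℝ :=
  Real.smoothTransition ((t - l) / δ - 1) * Real.smoothTransition ((r - t) / δ - 1)

section Cutoff

variable {l r δ t : ℝ}

theorem contDiff_cutoff : ContDiff ℝ ∞ (cutoff l r δ) := by
  unfold cutoff
  have h := Real.smoothTransition.contDiff (n := ⊤)
  exact (h.comp (by fun_prop)).mul (h.comp (by fun_prop))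

theorem cutoff_mem_Icc : cutoff l r δ t ∈ Icc (0 : ℝ) 1 :=
  ⟨mul_nonneg (Real.smoothTransition.nonneg _) (Real.smoothTransition.nonneg _),
    mul_le_one₀ (Real.smoothTransition.le_one _) (Real.smoothTransition.nonneg _)
      (Real.smoothTransition.le_one _)⟩

theorem abs_cutoff_le_one : |cutoff l r δ t| ≤ 1 := by
  rw [abs_of_nonneg cutoff_mem_Icc.1]; exact cutoff_mem_Icc.2

theorem tsupport_cutoff_subset (hδ : 0 < δ) : tsupport (cutoff l r δ) ⊆ Icc (l + δ) (r - δ) := by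
  apply closure_minimal _ isClosed_Icc
  intro t ht
  by_contra hcon
  rw [mem_Icc, not_and_or, not_le, not_le] at hcon
  apply ht
  unfold cutoff
  rcases hcon with h | h
  · rw [Real.smoothTransition.zero_of_nonpos, zero_mul]
    rw [sub_nonpos, div_le_one hδ]; linarith
  · rw [mul_comm, Real.smoothTransition.zero_of_nonpos, zero_mul]
    rw [sub_nonpos, div_le_one hδ]; linarith

theorem tsupport_cutoff_subset_Ioo (hδ : 0 < δ) : tsupport (cutoff l r δ) ⊆ Ioo l r :=
  (tsupport_cutoff_subset hδ).trans fun t ht => ⟨by linarith [ht.1], by linarith [ht.2]⟩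

theorem hasCompactSupport_cutoff (hδ : 0 < δ) : HasCompactSupport (cutoff l r δ) :=
  HasCompactSupport.of_support_subset_isCompact isCompact_Icc
    ((subset_tsupport _).trans (tsupport_cutoff_subset hδ))

theorem cutoff_eq_one (hδ : 0 < δ) (h1 : l + 2 * δ ≤ t) (h2 : t ≤ r - 2 * δ) : cutoff l r δ t = 1 := by
  unfold cutoff
  rw [Real.smoothTransition.one_of_one_le, Real.smoothTransition.one_of_one_le, one_mul]
  · rw [le_sub_iff_add_le, le_div_iff₀ hδ]; linarith
  · rw [le_sub_iff_add_le, le_div_iff₀ hδ]; linarith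

theorem deriv_cutoff_eq_zero (hδ : 0 < δ) (h1 : l + 2 * δ < t) (h2 : t < r - 2 * δ) :
    deriv (cutoff l r δ) t = 0 := by
  have : cutoff l r δ =ᶠ[𝓝 t] fun _ => 1 := by
    filter_upwards [Ioo_mem_nhds h1 h2] with s hs
    exact cutoff_eq_one hδ hs.1.le hs.2.le
  rw [this.deriv_eq]; simp

theorem abs_deriv_cutoff_le {C : ℝ} (hC : ∀ t, |deriv Real.smoothTransition t| ≤ C) (hδ : 0 < δ) :
    |deriv (cutoff l r δ) t| ≤ 2 * C / δ := by
  have hd : ∀ s, HasDerivAt Real.smoothTransition (deriv Real.smoothTransition s) s := fun s =>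
    ((Real.smoothTransition.contDiff (n := 1)).differentiable (by simp) s).hasDerivAt
  have h1 : HasDerivAt (fun t => (t - l) / δ - 1) (1 / δ) t :=
    (((hasDerivAt_id t).sub_const l).div_const δ).sub_const 1
  have h2 : HasDerivAt (fun t => (r - t) / δ - 1) (-1 / δ) t :=
    (((hasDerivAt_id t).const_sub r).div_const δ).sub_const 1
  have h3 := ((hd _).comp t h1).mul ((hd _).comp t h2)
  have h4 : deriv (cutoff l r δ) t = _ := h3.deriv
  rw [h4]
  have b1 := hC ((t - l) / δ - 1)
  have b2 := hC ((r - t) / δ - 1)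
  have c1 : |Real.smoothTransition ((t - l) / δ - 1)| ≤ 1 := by
    rw [abs_of_nonneg (Real.smoothTransition.nonneg _)]; exact Real.smoothTransition.le_one _
  have c2 : |Real.smoothTransition ((r - t) / δ - 1)| ≤ 1 := by
    rw [abs_of_nonneg (Real.smoothTransition.nonneg _)]; exact Real.smoothTransition.le_one _
  have hC0 : 0 ≤ C := (abs_nonneg _).trans b1
  refine (abs_add_le _ _).trans ?_
  simp only [Function.comp, abs_mul, abs_div, abs_neg, abs_one, abs_of_pos hδ]
  have d1 : |deriv Real.smoothTransition ((t - l) / δ - 1)| * (1 / δ) ≤ C / δ := by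
    rw [mul_one_div]; gcongr
  have d2 : |deriv Real.smoothTransition ((r - t) / δ - 1)| * (1 / δ) ≤ C / δ := by
    rw [mul_one_div]; gcongr
  have e1 := mul_le_mul d1 c2 (abs_nonneg _) (by positivity)
  have e2 := mul_le_mul c1 d2 (by positivity) zero_le_one
  calc _ ≤ C / δ * 1 + 1 * (C / δ) := add_le_add e1 e2
    _ = 2 * C / δ := by ring

end Cutoff

/-- A sequence of widths that tends to zero. -/
def width (N : ℕ) : ℝ := 1 / ((N : ℝ) + 1)

theorem width_pos (N : ℕ) : 0 < width N := by unfold width; positivity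

theorem tendsto_width : Tendsto width atTop (𝓝 0) := tendsto_one_div_add_atTop_nhds_zero_nat

theorem eventually_width {l r t : ℝ} (ht : t ∈ Ioo l r) :
    ∀ᶠ N in atTop, l + 2 * width N < t ∧ t < r - 2 * width N := by
  have h : 0 < min ((t - l) / 2) ((r - t) / 2) := by
    apply lt_min <;> linarith [ht.1, ht.2]
  filter_upwards [tendsto_width.eventually_lt_const h] with N hN
  have h1 := (lt_min_iff.1 hN).1
  have h2 := (lt_min_iff.1 hN).2
  constructor <;> linarith

theorem tendsto_cutoff {l r t : ℝ} (ht : t ∈ Ioo l r) :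
    Tendsto (fun N => cutoff l r (width N) t) atTop (𝓝 1) := by
  refine tendsto_const_nhds.congr' ?_
  filter_upwards [eventually_width ht] with N hN
  exact (cutoff_eq_one (width_pos N) hN.1.le hN.2.le).symm

theorem tendsto_deriv_cutoff {l r t : ℝ} (ht : t ∈ Ioo l r) :
    Tendsto (fun N => deriv (cutoff l r (width N)) t) atTop (𝓝 0) := by
  refine tendsto_const_nhds.congr' ?_
  filter_upwards [eventually_width ht] with N hN
  exact (deriv_cutoff_eq_zero (width_pos N) hN.1 hN.2).symm

/-! ### Products of functions of one coordinate -/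

/-- The product of functions of one coordinate. -/
def prodFn {k : ℕ} (θ : Fin k → ℝ → ℝ) (x : E k) : ℝ := ∏ j, θ j (x j)

theorem continuous_coord {k : ℕ} (j : Fin k) : Continuous fun x : E k => x j := by fun_prop

theorem contDiff_prodFn {k : ℕ} {θ : Fin k → ℝ → ℝ} (h : ∀ j, ContDiff ℝ ∞ (θ j)) :
    ContDiff ℝ ∞ (prodFn θ) := by
  unfold prodFn
  refine contDiff_prod fun j _ => (h j).comp ?_
  fun_prop

theorem continuous_prodFn {k : ℕ} {θ : Fin k → ℝ → ℝ} (h : ∀ j, Continuous (θ j)) :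
    Continuous (prodFn θ) := by
  unfold prodFn
  exact continuous_finsetProd _ fun j _ => (h j).comp (continuous_coord j)

theorem prodFn_update {k : ℕ} (θ : Fin k → ℝ → ℝ) (i : Fin k) (f : ℝ → ℝ) (x : E k) :
    prodFn (Function.update θ i f) x = f (x i) * ∏ j ∈ Finset.univ.erase i, θ j (x j) := by
  unfold prodFn
  rw [← Finset.mul_prod_erase _ _ (Finset.mem_univ i), Function.update_self]
  congr 1
  refine Finset.prod_congr rfl fun j hj => ?_
  rw [Function.update_of_ne (Finset.ne_of_mem_erase hj)]

theorem fderiv_prodFn {k : ℕ} {θ : Fin k → ℝ → ℝ} (h : ∀ j, ContDiff ℝ ∞ (θ j)) (i : Fin k)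
    (x : E k) : fderiv ℝ (prodFn θ) x (EuclideanSpace.single i 1) =
      prodFn (Function.update θ i (deriv (θ i))) x := by
  have hd : DifferentiableAt ℝ (prodFn θ) x := (contDiff_prodFn h).differentiable (by simp) x
  have h1 : HasDerivAt (fun t : ℝ => x + t • (EuclideanSpace.single i 1 : E k))
      (EuclideanSpace.single i 1) 0 := by
    have := ((hasDerivAt_id (0 : ℝ)).smul_const (EuclideanSpace.single i 1 : E k)).const_add x
    simpa using this
  have hd' : HasFDerivAt (prodFn θ) (fderiv ℝ (prodFn θ) x)
      (x + (0 : ℝ) • (EuclideanSpace.single i 1 : E k)) := by simpa using hd.hasFDerivAt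
  have h2 := hd'.comp_hasDerivAt (0 : ℝ) h1
  have e : (prodFn θ ∘ fun t : ℝ => x + t • (EuclideanSpace.single i 1 : E k)) =
      fun t => θ i (x i + t) * ∏ j ∈ Finset.univ.erase i, θ j (x j) := by
    ext t
    simp only [Function.comp]
    unfold prodFn
    rw [← Finset.mul_prod_erase _ _ (Finset.mem_univ i)]
    congr 1
    · simp
    · refine Finset.prod_congr rfl fun j hj => ?_
      simp [Finset.ne_of_mem_erase hj]
  rw [e] at h2
  have h3 : HasDerivAt (fun t => θ i (x i + t) * ∏ j ∈ Finset.univ.erase i, θ j (x j))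
      (deriv (θ i) (x i) * ∏ j ∈ Finset.univ.erase i, θ j (x j)) 0 := by
    have hθ : HasDerivAt (θ i) (deriv (θ i) (x i)) (x i + 0) := by
      rw [add_zero]; exact ((h i).differentiable (by simp) _).hasDerivAt
    have := (hθ.comp_const_add (x i) 0).mul_const (∏ j ∈ Finset.univ.erase i, θ j (x j))
    exact this
  rw [prodFn_update]
  exact h2.unique h3

theorem tsupport_prodFn_subset {k : ℕ} (θ : Fin k → ℝ → ℝ) :
    tsupport (prodFn θ) ⊆ {x | ∀ j, x j ∈ tsupport (θ j)} := by
  apply closure_minimal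
  · intro x hx j
    apply subset_tsupport
    exact Finset.prod_ne_zero_iff.1 hx j (Finset.mem_univ j)
  · have : {x : E k | ∀ j, x j ∈ tsupport (θ j)} = ⋂ j, (fun x : E k => x j) ⁻¹' tsupport (θ j) := by
      ext x; simp
    rw [this]
    exact isClosed_iInter fun j => (isClosed_tsupport _).preimage (continuous_coord j)

theorem isCompact_setOf_forall_mem {k : ℕ} {K : Fin k → Set ℝ} (h : ∀ j, IsCompact (K j)) :
    IsCompact {x : E k | ∀ j, x j ∈ K j} := by
  have h1 := (isCompact_univ_pi h).image (EuclideanSpace.equiv (Fin k) ℝ).symm.continuous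
  convert h1
  ext x
  constructor
  · intro hx
    exact ⟨fun j => x j, fun j _ => hx j, rfl⟩
  · rintro ⟨y, hy, rfl⟩ j
    exact hy j (mem_univ j)

theorem hasCompactSupport_prodFn {k : ℕ} {θ : Fin k → ℝ → ℝ} (h : ∀ j, HasCompactSupport (θ j)) :
    HasCompactSupport (prodFn θ) :=
  HasCompactSupport.of_support_subset_isCompact (isCompact_setOf_forall_mem h)
    ((subset_tsupport _).trans (tsupport_prodFn_subset θ))

/-! ### Weak derivatives on boxes, tested with products that need not vanish at the boundary -/

/-- The open box with corners `l` and `r`. -/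
def box {k : ℕ} (l r : Fin k → ℝ) : Set (E k) := {x | ∀ j, x j ∈ Ioo (l j) (r j)}

section Box

variable {k : ℕ} {l r : Fin k → ℝ}

theorem isOpen_box : IsOpen (box l r) := by
  have : box l r = ⋂ j, (fun x : E k => x j) ⁻¹' Ioo (l j) (r j) := by ext x; simp [box]
  rw [this]
  exact isOpen_iInter_of_finite fun j => isOpen_Ioo.preimage (continuous_coord j)

theorem measurableSet_box : MeasurableSet (box l r) := isOpen_box.measurableSet

theorem closure_box_subset : closure (box l r) ⊆ {x | ∀ j, x j ∈ Icc (l j) (r j)} := by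
  apply closure_minimal
  · intro x hx j
    exact Ioo_subset_Icc_self (hx j)
  · exact (isCompact_setOf_forall_mem fun j => isCompact_Icc).isClosed

theorem closure_box (h : ∀ j, l j < r j) : closure (box l r) = {x | ∀ j, x j ∈ Icc (l j) (r j)} := by
  apply closure_box_subset.antisymm
  intro x hx
  have e : box l r = (EuclideanSpace.equiv (Fin k) ℝ) ⁻¹' (univ.pi fun j => Ioo (l j) (r j)) := by
    ext x; simp [box]
  have e2 := (EuclideanSpace.equiv (Fin k) ℝ).toHomeomorph.preimage_closure
    (univ.pi fun j => Ioo (l j) (r j))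
  rw [ContinuousLinearEquiv.coe_toHomeomorph] at e2
  rw [e, ← e2, closure_pi_set]
  intro j _
  dsimp only
  rw [closure_Ioo (h j).ne]
  exact hx j

theorem isCompact_closure_box : IsCompact (closure (box l r)) :=
  (isCompact_setOf_forall_mem fun _ => isCompact_Icc).of_isClosed_subset isClosed_closure
    closure_box_subset

theorem volume_box_lt_top : volume (box l r) < ⊤ :=
  (measure_mono subset_closure).trans_lt isCompact_closure_box.measure_lt_top

/-- Dominated convergence for products of bounded functions of one coordinate. -/
theorem tendsto_integral_mul_prodFn {u : E k → ℝ} (hu : IntegrableOn u (box l r))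
    {f : ℕ → Fin k → ℝ → ℝ} {g : Fin k → ℝ → ℝ} (hfc : ∀ N j, Continuous (f N j)) {K : ℝ}
    (hK : ∀ N j, ∀ t ∈ Ioo (l j) (r j), |f N j t| ≤ K)
    (hlim : ∀ j, ∀ t ∈ Ioo (l j) (r j), Tendsto (fun N => f N j t) atTop (𝓝 (g j t))) :
    Tendsto (fun N => ∫ x in box l r, u x * prodFn (f N) x) atTop
      (𝓝 (∫ x in box l r, u x * prodFn g x)) := by
  refine tendsto_integral_of_dominated_convergence (fun x => |u x| * K ^ k) ?_ ?_ ?_ ?_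
  · intro N
    exact hu.aestronglyMeasurable.mul (continuous_prodFn (hfc N)).aestronglyMeasurable
  · exact hu.norm.mul_const _
  · intro N
    filter_upwards [ae_restrict_mem measurableSet_box] with x hx
    rw [norm_mul, Real.norm_eq_abs, Real.norm_eq_abs]
    apply mul_le_mul_of_nonneg_left _ (abs_nonneg _)
    unfold prodFn
    rw [Finset.abs_prod]
    refine (Finset.prod_le_prod (fun _ _ => abs_nonneg _) fun j _ => hK N j _ (hx j)).trans_eq ?_
    simp
  · filter_upwards [ae_restrict_mem measurableSet_box] with x hx
    refine Tendsto.const_mul _ ?_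
    unfold prodFn
    exact tendsto_finsetProd _ fun j _ => hlim j _ (hx j)

theorem exists_bound_of_continuous (θ : Fin k → ℝ → ℝ) (h : ∀ j, Continuous (θ j)) :
    ∃ K, 0 ≤ K ∧ ∀ j, ∀ t ∈ Ioo (l j) (r j), |θ j t| ≤ K := by
  have h1 : ∀ j, ∃ C, ∀ t ∈ Icc (l j) (r j), ‖θ j t‖ ≤ C := fun j =>
    isCompact_Icc.exists_bound_of_continuousOn (h j).continuousOn
  choose C hC using h1
  refine ⟨∑ j, |C j|, Finset.sum_nonneg fun _ _ => abs_nonneg _, fun j t ht => ?_⟩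
  refine ((hC j t (Ioo_subset_Icc_self ht)).trans (le_abs_self _)).trans ?_
  exact Finset.single_le_sum (f := fun j => |C j|) (fun _ _ => abs_nonneg _) (Finset.mem_univ j)

/-- The product of a function with the cutoff function in every coordinate. -/
def cutoffMul (l r : Fin k → ℝ) (θ : Fin k → ℝ → ℝ) (N : ℕ) (j : Fin k) (t : ℝ) : ℝ :=
  cutoff (l j) (r j) (width N) t * θ j t

theorem contDiff_cutoffMul {θ : Fin k → ℝ → ℝ} (h : ∀ j, ContDiff ℝ ∞ (θ j)) (N : ℕ) (j : Fin k) :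
    ContDiff ℝ ∞ (cutoffMul l r θ N j) := contDiff_cutoff.mul (h j)

/-- Insert a cutoff in every coordinate and let the widths tend to zero. Differentiation in
direction i touches only the i-th cutoff, so every other term converges by dominated convergence.
The one dangerous term is isolated in `hextra`; the two integration by parts results below differ
only in why it vanishes. -/
theorem HasWeakPartial.integral_mul_prodFn_update {i : Fin k} {u g : E k → ℝ}
    (hw : HasWeakPartial (box l r) i u g) (hu : IntegrableOn u (box l r))
    (hg : IntegrableOn g (box l r)) {θ : Fin k → ℝ → ℝ} (hθ : ∀ j, ContDiff ℝ ∞ (θ j))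
    (hextra : Tendsto (fun N => ∫ x in box l r, u x * prodFn
      (Function.update (cutoffMul l r θ N) i
        (fun t => deriv (cutoff (l i) (r i) (width N)) t * θ i t)) x) atTop (𝓝 0)) :
    ∫ x in box l r, u x * prodFn (Function.update θ i (deriv (θ i))) x =
      - ∫ x in box l r, g x * prodFn θ x := by
  have hθc : ∀ j, Continuous (θ j) := fun j => (hθ j).continuous
  have hdc : Continuous (deriv (θ i)) := (hθ i).continuous_deriv (by simp)
  have hcutc : ∀ N j, Continuous (cutoffMul l r θ N j) := fun N j =>
    (contDiff_cutoffMul hθ N j).continuous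
  obtain ⟨K, hK0, hK⟩ := exists_bound_of_continuous (l := l) (r := r) θ hθc
  have hupd : ∀ j, Continuous (Function.update θ i (deriv (θ i)) j) := by
    intro j
    rcases eq_or_ne j i with rfl | hj
    · simpa using hdc
    · simpa [Function.update_of_ne hj] using hθc j
  obtain ⟨K', hK0', hK'⟩ := exists_bound_of_continuous (l := l) (r := r) _ hupd
  -- the identity with cutoff functions
  have hid : ∀ N, (∫ x in box l r, u x * prodFn (Function.update (cutoffMul l r θ N) i
        (fun t => cutoff (l i) (r i) (width N) t * deriv (θ i) t)) x) +
      (∫ x in box l r, u x * prodFn (Function.update (cutoffMul l r θ N) i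
        (fun t => deriv (cutoff (l i) (r i) (width N)) t * θ i t)) x) =
      - ∫ x in box l r, g x * prodFn (cutoffMul l r θ N) x := by
    intro N
    have hs : ∀ j, HasCompactSupport (cutoffMul l r θ N j) := fun j =>
      (hasCompactSupport_cutoff (width_pos N)).mul_right
    have hts : tsupport (prodFn (cutoffMul l r θ N)) ⊆ box l r := by
      refine (tsupport_prodFn_subset _).trans fun x hx j => ?_
      exact tsupport_cutoff_subset_Ioo (width_pos N) (tsupport_mul_subset_left (hx j))
    have h1 := hw.2.2 _ (contDiff_prodFn (contDiff_cutoffMul hθ N)) (hasCompactSupport_prodFn hs) hts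
    rw [← h1, ← integral_add]
    · congr 1
      ext x
      rw [fderiv_prodFn (contDiff_cutoffMul hθ N), prodFn_update, prodFn_update, prodFn_update]
      have : deriv (cutoffMul l r θ N i) (x i) =
          deriv (cutoff (l i) (r i) (width N)) (x i) * θ i (x i) +
          cutoff (l i) (r i) (width N) (x i) * deriv (θ i) (x i) :=
        ((contDiff_cutoff.differentiable (by simp) _).hasDerivAt.mul
          ((hθ i).differentiable (by simp) _).hasDerivAt).deriv
      rw [this]; ring
    all_goals
      have hc : Continuous (prodFn (Function.update (cutoffMul l r θ N) i
        (fun t => cutoff (l i) (r i) (width N) t * deriv (θ i) t))) ∧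
        Continuous (prodFn (Function.update (cutoffMul l r θ N) i
        (fun t => deriv (cutoff (l i) (r i) (width N)) t * θ i t))) := by
        constructor
        all_goals
          refine continuous_prodFn fun j => ?_
          rcases eq_or_ne j i with rfl | hj
          · simp only [Function.update_self]
            first
            | exact contDiff_cutoff.continuous.mul hdc
            | exact (contDiff_cutoff.continuous_deriv (by simp)).mul (hθc _)
          · rw [Function.update_of_ne hj]; exact hcutc N j
    · obtain ⟨C, hC⟩ := (isCompact_closure_box (l := l) (r := r)).exists_bound_of_continuousOn
        hc.1.continuousOn
      refine Integrable.mul_bdd (c := C) hu hc.1.aestronglyMeasurable ?_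
      filter_upwards [ae_restrict_mem measurableSet_box] with x hx using hC x (subset_closure hx)
    · obtain ⟨C, hC⟩ := (isCompact_closure_box (l := l) (r := r)).exists_bound_of_continuousOn
        hc.2.continuousOn
      refine Integrable.mul_bdd (c := C) hu hc.2.aestronglyMeasurable ?_
      filter_upwards [ae_restrict_mem measurableSet_box] with x hx using hC x (subset_closure hx)
  -- passage to the limit
  have hb1 : ∀ N j, ∀ t ∈ Ioo (l j) (r j), |cutoffMul l r θ N j t| ≤ K := by
    intro N j t ht
    unfold cutoffMul
    rw [abs_mul]
    exact (mul_le_mul abs_cutoff_le_one (hK j t ht) (abs_nonneg _) zero_le_one).trans_eq (one_mul K)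
  have hl1 : ∀ j, ∀ t ∈ Ioo (l j) (r j),
      Tendsto (fun N => cutoffMul l r θ N j t) atTop (𝓝 (θ j t)) := by
    intro j t ht
    simpa [cutoffMul] using (tendsto_cutoff ht).mul_const (θ j t)
  have L3 := tendsto_integral_mul_prodFn hg hcutc hb1 hl1
  have L1 := tendsto_integral_mul_prodFn (f := fun N => Function.update (cutoffMul l r θ N) i
        (fun t => cutoff (l i) (r i) (width N) t * deriv (θ i) t))
      (g := Function.update θ i (deriv (θ i))) (K := K + K') hu ?_ ?_ ?_
  · have h2 := L1.add hextra
    simp only [hid, add_zero] at h2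
    exact (tendsto_nhds_unique h2 L3.neg)
  · intro N j
    rcases eq_or_ne j i with rfl | hj
    · simp only [Function.update_self]; exact contDiff_cutoff.continuous.mul hdc
    · rw [Function.update_of_ne hj]; exact hcutc N j
  · intro N j t ht
    rcases eq_or_ne j i with rfl | hj
    · simp only [Function.update_self]
      have := hK' j t ht
      rw [Function.update_self] at this
      rw [abs_mul]
      have := mul_le_mul (abs_cutoff_le_one (l := l j) (r := r j) (δ := width N) (t := t)) this
        (abs_nonneg _) zero_le_one
      linarith
    · rw [Function.update_of_ne hj]
      have := hb1 N j t ht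
      linarith
  · intro j t ht
    rcases eq_or_ne j i with rfl | hj
    · simp only [Function.update_self]
      simpa using (tendsto_cutoff ht).mul_const (deriv (θ j) t)
    · simp only [Function.update_of_ne hj]; exact hl1 j t ht

/-- Integration by parts against a product whose `i`-th factor vanishes at the end points. -/
theorem HasWeakPartial.integral_of_factor_vanishes {i : Fin k} {u g : E k → ℝ}
    (hw : HasWeakPartial (box l r) i u g) (hu : IntegrableOn u (box l r))
    (hg : IntegrableOn g (box l r)) {θ : Fin k → ℝ → ℝ} (hθ : ∀ j, ContDiff ℝ ∞ (θ j))
    (hl : θ i (l i) = 0) (hr : θ i (r i) = 0) :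
    ∫ x in box l r, u x * prodFn (Function.update θ i (deriv (θ i))) x =
      - ∫ x in box l r, g x * prodFn θ x := by
  refine hw.integral_mul_prodFn_update hu hg hθ ?_
  have hθc : ∀ j, Continuous (θ j) := fun j => (hθ j).continuous
  obtain ⟨K, hK0, hK⟩ := exists_bound_of_continuous (l := l) (r := r) θ hθc
  obtain ⟨C, hC0, hC⟩ := exists_bound_deriv_smoothTransition
  obtain ⟨L, hL⟩ := (((hθ i).of_le (m := 1) (by exact_mod_cast le_top)).contDiffOn
    (s := Icc (l i) (r i))).exists_lipschitzOnWith one_ne_zero (convex_Icc _ _) isCompact_Icc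
  have h := tendsto_integral_mul_prodFn (f := fun N => Function.update (cutoffMul l r θ N) i
        (fun t => deriv (cutoff (l i) (r i) (width N)) t * θ i t))
      (g := Function.update θ i (fun _ => 0)) (K := K + 4 * C * L) hu ?_ ?_ ?_
  · convert h using 2
    simp [prodFn_update]
  · intro N j
    rcases eq_or_ne j i with rfl | hj
    · simp only [Function.update_self]
      exact (contDiff_cutoff.continuous_deriv (by simp)).mul (hθc _)
    · rw [Function.update_of_ne hj]; exact (contDiff_cutoffMul hθ N j).continuous
  · intro N j t ht
    rcases eq_or_ne j i with rfl | hj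
    · simp only [Function.update_self]
      have hw0 := width_pos N
      have hL0 : (0 : ℝ) ≤ L := L.2
      have h0 : 0 ≤ 4 * C * L := by positivity
      have ht' := Ioo_subset_Icc_self ht
      have hlr : l j ≤ r j := ht'.1.trans ht'.2
      by_cases hcase : l j + 2 * width N < t ∧ t < r j - 2 * width N
      · rw [deriv_cutoff_eq_zero hw0 hcase.1 hcase.2, zero_mul, abs_zero]; positivity
      -- Where the cutoff is not constant, t lies within two widths of an end point at which θ
      -- vanishes. The Lipschitz bound then cancels the inverse width in the derivative of the
      -- cutoff and leaves the constant 4CL.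
      have hθt : |θ j t| ≤ L * (2 * width N) := by
        rw [not_and_or, not_lt, not_lt] at hcase
        rcases hcase with h1 | h1
        · have := hL.dist_le_mul t ht' (l j) ⟨le_rfl, hlr⟩
          rw [hl, Real.dist_eq, sub_zero, Real.dist_eq, abs_of_pos (sub_pos.2 ht.1)] at this
          exact this.trans (mul_le_mul_of_nonneg_left (by linarith) hL0)
        · have := hL.dist_le_mul t ht' (r j) ⟨hlr, le_rfl⟩
          rw [hr, Real.dist_eq, sub_zero, Real.dist_eq, abs_of_neg (sub_neg.2 ht.2)] at this
          exact this.trans (mul_le_mul_of_nonneg_left (by linarith) hL0)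
      rw [abs_mul]
      have := mul_le_mul (abs_deriv_cutoff_le (l := l j) (r := r j) (t := t) hC hw0) hθt
        (abs_nonneg _) (by positivity)
      have e : 2 * C / width N * (L * (2 * width N)) = 4 * C * L := by
        field_simp; ring
      linarith
    · rw [Function.update_of_ne hj]
      unfold cutoffMul
      rw [abs_mul]
      have := mul_le_mul (abs_cutoff_le_one (l := l j) (r := r j) (δ := width N) (t := t))
        (hK j t ht) (abs_nonneg _) zero_le_one
      have h0 : (0 : ℝ) ≤ 4 * C * L := by have := L.2; positivity
      linarith
  · intro j t ht
    rcases eq_or_ne j i with rfl | hj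
    · simp only [Function.update_self]
      simpa using (tendsto_deriv_cutoff ht).mul_const (θ j t)
    · simp only [Function.update_of_ne hj]
      simpa [cutoffMul] using (tendsto_cutoff ht).mul_const (θ j t)

/-- Used to see that a layer along two opposite faces has volume proportional to its width. -/
theorem volume_strip (i : Fin k) (T : Set ℝ) :
    volume {x ∈ box l r | x i ∈ T} =
      volume (Ioo (l i) (r i) ∩ T) * ∏ j ∈ Finset.univ.erase i, ENNReal.ofReal (r j - l j) := by
  have e : {x ∈ box l r | x i ∈ T} = (EuclideanSpace.equiv (Fin k) ℝ) ⁻¹'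
      (univ.pi (Function.update (fun j => Ioo (l j) (r j)) i (Ioo (l i) (r i) ∩ T))) := by
    ext x
    constructor
    · rintro ⟨h1, h2⟩ j -
      rcases eq_or_ne j i with rfl | hj
      · rw [Function.update_self]; exact ⟨h1 j, h2⟩
      · rw [Function.update_of_ne hj]; exact h1 j
    · intro h
      have hi := h i (mem_univ i)
      rw [Function.update_self] at hi
      refine ⟨fun j => ?_, hi.2⟩
      rcases eq_or_ne j i with rfl | hj
      · exact hi.1
      · have := h j (mem_univ j)
        rwa [Function.update_of_ne hj] at this
  have h := (EuclideanSpace.volume_preserving_symm_measurableEquiv_toLp (Fin k)).measure_preimage_equiv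
    (univ.pi (Function.update (fun j => Ioo (l j) (r j)) i (Ioo (l i) (r i) ∩ T)))
  rw [e]
  refine h.trans ?_
  rw [volume_pi_pi, ← Finset.mul_prod_erase _ _ (Finset.mem_univ i), Function.update_self]
  congr 1
  refine Finset.prod_congr rfl fun j hj => ?_
  rw [Function.update_of_ne (Finset.ne_of_mem_erase hj), Real.volume_Ioo]

/-- A function that is continuous on the closed box and vanishes on two opposite faces is small
near these faces. -/
theorem eventually_abs_le_near_faces (h : ∀ j, l j < r j) {i : Fin k} {u : E k → ℝ}
    (hu : ContinuousOn u (closure (box l r)))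
    (hu0 : ∀ x ∈ closure (box l r), x i = l i ∨ x i = r i → u x = 0) {ε : ℝ} (hε : 0 < ε) :
    ∀ᶠ N in atTop, ∀ x ∈ box l r, x i ≤ l i + 2 * width N ∨ r i - 2 * width N ≤ x i → |u x| ≤ ε := by
  obtain ⟨δ, hδ, huc⟩ := Metric.uniformContinuousOn_iff.1
    (isCompact_closure_box.uniformContinuousOn_of_continuous hu) ε hε
  filter_upwards [tendsto_width.eventually_lt_const (show 0 < δ / 2 by positivity)] with N hN x hx hor
  have hface : ∀ c, (c = l i ∨ c = r i) → |x i - c| < δ → |u x| ≤ ε := by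
    intro c hc hd
    -- The orthogonal projection of x onto the face with i-th coordinate c, where u vanishes.
    set y : E k := x - EuclideanSpace.single i (x i - c) with hy
    have hyi : y i = c := by simp [hy]
    have hyj : ∀ j, j ≠ i → y j = x j := fun j hj => by simp [hy, hj]
    have hycl : y ∈ closure (box l r) := by
      rw [closure_box h]
      intro j
      rcases eq_or_ne j i with rfl | hj
      · rw [hyi]
        rcases hc with rfl | rfl
        · exact ⟨le_rfl, (h j).le⟩
        · exact ⟨(h j).le, le_rfl⟩
      · rw [hyj j hj]; exact Ioo_subset_Icc_self (hx j)
    have h0 : u y = 0 := hu0 y hycl (by rw [hyi]; exact hc)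
    have hdist : dist x y < δ := by
      rw [dist_eq_norm, hy, sub_sub_cancel, PiLp.norm_single]; exact hd
    have := huc x (subset_closure hx) y hycl hdist
    rw [h0, Real.dist_eq, sub_zero] at this
    exact this.le
  rcases hor with h1 | h1
  · refine hface (l i) (Or.inl rfl) ?_
    rw [abs_of_pos (by linarith [(hx i).1])]; linarith
  · refine hface (r i) (Or.inr rfl) ?_
    rw [abs_of_neg (by linarith [(hx i).2])]; linarith

/-- Integration by parts for a function that is continuous on the closed box and vanishes on the
two faces orthogonal to the direction of differentiation. -/
theorem HasWeakPartial.integral_of_vanishes_on_faces (h : ∀ j, l j < r j) {i : Fin k}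
    {u g : E k → ℝ} (hw : HasWeakPartial (box l r) i u g) (huc : ContinuousOn u (closure (box l r)))
    (hu0 : ∀ x ∈ closure (box l r), x i = l i ∨ x i = r i → u x = 0)
    (hg : IntegrableOn g (box l r)) {θ : Fin k → ℝ → ℝ} (hθ : ∀ j, ContDiff ℝ ∞ (θ j)) :
    ∫ x in box l r, u x * prodFn (Function.update θ i (deriv (θ i))) x =
      - ∫ x in box l r, g x * prodFn θ x := by
  have hu : IntegrableOn u (box l r) :=
    (huc.integrableOn_compact isCompact_closure_box).mono_set subset_closure
  refine hw.integral_mul_prodFn_update hu hg hθ ?_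
  have hθc : ∀ j, Continuous (θ j) := fun j => (hθ j).continuous
  obtain ⟨K, hK0, hK⟩ := exists_bound_of_continuous (l := l) (r := r) θ hθc
  obtain ⟨C, hC0, hC⟩ := exists_bound_deriv_smoothTransition
  set c : ℝ := ∏ j ∈ Finset.univ.erase i, (r j - l j) with hc
  have hc0 : 0 ≤ c := Finset.prod_nonneg fun j _ => by linarith [h j]
  -- The derivative of the cutoff is at most 2C/width and the layer has volume at most 4·width·c, so
  -- the widths cancel and leave 8Cc. The powers of K + 1 bound the remaining factors. Making u at
  -- most ε/(A + 1) in the layer keeps the final inequality strict.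
  set A : ℝ := 8 * C * (K + 1) ^ (k + 1) * c with hA
  have hA0 : 0 ≤ A := by positivity
  rw [Metric.tendsto_nhds]
  intro ε hε
  have hε' : 0 < ε / (A + 1) := by positivity
  filter_upwards [eventually_abs_le_near_faces h huc hu0 hε'] with N hN
  rw [Real.dist_eq, sub_zero]
  have hw0 := width_pos N
  set T : Set ℝ := {t | t ≤ l i + 2 * width N ∨ r i - 2 * width N ≤ t} with hT
  have hTm : MeasurableSet T := measurableSet_Iic.union measurableSet_Ici
  set S : Set (E k) := {x ∈ box l r | x i ∈ T} with hS
  have hSm : MeasurableSet S := measurableSet_box.inter ((continuous_coord i).measurable hTm)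
  set F : E k → ℝ := fun x => u x * prodFn
      (Function.update (cutoffMul l r θ N) i
        (fun t => deriv (cutoff (l i) (r i) (width N)) t * θ i t)) x with hF
  have hzero : ∀ x ∈ box l r \ S, F x = 0 := by
    intro x hx
    have hxT : ¬ (x i ≤ l i + 2 * width N ∨ r i - 2 * width N ≤ x i) := fun hh => hx.2 ⟨hx.1, hh⟩
    rw [not_or, not_le, not_le] at hxT
    simp only [hF, prodFn_update, deriv_cutoff_eq_zero hw0 hxT.1 hxT.2, zero_mul, mul_zero]
  have hSsub : S ⊆ box l r := fun x hx => hx.1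
  have e1 : ∫ x in box l r, F x = ∫ x in S, F x :=
    setIntegral_eq_of_subset_of_forall_sdiff_eq_zero measurableSet_box hSsub hzero
  have hbound : ∀ x ∈ S, ‖F x‖ ≤ ε / (A + 1) * (2 * C / width N * (K + 1) ^ (k + 1)) := by
    intro x hx
    simp only [hF, prodFn_update, norm_mul, Real.norm_eq_abs]
    have h1 := hN x hx.1 hx.2
    have h2 := abs_deriv_cutoff_le (l := l i) (r := r i) (t := x i) hC hw0
    have h3 : |θ i (x i)| ≤ K + 1 := (hK i _ (hx.1 i)).trans (by linarith)
    have h4 : |∏ j ∈ Finset.univ.erase i, cutoffMul l r θ N j (x j)| ≤ (K + 1) ^ k := by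
      rw [Finset.abs_prod]
      calc _ ≤ ∏ j ∈ Finset.univ.erase i, (K + 1) := by
            refine Finset.prod_le_prod (fun _ _ => abs_nonneg _) fun j _ => ?_
            unfold cutoffMul
            rw [abs_mul]
            have := mul_le_mul (abs_cutoff_le_one (l := l j) (r := r j) (δ := width N) (t := x j))
              (hK j _ (hx.1 j)) (abs_nonneg _) zero_le_one
            linarith
        _ = (K + 1) ^ (k - 1) := by simp
        _ ≤ (K + 1) ^ k := pow_le_pow_right₀ (by linarith) (Nat.sub_le _ _)
    calc |u x| * (|deriv (cutoff (l i) (r i) (width N)) (x i)| * |θ i (x i)| *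
          |∏ j ∈ Finset.univ.erase i, cutoffMul l r θ N j (x j)|)
        ≤ ε / (A + 1) * (2 * C / width N * (K + 1) * (K + 1) ^ k) := by gcongr
      _ = _ := by ring
  have hvol : volume.real S ≤ 4 * width N * c := by
    have hvT : volume (Ioo (l i) (r i) ∩ T) ≤ ENNReal.ofReal (4 * width N) := by
      have hsub : Ioo (l i) (r i) ∩ T ⊆ Icc (l i) (l i + 2 * width N) ∪
          Icc (r i - 2 * width N) (r i) := by
        rintro t ⟨ht1, ht2 | ht2⟩
        · exact Or.inl ⟨ht1.1.le, ht2⟩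
        · exact Or.inr ⟨ht2, ht1.2.le⟩
      refine ((measure_mono hsub).trans (measure_union_le _ _)).trans_eq ?_
      rw [Real.volume_Icc, Real.volume_Icc, ← ENNReal.ofReal_add (by linarith) (by linarith)]
      congr 1; ring
    have : volume S ≤ ENNReal.ofReal (4 * width N * c) := by
      rw [hS, volume_strip, ENNReal.ofReal_mul (by positivity), hc,
        ENNReal.ofReal_prod_of_nonneg fun j _ => by linarith [h j]]
      gcongr
    exact ENNReal.toReal_le_of_le_ofReal (by positivity) this
  have hlt : volume S < ⊤ := (measure_mono hSsub).trans_lt volume_box_lt_top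
  have e2 := norm_setIntegral_le_of_norm_le_const hlt hbound
  rw [← e1, Real.norm_eq_abs] at e2
  calc |∫ x in box l r, F x| ≤ ε / (A + 1) * (2 * C / width N * (K + 1) ^ (k + 1)) *
        volume.real S := e2
    _ ≤ ε / (A + 1) * (2 * C / width N * (K + 1) ^ (k + 1)) * (4 * width N * c) := by gcongr
    _ = ε * (A / (A + 1)) := by rw [hA]; field_simp; ring
    _ < ε * 1 := by
        apply mul_lt_mul_of_pos_left _ hε
        rw [div_lt_one (by positivity)]; linarith
    _ = ε := mul_one _

end Box

/-! ### Slicing the prism -/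

section Slice

variable {m : ℕ} {B a b : ℝ}

theorem topPoint_castSucc (z : ℝ) (y : E m) (i : Fin m) : topPoint z y i.castSucc = y i := by
  simp [topPoint]

theorem topPoint_last (z : ℝ) (y : E m) : topPoint z y (Fin.last m) = z := by
  simp [topPoint]

/-- Lower corner of the prism. -/
def lowCorner (m : ℕ) (B a : ℝ) : Fin (m + 1) → ℝ := Fin.snoc (α := fun _ => ℝ) (fun _ => -B) a

/-- Upper corner of the prism. -/
def highCorner (m : ℕ) (B b : ℝ) : Fin (m + 1) → ℝ := Fin.snoc (α := fun _ => ℝ) (fun _ => B) b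

theorem prism_eq_box : prism m B a b = box (lowCorner m B a) (highCorner m B b) := by
  ext x
  simp only [prism, box, mem_ofPred_eq, Fin.forall_fin_succ', lowCorner, highCorner,
    Fin.snoc_castSucc, Fin.snoc_last]

theorem lowCorner_lt_highCorner (hB : 0 < B) (hab : a < b) (j : Fin (m + 1)) :
    lowCorner m B a j < highCorner m B b j := by
  refine Fin.lastCases ?_ (fun i => ?_) j
  · simpa [lowCorner, highCorner] using hab
  · simp [lowCorner, highCorner]; linarith

theorem isOpen_prism : IsOpen (prism m B a b) := by rw [prism_eq_box]; exact isOpen_box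

theorem measurableSet_prism : MeasurableSet (prism m B a b) := isOpen_prism.measurableSet

theorem cube_eq_box : cube m B = box (fun _ => -B) (fun _ => B) := rfl

theorem closure_prism (hB : 0 < B) (hab : a < b) : closure (prism m B a b) =
    {x | (∀ i : Fin m, x i.castSucc ∈ Icc (-B) B) ∧ x (Fin.last m) ∈ Icc a b} := by
  rw [prism_eq_box, closure_box (lowCorner_lt_highCorner hB hab)]
  ext x
  simp only [mem_ofPred_eq, Fin.forall_fin_succ', lowCorner, highCorner,
    Fin.snoc_castSucc, Fin.snoc_last]

theorem isCompact_closure_prism : IsCompact (closure (prism m B a b)) := by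
  rw [prism_eq_box]; exact isCompact_closure_box

theorem volume_prism_lt_top : volume (prism m B a b) < ⊤ := by
  rw [prism_eq_box]; exact volume_box_lt_top

instance isFiniteMeasure_restrict_prism : IsFiniteMeasure (volume.restrict (prism m B a b)) :=
  ⟨by rw [Measure.restrict_apply_univ]; exact volume_prism_lt_top⟩

instance isFiniteMeasure_restrict_cube : IsFiniteMeasure (volume.restrict (cube m B)) :=
  ⟨by rw [Measure.restrict_apply_univ, cube_eq_box]; exact volume_box_lt_top⟩

theorem continuous_topPoint : Continuous fun p : ℝ × E m => topPoint p.1 p.2 := by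
  unfold topPoint
  refine (PiLp.continuous_toLp 2 _).comp ?_
  refine continuous_pi fun j => ?_
  refine Fin.lastCases ?_ (fun i => ?_) j
  · simpa using continuous_fst
  · simp only [Fin.snoc_castSucc]
    fun_prop

/-- The prism as the product of its vertical and horizontal parts. -/
theorem measurePreserving_topPoint :
    MeasurePreserving (fun p : ℝ × E m => topPoint p.1 p.2)
      ((volume : Measure ℝ).prod volume) volume := by
  have h1 := (volume_preserving_piFinSuccAbove (fun _ : Fin (m + 1) => ℝ) (Fin.last m)).symm
  have h2 := (MeasurePreserving.id (volume : Measure ℝ)).prod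
    (PiLp.volume_preserving_ofLp (ι := Fin m))
  have h3 := (PiLp.volume_preserving_toLp (ι := Fin (m + 1))).comp (h1.comp h2)
  have e : (fun p : ℝ × E m => topPoint p.1 p.2) = WithLp.toLp 2 ∘
      (MeasurableEquiv.piFinSuccAbove (fun _ : Fin (m + 1) => ℝ) (Fin.last m)).symm ∘
        Prod.map id WithLp.ofLp := by
    funext p
    ext j
    refine Fin.lastCases ?_ (fun i => ?_) j
    · simp [topPoint, MeasurableEquiv.piFinSuccAbove]
    · simp [topPoint, MeasurableEquiv.piFinSuccAbove]
  rw [e]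
  exact h3

theorem preimage_topPoint_prism :
    (fun p : ℝ × E m => topPoint p.1 p.2) ⁻¹' prism m B a b = Ioo a b ×ˢ cube m B := by
  ext p
  simp only [prism, cube, mem_preimage, mem_ofPred_eq, topPoint_castSucc, topPoint_last, mem_prod]
  tauto

theorem measurePreserving_topPoint_prism :
    MeasurePreserving (fun p : ℝ × E m => topPoint p.1 p.2)
      ((volume.restrict (Ioo a b)).prod (volume.restrict (cube m B)))
      (volume.restrict (prism m B a b)) := by
  have h := (measurePreserving_topPoint (m := m)).restrict_preimage
    (measurableSet_prism (m := m) (B := B) (a := a) (b := b))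
  rw [preimage_topPoint_prism] at h
  rwa [Measure.prod_restrict]

theorem lintegral_prism {F : E (m + 1) → ℝ≥0∞} (hF : AEMeasurable F (volume.restrict (prism m B a b))) :
    ∫⁻ x in prism m B a b, F x = ∫⁻ z in Ioo a b, ∫⁻ y in cube m B, F (topPoint z y) := by
  have hmp := measurePreserving_topPoint_prism (m := m) (B := B) (a := a) (b := b)
  rw [← hmp.map_eq] at hF ⊢
  rw [lintegral_map' hF hmp.measurable.aemeasurable]
  exact lintegral_prod _ (hF.comp_measurable hmp.measurable)

theorem integral_prism {F : E (m + 1) → ℝ} (hF : IntegrableOn F (prism m B a b)) :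
    ∫ x in prism m B a b, F x = ∫ z in Ioo a b, ∫ y in cube m B, F (topPoint z y) := by
  have hmp := measurePreserving_topPoint_prism (m := m) (B := B) (a := a) (b := b)
  have hF' : Integrable F (volume.restrict (prism m B a b)) := hF
  rw [← hmp.map_eq] at hF' ⊢
  rw [integral_map hmp.measurable.aemeasurable hF'.aestronglyMeasurable]
  exact integral_prod _ (hF'.comp_measurable hmp.measurable)

theorem aestronglyMeasurable_slice {h : E (m + 1) → ℝ}
    (hh : AEStronglyMeasurable h (volume.restrict (prism m B a b))) :
    AEStronglyMeasurable (fun p : ℝ × E m => h (topPoint p.1 p.2))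
      ((volume.restrict (Ioo a b)).prod (volume.restrict (cube m B))) :=
  hh.comp_measurePreserving measurePreserving_topPoint_prism

theorem memLp_slice {h : E (m + 1) → ℝ} (hh : MemLp h 2 (volume.restrict (prism m B a b))) :
    ∀ᵐ z ∂(volume.restrict (Ioo a b)),
      MemLp (fun y => h (topPoint z y)) 2 (volume.restrict (cube m B)) := by
  have h1 := hh.comp_measurePreserving measurePreserving_topPoint_prism
  have h2 := h1.integrable_sq.prod_right_ae
  have h3 := (aestronglyMeasurable_slice hh.aestronglyMeasurable).prodMk_left
  filter_upwards [h2, h3] with z h2 h3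
  exact (memLp_two_iff_integrable_sq h3).2 h2

end Slice

/-! ### Tangential Fourier coefficients -/

/-- The tangential Fourier coefficient of `h` at height `z`. -/
def coef {m : ℕ} (B : ℝ) (σ : Fin m → Bool) (n : Fin m → ℤ) (h : E (m + 1) → ℝ) (z : ℝ) : ℝ :=
  ∫ y in cube m B, h (topPoint z y) * trigProd B σ n y

section Coef

variable {m : ℕ} {B a b : ℝ} {σ : Fin m → Bool} {n : Fin m → ℤ}

theorem enorm_sq_eq_ofReal (x : ℝ) : ‖x‖ₑ ^ 2 = ENNReal.ofReal (x ^ 2) := by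
  rw [← enorm_pow, Real.enorm_of_nonneg (sq_nonneg _)]

theorem aestronglyMeasurable_coef {h : E (m + 1) → ℝ}
    (hh : AEStronglyMeasurable h (volume.restrict (prism m B a b))) :
    AEStronglyMeasurable (coef B σ n h) (volume.restrict (Ioo a b)) := by
  have h1 := (aestronglyMeasurable_slice hh).mul
    ((continuous_trigProd B σ n).comp continuous_snd).aestronglyMeasurable
  exact h1.integral_prod_right'

theorem tsum_coef_sq (hB : 0 < B) {h : E (m + 1) → ℝ}
    (hh : MemLp h 2 (volume.restrict (prism m B a b))) :
    ∀ᵐ z ∂(volume.restrict (Ioo a b)), ∑' n, ENNReal.ofReal (coef B σ n h z ^ 2) =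
      ENNReal.ofReal ((2 * B) ^ m) * ∫⁻ y in cube m B, ENNReal.ofReal (h (topPoint z y) ^ 2) := by
  filter_upwards [memLp_slice hh] with z hz
  have := parseval_cube hB σ hz
  simp only [l2NormSq, enorm_sq_eq_ofReal] at this
  exact this

/-- Parseval's identity, integrated over the height with a weight. -/
theorem tsum_lintegral_coef_sq (hB : 0 < B) {h : E (m + 1) → ℝ}
    (hh : MemLp h 2 (volume.restrict (prism m B a b))) {w : ℝ → ℝ} (hw : Measurable w)
    (hw0 : ∀ z, 0 ≤ w z) :
    ∑' n, ∫⁻ z in Ioo a b, ENNReal.ofReal (w z * coef B σ n h z ^ 2) =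
      ENNReal.ofReal ((2 * B) ^ m) *
        ∫⁻ x in prism m B a b, ENNReal.ofReal (w (x (Fin.last m)) * h x ^ 2) := by
  have hm : AEMeasurable (fun x => ENNReal.ofReal (w (x (Fin.last m)) * h x ^ 2))
      (volume.restrict (prism m B a b)) :=
    (((hw.comp (continuous_coord _).measurable).aemeasurable).mul
      (hh.aestronglyMeasurable.aemeasurable.pow_const 2)).ennreal_ofReal
  rw [lintegral_prism hm, ← lintegral_tsum, ← lintegral_const_mul' _ _ ENNReal.ofReal_ne_top]
  · apply lintegral_congr_ae
    filter_upwards [tsum_coef_sq (σ := σ) hB hh] with z hz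
    simp only [ENNReal.ofReal_mul (hw0 _), topPoint_last]
    rw [ENNReal.tsum_mul_left, hz, lintegral_const_mul' _ _ ENNReal.ofReal_ne_top]
    ring
  · intro n
    exact (hw.aemeasurable.mul
      ((aestronglyMeasurable_coef hh.aestronglyMeasurable).aemeasurable.pow_const 2)).ennreal_ofReal

/-- One term of the Parseval sum with weight 1 is at most the whole sum, which is finite. -/
theorem memLp_coef (hB : 0 < B) {h : E (m + 1) → ℝ}
    (hh : MemLp h 2 (volume.restrict (prism m B a b))) :
    MemLp (coef B σ n h) 2 (volume.restrict (Ioo a b)) := by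
  have hm := aestronglyMeasurable_coef (σ := σ) (n := n) hh.aestronglyMeasurable
  rw [memLp_two_iff_integrable_sq hm]
  refine ⟨hm.pow 2, ?_⟩
  have h1 := tsum_lintegral_coef_sq (σ := σ) hB hh (w := fun _ => 1) measurable_const
    (fun _ => zero_le_one)
  have h2 := ENNReal.le_tsum (f := fun n => ∫⁻ z in Ioo a b, ENNReal.ofReal (1 * coef B σ n h z ^ 2)) n
  rw [h1] at h2
  unfold HasFiniteIntegral
  have e : ∀ z, ‖coef B σ n h z ^ 2‖ₑ = ENNReal.ofReal (1 * coef B σ n h z ^ 2) := fun z => by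
    rw [one_mul, Real.enorm_of_nonneg (sq_nonneg _)]
  simp only [e]
  refine h2.trans_lt (ENNReal.mul_lt_top ENNReal.ofReal_lt_top ?_)
  have h3 := hh.integrable_sq.hasFiniteIntegral
  unfold HasFiniteIntegral at h3
  convert h3 using 2
  ext x
  rw [one_mul, Real.enorm_of_nonneg (sq_nonneg _)]

/-- The test function with tangential part a trigonometric product and vertical part `η`. -/
def testFn (B : ℝ) (σ : Fin m → Bool) (n : Fin m → ℤ) (η : ℝ → ℝ) : Fin (m + 1) → ℝ → ℝ :=
  Fin.snoc (α := fun _ => ℝ → ℝ) (fun j => trig B (σ j) (n j)) η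

theorem prodFn_snoc (θ : Fin m → ℝ → ℝ) (η : ℝ → ℝ) (z : ℝ) (y : E m) :
    prodFn (Fin.snoc (α := fun _ => ℝ → ℝ) θ η) (topPoint z y) = prodFn θ y * η z := by
  simp [prodFn, Fin.prod_univ_castSucc, topPoint_castSucc, topPoint_last]

theorem integrableOn_mul_of_continuous_prism {h φ : E (m + 1) → ℝ}
    (hh : IntegrableOn h (prism m B a b)) (hφ : Continuous φ) :
    IntegrableOn (fun x => h x * φ x) (prism m B a b) := by
  obtain ⟨C, hC⟩ := (isCompact_closure_prism (m := m) (B := B) (a := a)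
    (b := b)).exists_bound_of_continuousOn hφ.continuousOn
  refine Integrable.mul_bdd (c := C) hh hφ.aestronglyMeasurable ?_
  filter_upwards [ae_restrict_mem measurableSet_prism] with x hx using hC x (subset_closure hx)

theorem integral_mul_prodFn_snoc {h : E (m + 1) → ℝ} (hh : IntegrableOn h (prism m B a b))
    {θ : Fin m → ℝ → ℝ} (hθ : ∀ j, Continuous (θ j)) {η : ℝ → ℝ} (hη : Continuous η) :
    ∫ x in prism m B a b, h x * prodFn (Fin.snoc (α := fun _ => ℝ → ℝ) θ η) x =
      ∫ z in Ioo a b, (∫ y in cube m B, h (topPoint z y) * prodFn θ y) * η z := by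
  have hc : Continuous (prodFn (Fin.snoc (α := fun _ => ℝ → ℝ) θ η)) := by
    refine continuous_prodFn fun j => ?_
    refine Fin.lastCases ?_ (fun i => ?_) j
    · simpa using hη
    · simpa using hθ i
  rw [integral_prism (integrableOn_mul_of_continuous_prism hh hc)]
  congr 1
  ext z
  rw [← integral_mul_const]
  congr 1
  ext y
  rw [prodFn_snoc, mul_assoc]

theorem integral_mul_testFn {h : E (m + 1) → ℝ} (hh : IntegrableOn h (prism m B a b))
    {η : ℝ → ℝ} (hη : Continuous η) :
    ∫ x in prism m B a b, h x * prodFn (testFn B σ n η) x = ∫ z in Ioo a b, coef B σ n h z * η z :=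
  integral_mul_prodFn_snoc hh (fun j => (contDiff_trig B (σ j) (n j)).continuous) hη

theorem contDiff_testFn {η : ℝ → ℝ} (hη : ContDiff ℝ ∞ η) (j : Fin (m + 1)) :
    ContDiff ℝ ∞ (testFn B σ n η j) := by
  refine Fin.lastCases ?_ (fun i => ?_) j
  · simpa [testFn] using hη
  · simpa [testFn] using contDiff_trig B (σ i) (n i)

/-! ### Derivatives of the trigonometric products and of the coefficients. -/

/-- The frequency `π n / (2 B)`. -/
def freq (B : ℝ) (n : ℤ) : ℝ := n * (Real.pi / (2 * B))

theorem deriv_trig_false (n : ℤ) : deriv (trig B false n) = fun t => freq B n * trig B true n t := by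
  ext t
  have h1 : HasDerivAt (fun t : ℝ => n * (Real.pi * (t + B) / (2 * B))) (freq B n) t := by
    have := ((((hasDerivAt_id t).add_const B).const_mul Real.pi).div_const (2 * B)).const_mul (n : ℝ)
    refine this.congr_deriv ?_
    unfold freq; ring
  have e : trig B false n = fun t => Real.sin (n * (Real.pi * (t + B) / (2 * B))) := by
    ext t; simp [trig]
  have e' : trig B true n t = Real.cos (n * (Real.pi * (t + B) / (2 * B))) := by
    simp [trig]
  rw [e, h1.sin.deriv, e']
  ring

theorem deriv_trig_true (n : ℤ) : deriv (trig B true n) = fun t => -freq B n * trig B false n t := by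
  ext t
  have h1 : HasDerivAt (fun t : ℝ => n * (Real.pi * (t + B) / (2 * B))) (freq B n) t := by
    have := ((((hasDerivAt_id t).add_const B).const_mul Real.pi).div_const (2 * B)).const_mul (n : ℝ)
    refine this.congr_deriv ?_
    unfold freq; ring
  have e : trig B true n = fun t => Real.cos (n * (Real.pi * (t + B) / (2 * B))) := by
    ext t; simp [trig]
  have e' : trig B false n t = Real.sin (n * (Real.pi * (t + B) / (2 * B))) := by
    simp [trig]
  rw [e, h1.cos.deriv, e']
  ring

theorem trig_false_left (n : ℤ) : trig B false n (-B) = 0 := by simp [trig]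

theorem trig_false_right (hB : 0 < B) (n : ℤ) : trig B false n B = 0 := by
  have : (n : ℝ) * (Real.pi * (B + B) / (2 * B)) = n * Real.pi := by field_simp; ring
  simp only [trig, Bool.false_eq_true, if_false, this, Real.sin_int_mul_pi]

/-- The parity pattern with a single cosine in the coordinate `i`. -/
def oneCos (i : Fin m) : Fin m → Bool := Function.update (fun _ => false) i true

/-- The parity pattern with sines only. -/
def noCos : Fin m → Bool := fun _ => false

/-- Differentiating the only cosine returns the pure sine product, so testing ∂ᵢu with the pattern
`oneCos i` leads back to the sine coefficients of u. -/
theorem trig_oneCos_update (i : Fin m) (n : Fin m → ℤ) (y : E m) :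
    prodFn (Function.update (fun j => trig B (oneCos i j) (n j)) i
      (deriv (trig B (oneCos i i) (n i)))) y = -freq B (n i) * trigProd B noCos n y := by
  rw [prodFn_update]
  have e : oneCos i i = true := by simp [oneCos]
  rw [e, deriv_trig_true, mul_assoc]
  congr 1
  unfold trigProd
  rw [← Finset.mul_prod_erase _ _ (Finset.mem_univ i)]
  congr 1
  refine Finset.prod_congr rfl fun j hj => ?_
  simp [oneCos, noCos, Function.update_of_ne (Finset.ne_of_mem_erase hj)]

theorem trig_noCos_update (i : Fin m) (n : Fin m → ℤ) (y : E m) :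
    prodFn (Function.update (fun j => trig B (noCos j) (n j)) i
      (deriv (trig B (noCos i) (n i)))) y = freq B (n i) * trigProd B (oneCos i) n y := by
  rw [prodFn_update]
  have e : noCos i = false := rfl
  rw [e, deriv_trig_false, mul_assoc]
  congr 1
  unfold trigProd
  rw [← Finset.mul_prod_erase _ _ (Finset.mem_univ i)]
  congr 1
  · simp [oneCos]
  · refine Finset.prod_congr rfl fun j hj => ?_
    simp [oneCos, noCos, Function.update_of_ne (Finset.ne_of_mem_erase hj)]

theorem testFn_update_castSucc (i : Fin m) (η f : ℝ → ℝ) :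
    Function.update (testFn B σ n η) i.castSucc f =
      Fin.snoc (α := fun _ => ℝ → ℝ) (Function.update (fun j => trig B (σ j) (n j)) i f) η := by
  unfold testFn
  rw [Fin.snoc_update]

theorem testFn_update_last (η f : ℝ → ℝ) :
    Function.update (testFn B σ n η) (Fin.last m) f = testFn B σ n f := by
  unfold testFn
  rw [Fin.update_snoc_last]

theorem ae_eq_of_forall_integral_eq {f g : ℝ → ℝ} (hf : IntegrableOn f (Ioo a b))
    (hg : IntegrableOn g (Ioo a b))
    (h : ∀ η : ℝ → ℝ, ContDiff ℝ ∞ η → ∫ z in Ioo a b, f z * η z = ∫ z in Ioo a b, g z * η z) :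
    ∀ᵐ z ∂(volume.restrict (Ioo a b)), f z = g z := by
  have key := IsOpen.ae_eq_zero_of_integral_contDiff_smul_eq_zero (μ := volume)
    (isOpen_Ioo (a := a) (b := b)) (f := fun z => f z - g z)
    (hf.sub hg).locallyIntegrableOn ?_
  · rw [ae_restrict_iff' measurableSet_Ioo]
    filter_upwards [key] with z hz hz'
    linarith [hz hz']
  · intro η h1 h2 h3
    rw [← setIntegral_eq_integral_of_forall_compl_eq_zero (s := Ioo a b)]
    · have e : ∀ z, η z • (f z - g z) = f z * η z - g z * η z := fun z => by
        rw [smul_eq_mul]; ring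
      simp only [e]
      rw [integral_sub (integrableOn_mul_of_continuous hf h1.continuous)
        (integrableOn_mul_of_continuous hg h1.continuous), h η h1, sub_self]
    · intro x hx
      rw [image_eq_zero_of_notMem_tsupport (fun hh => hx (h3 hh)), zero_smul]

theorem MemLp.integrableOn_prism {h : E (m + 1) → ℝ}
    (hh : MemLp h 2 (volume.restrict (prism m B a b))) : IntegrableOn h (prism m B a b) :=
  hh.integrable (by norm_num)

theorem integrableOn_coef (hB : 0 < B) {h : E (m + 1) → ℝ}
    (hh : MemLp h 2 (volume.restrict (prism m B a b))) : IntegrableOn (coef B σ n h) (Ioo a b) :=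
  (memLp_coef hB hh).integrable (by norm_num)

theorem integral_smul_coef {h : E (m + 1) → ℝ} (hh : IntegrableOn h (prism m B a b)) (c : ℝ)
    {θ : Fin m → ℝ → ℝ} (hθ : ∀ j, Continuous (θ j)) {η : ℝ → ℝ} (hη : Continuous η)
    (e : ∀ y, prodFn θ y = c * trigProd B σ n y) :
    ∫ x in prism m B a b, h x * prodFn (Fin.snoc (α := fun _ => ℝ → ℝ) θ η) x =
      ∫ z in Ioo a b, (c * coef B σ n h z) * η z := by
  rw [integral_mul_prodFn_snoc hh hθ hη]
  congr 1
  ext z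
  congr 1
  unfold coef
  rw [← integral_const_mul]
  congr 1
  ext y
  rw [e]; ring

theorem continuous_update_trig (i : Fin m) (σ : Fin m → Bool) (n : Fin m → ℤ) (j : Fin m) :
    Continuous (Function.update (fun j => trig B (σ j) (n j)) i (deriv (trig B (σ i) (n i))) j) := by
  rcases eq_or_ne j i with rfl | hj
  · simp only [Function.update_self]
    exact (contDiff_trig B (σ j) (n j)).continuous_deriv (by simp)
  · simp only [Function.update_of_ne hj]
    exact (contDiff_trig B (σ j) (n j)).continuous

/-- The coefficients of a tangential weak derivative of a function that vanishes on the lateral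
boundary. -/
theorem coef_tangential (hB : 0 < B) (hab : a < b) {u g : E (m + 1) → ℝ} {i : Fin m}
    (hw : HasWeakPartial (prism m B a b) i.castSucc u g)
    (huc : ContinuousOn u (closure (prism m B a b)))
    (hu0 : ∀ x ∈ closure (prism m B a b), x i.castSucc = -B ∨ x i.castSucc = B → u x = 0)
    (hu : MemLp u 2 (volume.restrict (prism m B a b)))
    (hg : MemLp g 2 (volume.restrict (prism m B a b))) (n : Fin m → ℤ) :
    ∀ᵐ z ∂(volume.restrict (Ioo a b)),
      coef B (oneCos i) n g z = freq B (n i) * coef B noCos n u z := by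
  refine ae_eq_of_forall_integral_eq (integrableOn_coef hB hg)
    ((integrableOn_coef hB hu).const_mul _) fun η hη => ?_
  have hui := MemLp.integrableOn_prism hu
  have hgi := MemLp.integrableOn_prism hg
  rw [← integral_mul_testFn hgi hη.continuous]
  have hw' := hw
  rw [prism_eq_box] at hw' huc hu0
  have hgi' := hgi
  rw [prism_eq_box] at hgi'
  -- The cosine in coordinate i does not vanish at ±B, so the boundary term has to be removed by the
  -- boundary values of u.
  have key := hw'.integral_of_vanishes_on_faces (lowCorner_lt_highCorner hB hab) huc
    (by simpa [lowCorner, highCorner] using hu0) hgi'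
    (contDiff_testFn (B := B) (σ := oneCos i) (n := n) hη)
  rw [← prism_eq_box, testFn_update_castSucc] at key
  have e : testFn B (oneCos i) n η i.castSucc = trig B (oneCos i i) (n i) := by simp [testFn]
  rw [e, integral_smul_coef hui (-freq B (n i)) (continuous_update_trig i _ n) hη.continuous
    (fun y => trig_oneCos_update i n y)] at key
  have e2 : ∫ z in Ioo a b, (-freq B (n i) * coef B noCos n u z) * η z =
      - ∫ z in Ioo a b, (freq B (n i) * coef B noCos n u z) * η z := by
    rw [← integral_neg]; congr 1; ext z; ring
  rw [e2] at key
  linarith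

/-- The sine coefficients of a tangential weak derivative. -/
theorem coef_tangential_of_sine (hB : 0 < B) {g h : E (m + 1) → ℝ} {i : Fin m}
    (hw : HasWeakPartial (prism m B a b) i.castSucc g h)
    (hg : MemLp g 2 (volume.restrict (prism m B a b)))
    (hh : MemLp h 2 (volume.restrict (prism m B a b))) (n : Fin m → ℤ) :
    ∀ᵐ z ∂(volume.restrict (Ioo a b)),
      coef B noCos n h z = -freq B (n i) * coef B (oneCos i) n g z := by
  refine ae_eq_of_forall_integral_eq (integrableOn_coef hB hh)
    ((integrableOn_coef hB hg).const_mul _) fun η hη => ?_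
  have hgi := MemLp.integrableOn_prism hg
  have hhi := MemLp.integrableOn_prism hh
  rw [← integral_mul_testFn hhi hη.continuous]
  have hw' := hw
  have hgi' := hgi
  have hhi' := hhi
  rw [prism_eq_box] at hw' hgi' hhi'
  -- Now the i-th factor is a sine and vanishes at ±B, so no boundary values of the first derivative
  -- g are needed.
  have key := hw'.integral_of_factor_vanishes hgi' hhi'
    (contDiff_testFn (B := B) (σ := noCos) (n := n) hη)
    (by simp [lowCorner, testFn, noCos, trig_false_left])
    (by simp [highCorner, testFn, noCos, trig_false_right hB])
  rw [← prism_eq_box, testFn_update_castSucc] at key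
  have e : testFn B noCos n η i.castSucc = trig B (noCos i) (n i) := by simp [testFn]
  rw [e, integral_smul_coef hgi (freq B (n i)) (continuous_update_trig i _ n) hη.continuous
    (fun y => trig_noCos_update i n y)] at key
  have e2 : ∫ z in Ioo a b, (-freq B (n i) * coef B (oneCos i) n g z) * η z =
      - ∫ z in Ioo a b, (freq B (n i) * coef B (oneCos i) n g z) * η z := by
    rw [← integral_neg]; congr 1; ext z; ring
  rw [e2]
  linarith

/-- The coefficients of the vertical weak derivative. -/
theorem coef_vertical {u g : E (m + 1) → ℝ}
    (hw : HasWeakPartial (prism m B a b) (Fin.last m) u g)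
    (hu : MemLp u 2 (volume.restrict (prism m B a b)))
    (hg : MemLp g 2 (volume.restrict (prism m B a b))) (σ : Fin m → Bool) (n : Fin m → ℤ) :
    HasWeakDeriv a b (coef B σ n u) (coef B σ n g) := by
  intro η hη _ hs
  have hui := MemLp.integrableOn_prism hu
  have hgi := MemLp.integrableOn_prism hg
  rw [← integral_mul_testFn hgi hη.continuous,
    ← integral_mul_testFn hui (hη.continuous_deriv (by simp))]
  have hw' := hw
  have hui' := hui
  have hgi' := hgi
  rw [prism_eq_box] at hw' hui' hgi'
  have ha : η a = 0 := image_eq_zero_of_notMem_tsupport fun hh => (lt_irrefl _ (hs hh).1)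
  have hb : η b = 0 := image_eq_zero_of_notMem_tsupport fun hh => (lt_irrefl _ (hs hh).2)
  -- Only the vertical factor η must vanish at its end points; the tangential factors may be
  -- arbitrary, which is why this holds for every parity pattern.
  have key := hw'.integral_of_factor_vanishes hui' hgi'
    (contDiff_testFn (B := B) (σ := σ) (n := n) hη)
    (by simp [lowCorner, testFn, ha]) (by simp [highCorner, testFn, hb])
  have e : testFn B σ n η (Fin.last m) = η := by simp [testFn]
  rwa [← prism_eq_box, e, testFn_update_last] at key

end Coef

/-! ### Vertical regularity of the Fourier coefficients -/

section Vertical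

variable {a b : ℝ}

theorem eqOn_Icc_of_ae_eq (hab : a < b) {f g : ℝ → ℝ} (hf : ContinuousOn f (Icc a b))
    (hg : ContinuousOn g (Icc a b)) (h : ∀ᵐ z ∂(volume.restrict (Ioo a b)), f z = g z) :
    EqOn f g (Icc a b) := by
  have h1 : EqOn f g (Ioo a b) := by
    have := Measure.eqOn_open_of_ae_eq (μ := volume) (f := f) (g := g) (U := Ioo a b) h isOpen_Ioo
      (hf.mono Ioo_subset_Icc_self) (hg.mono Ioo_subset_Icc_self)
    exact this
  exact h1.of_subset_closure hf hg Ioo_subset_Icc_self (by rw [closure_Ioo hab.ne])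

theorem continuousOn_primitive_Icc (hab : a < b) {w : ℝ → ℝ} (hw : IntegrableOn w (Ioo a b)) (C : ℝ) :
    ContinuousOn (fun z => C + ∫ t in a..z, w t) (Icc a b) := by
  have := ((intervalIntegrable_of_integrableOn_Ioo hab.le
      hw).absolutelyContinuousOnInterval_intervalIntegral (c := a) (by simp)).continuousOn
  rw [uIcc_of_le hab.le] at this
  exact continuousOn_const.add this

/-- A continuous function with two integrable weak derivatives is a double primitive. -/
theorem exists_double_primitive (hab : a < b) {c v w : ℝ → ℝ} (hc : ContinuousOn c (Icc a b))
    (hv : IntegrableOn v (Ioo a b)) (hw : IntegrableOn w (Ioo a b)) (hcv : HasWeakDeriv a b c v)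
    (hvw : HasWeakDeriv a b v w) :
    ∃ C, (∀ᵐ z ∂(volume.restrict (Ioo a b)), v z = C + ∫ t in a..z, w t) ∧
      (∀ z ∈ Icc a b, c z = c a + ∫ s in a..z, (C + ∫ t in a..s, w t)) ∧
      HasDerivWithinAt c (C + ∫ t in a..b, w t) (Icc a b) b := by
  obtain ⟨C, hC⟩ := hvw.exists_primitive hab hv hw
  have hci : IntegrableOn c (Ioo a b) := hc.integrableOn_Icc.mono_set Ioo_subset_Icc_self
  obtain ⟨K, hK⟩ := hcv.exists_primitive hab hci hv
  have hVc := continuousOn_primitive_Icc hab hw C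
  have e1 : EqOn c (fun z => K + ∫ t in a..z, v t) (Icc a b) :=
    eqOn_Icc_of_ae_eq hab hc (continuousOn_primitive_Icc hab hv K) hK
  have e2 : ∀ z ∈ Icc a b, ∫ t in a..z, v t = ∫ s in a..z, (C + ∫ t in a..s, w t) := by
    intro z hz
    apply intervalIntegral.integral_congr_ae
    rw [ae_restrict_iff' measurableSet_Ioo] at hC
    have hne : ∀ᵐ x : ℝ, x ≠ b := by simp [ae_iff]
    filter_upwards [hC, hne] with x hx hxb hxz
    rw [uIoc_of_le hz.1] at hxz
    exact hx ⟨hxz.1, lt_of_le_of_ne (hxz.2.trans hz.2) hxb⟩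
  have hKa : K = c a := by
    have := e1 (left_mem_Icc.2 hab.le); simpa using this.symm
  have e3 : ∀ z ∈ Icc a b, c z = c a + ∫ s in a..z, (C + ∫ t in a..s, w t) := by
    intro z hz
    rw [← e2 z hz, ← hKa]; exact e1 hz
  refine ⟨C, hC, e3, ?_⟩
  have hint : IntervalIntegrable (fun s => C + ∫ t in a..s, w t) volume a b := by
    apply ContinuousOn.intervalIntegrable
    rwa [uIcc_of_le hab.le]
  have hd : HasDerivWithinAt (fun z => ∫ s in a..z, (C + ∫ t in a..s, w t))
      (C + ∫ t in a..b, w t) (Icc a b) b := by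
    have : Fact (b ∈ Icc a b) := ⟨right_mem_Icc.2 hab.le⟩
    refine intervalIntegral.integral_hasDerivWithinAt_right hint ?_ (hVc b (right_mem_Icc.2 hab.le))
    exact hVc.stronglyMeasurableAtFilter_nhdsWithin measurableSet_Icc b
  exact (hd.const_add (c a)).congr e3 (e3 b (right_mem_Icc.2 hab.le))

/-- The Carleman estimate for a function with two weak derivatives. -/
theorem carleman_estimate_weak (ha : 0 < a) (hab : a < b) {l : ℝ} (hl : 1 ≤ l) (k : ℝ)
    {c v w : ℝ → ℝ} (hc : ContinuousOn c (Icc a b)) (hca : c a = 0)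
    (hv : MemLp v 2 (volume.restrict (Ioo a b))) (hw : MemLp w 2 (volume.restrict (Ioo a b)))
    (hcv : HasWeakDeriv a b c v) (hvw : HasWeakDeriv a b v w) :
    l * ∫ z in Ioo a b, carlemanWeight l z * (v z ^ 2 + k ^ 2 * c z ^ 2 + c z ^ 2) ≤
      carlemanConst a b * (∫ z in Ioo a b, carlemanWeight l z * (w z - k ^ 2 * c z) ^ 2) +
        carlemanDataConst a b l * (c b ^ 2 + derivWithin c (Icc a b) b ^ 2) := by
  have hv1 : IntegrableOn v (Ioo a b) := hv.integrable (by norm_num)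
  have hw1 : IntegrableOn w (Ioo a b) := hw.integrable (by norm_num)
  obtain ⟨C, hC1, hC2, hC3⟩ := exists_double_primitive hab hc hv1 hw1 hcv hvw
  rw [hca] at hC2
  simp only [zero_add] at hC2
  have hbm : b ∈ Icc a b := right_mem_Icc.2 hab.le
  rw [hC3.derivWithin (uniqueDiffOn_Icc hab b hbm), hC2 b hbm]
  have hVc := continuousOn_primitive_Icc hab hw1 C
  have hVi : IntegrableOn (fun s => C + ∫ t in a..s, w t) (Ioo a b) :=
    hVc.integrableOn_Icc.mono_set Ioo_subset_Icc_self
  have hVAC : AbsolutelyContinuousOnInterval (fun s => C + ∫ t in a..s, w t) a b :=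
    (contDiff_absolutelyContinuousOnInterval contDiff_const a b).add
      ((intervalIntegrable_of_integrableOn_Ioo hab.le
        hw1).absolutelyContinuousOnInterval_intervalIntegral (c := a) (by simp))
  have hcAC : AbsolutelyContinuousOnInterval (fun z => ∫ s in a..z, (C + ∫ t in a..s, w t)) a b :=
    (intervalIntegrable_of_integrableOn_Ioo hab.le
        hVi).absolutelyContinuousOnInterval_intervalIntegral (c := a) (by simp)
  have key := carleman_estimate ha hab hl k hcAC hVAC (ae_hasDerivAt_primitive hab.le hVi)
    ?_ (by simp) hw
  · convert key using 2
    · apply integral_congr_ae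
      filter_upwards [hC1, ae_restrict_mem measurableSet_Ioo] with z hz hz'
      rw [hz, hC2 z (Ioo_subset_Icc_self hz')]
    · congr 1
      apply integral_congr_ae
      filter_upwards [ae_restrict_mem measurableSet_Ioo] with z hz'
      rw [hC2 z (Ioo_subset_Icc_self hz')]
  · filter_upwards [ae_hasDerivAt_primitive hab.le hw1] with z hz hz'
    exact (hz hz').const_add C

end Vertical

/-! ### The Carleman estimate in the prism -/

section Prism

variable {m : ℕ} {B a b : ℝ}

theorem topPoint_mem_closure (hB : 0 < B) (hab : a < b) {z : ℝ} (hz : z ∈ Icc a b) {y : E m}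
    (hy : y ∈ closure (cube m B)) : topPoint z y ∈ closure (prism m B a b) := by
  rw [closure_prism hB hab]
  have hy' := closure_box_subset hy
  simp only [mem_ofPred_eq, topPoint_castSucc, topPoint_last]
  exact ⟨fun i => hy' i, hz⟩

theorem frontier_prism : frontier (prism m B a b) = closure (prism m B a b) \ prism m B a b :=
  isOpen_prism.frontier_eq

theorem topPoint_mem_frontier_low (hB : 0 < B) (hab : a < b) {y : E m} (hy : y ∈ cube m B) :
    topPoint a y ∈ frontier (prism m B a b) \ topFace m B b := by
  rw [frontier_prism]
  refine ⟨⟨topPoint_mem_closure hB hab (left_mem_Icc.2 hab.le) (subset_closure hy), fun h => ?_⟩,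
    fun h => ?_⟩
  · have := h.2.1; rw [topPoint_last] at this; exact lt_irrefl _ this
  · have := h.2; rw [topPoint_last] at this; exact hab.ne this

theorem mem_frontier_lateral {x : E (m + 1)} (hx : x ∈ closure (prism m B a b)) {i : Fin m}
    (h : x i.castSucc = -B ∨ x i.castSucc = B) : x ∈ frontier (prism m B a b) \ topFace m B b := by
  have hi : x i.castSucc ∉ Ioo (-B) B := by
    rintro ⟨h1, h2⟩
    rcases h with h | h
    · exact h1.ne' h
    · exact h2.ne h
  rw [frontier_prism]
  exact ⟨⟨hx, fun h' => hi (h'.1 i)⟩, fun h' => hi (h'.1 i)⟩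

theorem memLp_of_continuousOn_closure {u : E (m + 1) → ℝ}
    (hu : ContinuousOn u (closure (prism m B a b))) : MemLp u 2 (volume.restrict (prism m B a b)) := by
  obtain ⟨C, hC⟩ := isCompact_closure_prism.exists_bound_of_continuousOn hu
  refine MemLp.of_bound ((hu.mono subset_closure).aestronglyMeasurable measurableSet_prism) C ?_
  filter_upwards [ae_restrict_mem measurableSet_prism] with x hx using hC x (subset_closure hx)

theorem continuousOn_slice (hB : 0 < B) (hab : a < b) {u : E (m + 1) → ℝ}
    (hu : ContinuousOn u (closure (prism m B a b))) {z : ℝ} (hz : z ∈ Icc a b) :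
    ContinuousOn (fun y => u (topPoint z y)) (closure (cube m B)) := by
  have hc : Continuous fun y : E m => topPoint z y :=
    continuous_topPoint.comp (continuous_const.prodMk continuous_id)
  exact hu.comp hc.continuousOn fun y hy => topPoint_mem_closure hB hab hz hy

theorem memLp_slice_of_continuousOn (hB : 0 < B) (hab : a < b) {u : E (m + 1) → ℝ}
    (hu : ContinuousOn u (closure (prism m B a b))) {z : ℝ} (hz : z ∈ Icc a b) :
    MemLp (fun y => u (topPoint z y)) 2 (volume.restrict (cube m B)) := by
  have hs := continuousOn_slice hB hab hu hz
  have hcpt : IsCompact (closure (cube m B)) := isCompact_closure_box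
  obtain ⟨C, hC⟩ := hcpt.exists_bound_of_continuousOn hs
  refine MemLp.of_bound ((hs.mono subset_closure).aestronglyMeasurable (measurableSet_cube m B)) C ?_
  filter_upwards [ae_restrict_mem (measurableSet_cube m B)] with x hx using hC x (subset_closure hx)

theorem continuousOn_coef (hB : 0 < B) (hab : a < b) {u : E (m + 1) → ℝ}
    (hu : ContinuousOn u (closure (prism m B a b))) (σ : Fin m → Bool) (n : Fin m → ℤ) :
    ContinuousOn (coef B σ n u) (Icc a b) := by
  obtain ⟨C, hC⟩ := (isCompact_closure_prism (m := m) (B := B) (a := a)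
    (b := b)).exists_bound_of_continuousOn hu
  unfold coef
  refine continuousOn_of_dominated (bound := fun _ => C) ?_ ?_ (integrable_const _) ?_
  · intro z hz
    exact (memLp_slice_of_continuousOn hB hab hu hz).aestronglyMeasurable.mul
      (continuous_trigProd B σ n).aestronglyMeasurable
  · intro z hz
    filter_upwards [ae_restrict_mem (measurableSet_cube m B)] with y hy
    rw [norm_mul]
    have h1 := hC _ (topPoint_mem_closure hB hab hz (subset_closure hy))
    have h2 : ‖trigProd B σ n y‖ ≤ 1 := abs_trigProd_le_one B σ n y
    have := mul_le_mul h1 h2 (norm_nonneg _) ((norm_nonneg _).trans h1)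
    linarith
  · filter_upwards [ae_restrict_mem (measurableSet_cube m B)] with y hy
    refine ContinuousOn.mul ?_ continuousOn_const
    have hc : Continuous fun z : ℝ => topPoint z y :=
      continuous_topPoint.comp (continuous_id.prodMk continuous_const)
    exact hu.comp hc.continuousOn fun z hz => topPoint_mem_closure hB hab hz (subset_closure hy)

theorem coef_low (hB : 0 < B) (hab : a < b) {u : E (m + 1) → ℝ}
    (hu0 : ∀ x ∈ frontier (prism m B a b) \ topFace m B b, u x = 0) (σ : Fin m → Bool)
    (n : Fin m → ℤ) : coef B σ n u a = 0 := by
  unfold coef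
  rw [setIntegral_congr_fun (g := fun _ => 0) (measurableSet_cube m B)]
  · simp
  · intro y hy
    simp only [hu0 _ (topPoint_mem_frontier_low hB hab hy), zero_mul]

theorem coef_sum {ι : Type*} (s : Finset ι) {h : ι → E (m + 1) → ℝ}
    (hh : ∀ i ∈ s, MemLp (h i) 2 (volume.restrict (prism m B a b))) (σ : Fin m → Bool)
    (n : Fin m → ℤ) : ∀ᵐ z ∂(volume.restrict (Ioo a b)),
      coef B σ n (fun x => ∑ i ∈ s, h i x) z = ∑ i ∈ s, coef B σ n (h i) z := by
  have h1 : ∀ᵐ z ∂(volume.restrict (Ioo a b)), ∀ i ∈ s,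
      MemLp (fun y => h i (topPoint z y)) 2 (volume.restrict (cube m B)) :=
    (Finset.eventually_all s).2 fun i hi => memLp_slice (hh i hi)
  filter_upwards [h1] with z hz
  unfold coef
  simp only [Finset.sum_mul]
  rw [integral_finsetSum]
  intro i hi
  refine Integrable.mul_bdd (c := 1) ((hz i hi).integrable (by norm_num))
    (continuous_trigProd B σ n).aestronglyMeasurable (Eventually.of_forall fun y => ?_)
  exact abs_trigProd_le_one B σ n y

/-- The Fourier coefficients of the normal derivative on the top face. -/
def topDeriv (B a b : ℝ) (n : Fin m → ℤ) (u : E (m + 1) → ℝ) : ℝ :=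
  derivWithin (coef B noCos n u) (Icc a b) b

/-- The sum of the squares of the Fourier coefficients of the Cauchy data on the top face. -/
def topData (B a b : ℝ) (u : E (m + 1) → ℝ) : ℝ≥0∞ :=
  ∑' n : Fin m → ℤ, ENNReal.ofReal (coef B noCos n u b ^ 2 + topDeriv B a b n u ^ 2)

/-- The hypotheses on a function of class `H²` that is continuous up to the boundary and vanishes on
the boundary outside the top face. -/
structure IsAdmissible (B a b : ℝ) (u : E (m + 1) → ℝ) (g h : Fin (m + 1) → E (m + 1) → ℝ) : Prop where
  cont : ContinuousOn u (closure (prism m B a b))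
  zero : ∀ x ∈ frontier (prism m B a b) \ topFace m B b, u x = 0
  grad : HasWeakGrad (prism m B a b) u g
  grad_memLp : ∀ i, MemLp (g i) 2 (volume.restrict (prism m B a b))
  second : ∀ i, HasWeakPartial (prism m B a b) i (g i) (h i)
  second_memLp : ∀ i, MemLp (h i) 2 (volume.restrict (prism m B a b))

variable {u : E (m + 1) → ℝ} {g h : Fin (m + 1) → E (m + 1) → ℝ}

theorem ofReal_setIntegral_eq {f : ℝ → ℝ} (hf : IntegrableOn f (Ioo a b)) (h0 : ∀ z, 0 ≤ f z) :
    ENNReal.ofReal (∫ z in Ioo a b, f z) = ∫⁻ z in Ioo a b, ENNReal.ofReal (f z) :=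
  ofReal_integral_eq_lintegral_ofReal hf (Eventually.of_forall h0)

theorem integrableOn_weight_sq {l : ℝ} {f : ℝ → ℝ} (hf : MemLp f 2 (volume.restrict (Ioo a b))) :
    IntegrableOn (fun z => carlemanWeight l z * f z ^ 2) (Ioo a b) :=
  integrable_mul_sq_of_continuousOn (contDiff_carlemanWeight l).continuous.continuousOn hf

/-- The Carleman estimate for one Fourier mode. -/
theorem IsAdmissible.carleman_mode (hB : 0 < B) (ha : 0 < a) (hab : a < b)
    (H : IsAdmissible B a b u g h) {l : ℝ} (hl : 1 ≤ l) (n : Fin m → ℤ) :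
    ENNReal.ofReal l * ((∫⁻ z in Ioo a b,
        ENNReal.ofReal (carlemanWeight l z * coef B noCos n (g (Fin.last m)) z ^ 2)) +
      (∑ i, ∫⁻ z in Ioo a b,
        ENNReal.ofReal (carlemanWeight l z * coef B (oneCos i) n (g i.castSucc) z ^ 2)) +
      ∫⁻ z in Ioo a b, ENNReal.ofReal (carlemanWeight l z * coef B noCos n u z ^ 2)) ≤
    ENNReal.ofReal (carlemanConst a b) * (∫⁻ z in Ioo a b,
      ENNReal.ofReal (carlemanWeight l z * coef B noCos n (fun x => ∑ i, h i x) z ^ 2)) +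
    ENNReal.ofReal (carlemanDataConst a b l) *
      ENNReal.ofReal (coef B noCos n u b ^ 2 + topDeriv B a b n u ^ 2) := by
  have huL := memLp_of_continuousOn_closure H.cont
  have hw0 : ∀ z, 0 ≤ carlemanWeight l z := fun z => (carlemanWeight_pos l z).le
  have hk : 0 ≤ ∑ i, freq B (n i) ^ 2 := Finset.sum_nonneg fun _ _ => sq_nonneg _
  have hFL : MemLp (fun x => ∑ i, h i x) 2 (volume.restrict (prism m B a b)) :=
    memLp_finsetSum _ fun i _ => H.second_memLp i
  -- The frequency k of the mode is the length of its vector of tangential frequencies, since only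
  -- k² enters.
  have key := carleman_estimate_weak ha hab hl (Real.sqrt (∑ i, freq B (n i) ^ 2))
    (continuousOn_coef hB hab H.cont noCos n) (coef_low hB hab H.zero noCos n)
    (memLp_coef hB (H.grad_memLp (Fin.last m))) (memLp_coef hB (H.second_memLp (Fin.last m)))
    (coef_vertical (H.grad _) huL (H.grad_memLp _) noCos n)
    (coef_vertical (H.second _) (H.grad_memLp _) (H.second_memLp _) noCos n)
  rw [Real.sq_sqrt hk] at key
  have htan : ∀ᵐ z ∂(volume.restrict (Ioo a b)), ∀ i : Fin m,
      coef B (oneCos i) n (g i.castSucc) z = freq B (n i) * coef B noCos n u z :=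
    ae_all_iff.2 fun i => coef_tangential hB hab (H.grad _) H.cont
      (fun x hx h => H.zero x (mem_frontier_lateral hx h)) huL (H.grad_memLp _) n
  have htan2 : ∀ᵐ z ∂(volume.restrict (Ioo a b)), ∀ i : Fin m,
      coef B noCos n (h i.castSucc) z = -freq B (n i) * coef B (oneCos i) n (g i.castSucc) z :=
    ae_all_iff.2 fun i => coef_tangential_of_sine hB (H.second _) (H.grad_memLp _)
      (H.second_memLp _) n
  have hsum := coef_sum Finset.univ (fun i _ => H.second_memLp i) noCos n
  -- Moving two tangential derivatives onto the sine produces the factor -freq², so subtracting k²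
  -- times the coefficient of u from that of the second vertical derivative gives the coefficient of
  -- the full Laplacian.
  have eF : ∫ z in Ioo a b, carlemanWeight l z * (coef B noCos n (h (Fin.last m)) z -
        (∑ i, freq B (n i) ^ 2) * coef B noCos n u z) ^ 2 =
      ∫ z in Ioo a b, carlemanWeight l z * coef B noCos n (fun x => ∑ i, h i x) z ^ 2 := by
    apply integral_congr_ae
    filter_upwards [htan, htan2, hsum] with z h1 h2 h3
    rw [h3, Fin.sum_univ_castSucc]
    congr 2
    have : ∑ i : Fin m, coef B noCos n (h i.castSucc) z =
        -((∑ i, freq B (n i) ^ 2) * coef B noCos n u z) := by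
      rw [Finset.sum_mul, ← Finset.sum_neg_distrib]
      refine Finset.sum_congr rfl fun i _ => ?_
      rw [h2, h1]; ring
    rw [this]; ring
  -- The term k² c² is the sum of the squared coefficients of the tangential derivatives, each
  -- against its own mixed system.
  have eL : ∫ z in Ioo a b, carlemanWeight l z * (coef B noCos n (g (Fin.last m)) z ^ 2 +
        (∑ i, freq B (n i) ^ 2) * coef B noCos n u z ^ 2 + coef B noCos n u z ^ 2) =
      (∫ z in Ioo a b, carlemanWeight l z * coef B noCos n (g (Fin.last m)) z ^ 2) +
      (∑ i, ∫ z in Ioo a b, carlemanWeight l z * coef B (oneCos i) n (g i.castSucc) z ^ 2) +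
      ∫ z in Ioo a b, carlemanWeight l z * coef B noCos n u z ^ 2 := by
    have i1 := integrableOn_weight_sq (l := l) (memLp_coef (σ := noCos) (n := n) hB
      (H.grad_memLp (Fin.last m)))
    have i2 := fun i : Fin m => integrableOn_weight_sq (l := l) (memLp_coef (σ := oneCos i) (n := n) hB
      (H.grad_memLp i.castSucc))
    have i3 := integrableOn_weight_sq (l := l) (memLp_coef (σ := noCos) (n := n) hB huL)
    have i4 : IntegrableOn (fun z => ∑ i : Fin m, carlemanWeight l z *
        coef B (oneCos i) n (g i.castSucc) z ^ 2) (Ioo a b) := integrable_finsetSum _ fun i _ => i2 i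
    have i5 : IntegrableOn (fun z => carlemanWeight l z * coef B noCos n (g (Fin.last m)) z ^ 2 +
        ∑ i : Fin m, carlemanWeight l z * coef B (oneCos i) n (g i.castSucc) z ^ 2) (Ioo a b) :=
      i1.add i4
    rw [← integral_finsetSum _ fun i _ => i2 i, ← integral_add i1 i4, ← integral_add i5 i3]
    apply integral_congr_ae
    filter_upwards [htan] with z h1
    simp only [h1, mul_pow]
    have : ∑ i, carlemanWeight l z * (freq B (n i) ^ 2 * coef B noCos n u z ^ 2) =
        carlemanWeight l z * ((∑ i, freq B (n i) ^ 2) * coef B noCos n u z ^ 2) := by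
      rw [Finset.sum_mul, Finset.mul_sum]
    rw [this]; ring
  rw [eF, eL] at key
  have key' := ENNReal.ofReal_le_ofReal key
  have hb : 0 < b := ha.trans hab
  have n1 : ∀ (σ : Fin m → Bool) (f : E (m + 1) → ℝ), 0 ≤ ∫ z in Ioo a b,
      carlemanWeight l z * coef B σ n f z ^ 2 := fun σ f =>
    integral_nonneg fun z => mul_nonneg (hw0 z) (sq_nonneg _)
  have n2 : ∀ (σ : Fin m → Bool) (f : E (m + 1) → ℝ) z, 0 ≤
      carlemanWeight l z * coef B σ n f z ^ 2 := fun σ f z => mul_nonneg (hw0 z) (sq_nonneg _)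
  rw [ENNReal.ofReal_mul (by linarith), ENNReal.ofReal_add
      (add_nonneg (n1 _ _) (Finset.sum_nonneg fun i _ => n1 _ _)) (n1 _ _),
    ENNReal.ofReal_add (n1 _ _) (Finset.sum_nonneg fun i _ => n1 _ _),
    ENNReal.ofReal_sum_of_nonneg (fun i _ => n1 _ _), ENNReal.ofReal_add
      (mul_nonneg carlemanConst_pos.le (n1 _ _))
      (mul_nonneg (carlemanDataConst_pos hb hl).le (by positivity)),
    ENNReal.ofReal_mul carlemanConst_pos.le, ENNReal.ofReal_mul (carlemanDataConst_pos hb hl).le,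
    ofReal_setIntegral_eq (integrableOn_weight_sq (memLp_coef hB (H.grad_memLp _))) (n2 _ _),
    ofReal_setIntegral_eq (integrableOn_weight_sq (memLp_coef hB huL)) (n2 _ _),
    ofReal_setIntegral_eq (integrableOn_weight_sq (memLp_coef hB hFL)) (n2 _ _)] at key'
  have e4 : ∀ i : Fin m, ENNReal.ofReal (∫ z in Ioo a b,
      carlemanWeight l z * coef B (oneCos i) n (g i.castSucc) z ^ 2) = _ := fun i =>
    ofReal_setIntegral_eq (integrableOn_weight_sq (memLp_coef hB (H.grad_memLp _))) (n2 _ _)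
  simp only [e4] at key'
  exact key'

/-- The weighted square of the `L²` norm in the prism. -/
def weightedSq (B a b l : ℝ) (f : E (m + 1) → ℝ) : ℝ≥0∞ :=
  ∫⁻ x in prism m B a b, ENNReal.ofReal (carlemanWeight l (x (Fin.last m)) * f x ^ 2)

/-- **The Carleman estimate** for functions of class `H²` that vanish on the boundary of the prism
outside the top face. -/
theorem IsAdmissible.carleman (hB : 0 < B) (ha : 0 < a) (hab : a < b)
    (H : IsAdmissible B a b u g h) {l : ℝ} (hl : 1 ≤ l) :
    ENNReal.ofReal l * (ENNReal.ofReal ((2 * B) ^ m) *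
      (weightedSq B a b l u + ∑ i, weightedSq B a b l (g i))) ≤
    ENNReal.ofReal (carlemanConst a b) * (ENNReal.ofReal ((2 * B) ^ m) *
      weightedSq B a b l (fun x => ∑ i, h i x)) +
    ENNReal.ofReal (carlemanDataConst a b l) * topData B a b u := by
  have hw := (contDiff_carlemanWeight l).continuous.measurable
  have hw0 : ∀ z, 0 ≤ carlemanWeight l z := fun z => (carlemanWeight_pos l z).le
  have huL := memLp_of_continuousOn_closure H.cont
  have hFL : MemLp (fun x => ∑ i, h i x) 2 (volume.restrict (prism m B a b)) :=
    memLp_finsetSum _ fun i _ => H.second_memLp i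
  have hP : ∀ (σ : Fin m → Bool) {f : E (m + 1) → ℝ}, MemLp f 2 (volume.restrict (prism m B a b)) →
      ENNReal.ofReal ((2 * B) ^ m) * weightedSq B a b l f =
      ∑' n, ∫⁻ z in Ioo a b, ENNReal.ofReal (carlemanWeight l z * coef B σ n f z ^ 2) :=
    fun σ f hf => (tsum_lintegral_coef_sq hB hf hw hw0).symm
  -- Each component is expanded in its own complete system: sines for u, ∂_z u and Δu, and a cosine
  -- in coordinate i for ∂ᵢu.
  rw [mul_add, Finset.mul_sum, Fin.sum_univ_castSucc, hP noCos huL, hP noCos hFL,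
    hP noCos (H.grad_memLp _)]
  simp only [fun i : Fin m => hP (oneCos i) (H.grad_memLp i.castSucc)]
  rw [← Summable.tsum_finsetSum (fun i _ => ENNReal.summable), ← ENNReal.tsum_add,
    ← ENNReal.tsum_add, ← ENNReal.tsum_mul_left, ← ENNReal.tsum_mul_left, topData,
    ← ENNReal.tsum_mul_left, ← ENNReal.tsum_add]
  refine ENNReal.tsum_le_tsum fun n => ?_
  refine le_trans (le_of_eq ?_) (H.carleman_mode hB ha hab hl n)
  ring

/-! ### The Cauchy data -/

theorem tsum_coef_top (hB : 0 < B) (hab : a < b) (hu : ContinuousOn u (closure (prism m B a b))) :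
    ∑' n : Fin m → ℤ, ENNReal.ofReal (coef B noCos n u b ^ 2) =
      ENNReal.ofReal ((2 * B) ^ m) * l2NormSq (cube m B) (fun y => u (topPoint b y)) :=
  parseval_cube hB noCos (memLp_slice_of_continuousOn hB hab hu (right_mem_Icc.2 hab.le))

theorem l2NormSq_le_h1NormSq {k : ℕ} (U : Set (E k)) (f : E k → ℝ) : l2NormSq U f ≤ h1NormSq U f :=
  le_iInf fun _ => le_iInf fun _ => le_self_add

/-- Only the L² part of the Dirichlet norm is used, because the boundary form of the Carleman
estimate does not see the tangential frequency. -/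
theorem tsum_coef_top_le (hB : 0 < B) (hab : a < b) (hu : ContinuousOn u (closure (prism m B a b))) :
    ∑' n : Fin m → ℤ, ENNReal.ofReal (coef B noCos n u b ^ 2) ≤
      ENNReal.ofReal ((2 * B) ^ m) * dirichletNormSq B b u := by
  rw [tsum_coef_top hB hab hu]
  gcongr
  exact l2NormSq_le_h1NormSq _ _

/-- The trace formula for the Fourier coefficients. -/
theorem trace_coef {v w : E (m + 1) → ℝ} {γ : E m → ℝ}
    (hv : MemLp v 2 (volume.restrict (prism m B a b)))
    (hw : MemLp w 2 (volume.restrict (prism m B a b)))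
    (hγ : MemLp γ 2 (volume.restrict (cube m B)))
    (ht : ∀ φ : E (m + 1) → ℝ, ContDiff ℝ ∞ φ → HasCompactSupport φ →
      tsupport φ ⊆ {x | (∀ i : Fin m, x i.castSucc ∈ Ioo (-B) B) ∧ a < x (Fin.last m)} →
      (∫ x in prism m B a b, v x * fderiv ℝ φ x (EuclideanSpace.single (Fin.last m) 1)) +
          ∫ x in prism m B a b, w x * φ x = ∫ y in cube m B, γ y * φ (topPoint b y))
    {η : ℝ → ℝ} (hη : ContDiff ℝ ∞ η) (hηc : HasCompactSupport η) (hηs : tsupport η ⊆ Ioi a)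
    (σ : Fin m → Bool) (n : Fin m → ℤ) :
    (∫ z in Ioo a b, coef B σ n v z * deriv η z) + ∫ z in Ioo a b, coef B σ n w z * η z =
      (∫ y in cube m B, γ y * trigProd B σ n y) * η b := by
  have hvi := MemLp.integrableOn_prism hv
  have hwi := MemLp.integrableOn_prism hw
  have hγi : IntegrableOn γ (cube m B) := hγ.integrable (by norm_num)
  set θ : Fin m → ℝ → ℝ := fun j => trig B (σ j) (n j) with hθ
  have hθs : ∀ j, ContDiff ℝ ∞ (θ j) := fun j => contDiff_trig B (σ j) (n j)
  -- Green's formula admits only test functions supported away from the lateral faces. It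
  -- differentiates only vertically, so tangential cutoffs can be removed by dominated convergence
  -- with no extra term.
  set f : ℕ → Fin m → ℝ → ℝ := cutoffMul (fun _ => -B) (fun _ => B) θ with hf
  have hfs : ∀ N j, ContDiff ℝ ∞ (f N j) := fun N j => contDiff_cutoffMul hθs N j
  have hfb : ∀ N j t, |f N j t| ≤ 1 := by
    intro N j t
    simp only [hf, cutoffMul, abs_mul]
    exact mul_le_one₀ abs_cutoff_le_one (abs_nonneg _) (abs_trig_le_one _ _ _ _)
  have hfl : ∀ j, ∀ t ∈ Ioo (-B) B, Tendsto (fun N => f N j t) atTop (𝓝 (θ j t)) := by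
    intro j t ht'
    simpa [hf, cutoffMul] using (tendsto_cutoff ht').mul_const (θ j t)
  have hdη : Continuous (deriv η) := hη.continuous_deriv (by simp)
  -- the limit of the volume integrals
  have hlim : ∀ {r : E (m + 1) → ℝ}, IntegrableOn r (prism m B a b) → ∀ {ζ : ℝ → ℝ}, Continuous ζ →
      Tendsto (fun N => ∫ x in prism m B a b, r x *
        prodFn (Fin.snoc (α := fun _ => ℝ → ℝ) (f N) ζ) x) atTop
        (𝓝 (∫ z in Ioo a b, coef B σ n r z * ζ z)) := by
    intro r hr ζ hζ
    obtain ⟨K, hK⟩ := isCompact_Icc.exists_bound_of_continuousOn (s := Icc a b) hζ.continuousOn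
    have hr' := hr
    rw [prism_eq_box] at hr'
    have := tendsto_integral_mul_prodFn hr' (f := fun N => Fin.snoc (α := fun _ => ℝ → ℝ) (f N) ζ)
      (g := Fin.snoc (α := fun _ => ℝ → ℝ) θ ζ) (K := 1 + |K|) ?_ ?_ ?_
    · rw [← prism_eq_box, integral_mul_prodFn_snoc hr (fun j => (hθs j).continuous) hζ] at this
      exact this
    · intro N j
      refine Fin.lastCases ?_ (fun i => ?_) j
      · simpa using hζ
      · simpa using (hfs N i).continuous
    · intro N j
      refine Fin.lastCases ?_ (fun i => ?_) j
      · intro t ht'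
        simp only [lowCorner, highCorner, Fin.snoc_last] at ht' ⊢
        have := hK t (Ioo_subset_Icc_self ht')
        rw [Real.norm_eq_abs] at this
        linarith [le_abs_self K]
      · intro t _
        simp only [Fin.snoc_castSucc]
        linarith [hfb N i t, abs_nonneg K]
    · intro j
      refine Fin.lastCases ?_ (fun i => ?_) j
      · intro t _
        simp
      · intro t ht'
        simp only [lowCorner, highCorner, Fin.snoc_castSucc] at ht' ⊢
        exact hfl i t ht'
  have L1 := hlim hvi hdη
  have L2 := hlim hwi hη.continuous
  have L3 : Tendsto (fun N => ∫ y in cube m B, γ y * (prodFn (f N) y * η b)) atTop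
      (𝓝 ((∫ y in cube m B, γ y * trigProd B σ n y) * η b)) := by
    have := tendsto_integral_mul_prodFn (l := fun _ => -B) (r := fun _ => B) (u := γ) hγi
      (f := f) (g := θ) (K := 1) (fun N j => (hfs N j).continuous)
      (fun N j t _ => hfb N j t) hfl
    have h2 := this.mul_const (η b)
    simp only [← integral_mul_const, mul_assoc] at h2 ⊢
    exact h2
  have hid : ∀ N, (∫ x in prism m B a b, v x *
        prodFn (Fin.snoc (α := fun _ => ℝ → ℝ) (f N) (deriv η)) x) +
      (∫ x in prism m B a b, w x * prodFn (Fin.snoc (α := fun _ => ℝ → ℝ) (f N) η) x) =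
      ∫ y in cube m B, γ y * (prodFn (f N) y * η b) := by
    intro N
    have hs : ∀ j, ContDiff ℝ ∞ (Fin.snoc (α := fun _ => ℝ → ℝ) (f N) η j) := by
      intro j
      refine Fin.lastCases ?_ (fun i => ?_) j
      · simpa using hη
      · simpa using hfs N i
    have hcs : ∀ j, HasCompactSupport (Fin.snoc (α := fun _ => ℝ → ℝ) (f N) η j) := by
      intro j
      refine Fin.lastCases ?_ (fun i => ?_) j
      · simpa using hηc
      · have : HasCompactSupport (f N i) := (hasCompactSupport_cutoff (width_pos N)).mul_right
        simpa using this
    have h1 := ht _ (contDiff_prodFn hs) (hasCompactSupport_prodFn hcs) ?_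
    · simp only [fderiv_prodFn hs, prodFn_snoc, Fin.snoc_last, Fin.update_snoc_last] at h1
      exact h1
    · refine (tsupport_prodFn_subset _).trans fun x hx => ⟨fun i => ?_, ?_⟩
      · have := hx i.castSucc
        simp only [Fin.snoc_castSucc] at this
        exact tsupport_cutoff_subset_Ioo (width_pos N) (tsupport_mul_subset_left this)
      · have := hx (Fin.last m)
        simp only [Fin.snoc_last] at this
        exact hηs this
  have L4 := L1.add L2
  simp only [hid] at L4
  exact tendsto_nhds_unique L4 L3

/-- The coefficients of the Neumann datum are the vertical derivatives of the coefficients. -/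
theorem topDeriv_eq (hB : 0 < B) (hab : a < b) (hu : ContinuousOn u (closure (prism m B a b)))
    {γ : E m → ℝ} (hγ : IsTopNormalDeriv B a b u γ) (n : Fin m → ℤ) :
    topDeriv B a b n u = ∫ y in cube m B, γ y * trigProd B noCos n y := by
  obtain ⟨v, huv, w, hvw, hv, hw, hγ2, ht⟩ := hγ
  have huL := memLp_of_continuousOn_closure hu
  obtain ⟨C, hC1, hC2, hC3⟩ := exists_double_primitive hab (continuousOn_coef hB hab hu noCos n)
    (integrableOn_coef hB hv) (integrableOn_coef hB hw) (coef_vertical huv huL hv noCos n)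
    (coef_vertical hvw hv hw noCos n)
  rw [topDeriv, hC3.derivWithin (uniqueDiffOn_Icc hab b (right_mem_Icc.2 hab.le))]
  -- A vertical test function equal to 1 at b and supported above a. With it, Green's formula and
  -- integration by parts for the primitive differ only in their boundary values at b.
  let f : ContDiffBump b := ⟨(b - a) / 4, (b - a) / 2, by linarith, by linarith⟩
  have hηs : tsupport f ⊆ Ioi a := by
    rw [f.tsupport_eq, Real.closedBall_eq_Icc]
    intro z hz
    have := hz.1
    simp only [f] at this
    rw [mem_Ioi]; linarith
  have hfa : f a = 0 := image_eq_zero_of_notMem_tsupport fun h => lt_irrefl a (hηs h)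
  have hfb : f b = 1 := f.one_of_mem_closedBall (Metric.mem_closedBall_self f.rIn_pos.le)
  have h1 := trace_coef hv hw hγ2 ht f.contDiff f.hasCompactSupport hηs noCos n
  have h2 := integral_primitive_mul_deriv hab.le C (integrableOn_coef (σ := noCos) (n := n) hB hw)
    (η := f) f.contDiff
  have h3 : ∫ z in Ioo a b, coef B noCos n v z * deriv f z =
      ∫ z in Ioo a b, (C + ∫ t in a..z, coef B noCos n w t) * deriv f z := by
    apply integral_congr_ae
    filter_upwards [hC1] with z hz
    rw [hz]
  rw [h3, h2, hfa, hfb] at h1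
  linarith

/-- Every competitor in the infimum defining the Neumann norm has these numbers as its Fourier
coefficients. If there is no competitor, the right-hand side is infinite. -/
theorem tsum_topDeriv_le (hB : 0 < B) (hab : a < b) (hu : ContinuousOn u (closure (prism m B a b))) :
    ∑' n : Fin m → ℤ, ENNReal.ofReal (topDeriv B a b n u ^ 2) ≤
      ENNReal.ofReal ((2 * B) ^ m) * neumannNormSq B a b u := by
  have hne : ENNReal.ofReal ((2 * B) ^ m) ≠ 0 := by
    rw [ne_eq, ENNReal.ofReal_eq_zero, not_le]; positivity
  rw [neumannNormSq]
  simp only [ENNReal.mul_iInf_of_ne hne ENNReal.ofReal_ne_top]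
  refine le_iInf fun γ => le_iInf fun hγ => ?_
  simp only [topDeriv_eq hB hab hu hγ]
  obtain ⟨v, huv, w, hvw, hv, hw, hγ2, ht⟩ := hγ
  exact (parseval_cube hB noCos hγ2).le

end Prism

/-! ### Algebra of weak derivatives -/

section Weak

variable {k : ℕ} {U : Set (E k)} {i : Fin k} {u u' g g' : E k → ℝ}

theorem integrableOn_mul_of_tsupport_subset (hu : LocallyIntegrableOn u U) {ψ : E k → ℝ}
    (hψ : Continuous ψ) (hc : HasCompactSupport ψ) (hs : tsupport ψ ⊆ U) :
    Integrable (fun x => u x * ψ x) := by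
  have h1 : IntegrableOn (fun x => u x * ψ x) (tsupport ψ) := by
    obtain ⟨C, hC⟩ := hc.isCompact.exists_bound_of_continuousOn hψ.continuousOn
    have h2 : IntegrableOn u (tsupport ψ) := hu.integrableOn_compact_subset hs hc.isCompact
    refine Integrable.mul_bdd (c := C) h2 hψ.aestronglyMeasurable ?_
    filter_upwards [ae_restrict_mem hc.isCompact.measurableSet] with x hx using hC x hx
  rw [← integrableOn_iff_integrable_of_support_subset (s := tsupport ψ)]
  · exact h1
  · intro x hx
    apply subset_tsupport
    intro h0
    exact hx (by simp [h0])

theorem contDiff_partial {φ : E k → ℝ} (hφ : ContDiff ℝ ∞ φ) (e : E k) :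
    Continuous fun x => fderiv ℝ φ x e :=
  (hφ.continuous_fderiv (by simp)).clm_apply continuous_const

theorem hasCompactSupport_partial {φ : E k → ℝ} (hc : HasCompactSupport φ) (e : E k) :
    HasCompactSupport fun x => fderiv ℝ φ x e := hc.fderiv_apply (𝕜 := ℝ) e

theorem tsupport_partial_subset {φ : E k → ℝ} (e : E k) :
    tsupport (fun x => fderiv ℝ φ x e) ⊆ tsupport φ := tsupport_fderiv_apply_subset ℝ e

theorem HasWeakPartial.sub (h : HasWeakPartial U i u g) (h' : HasWeakPartial U i u' g') :
    HasWeakPartial U i (fun x => u x - u' x) (fun x => g x - g' x) := by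
  refine ⟨h.1.sub h'.1, h.2.1.sub h'.2.1, fun φ hφ hc hs => ?_⟩
  have a1 := (integrableOn_mul_of_tsupport_subset h.1 (contDiff_partial hφ (EuclideanSpace.single i 1))
    (hasCompactSupport_partial hc _) ((tsupport_partial_subset _).trans hs)).integrableOn (s := U)
  have a2 := (integrableOn_mul_of_tsupport_subset h'.1 (contDiff_partial hφ (EuclideanSpace.single i 1))
    (hasCompactSupport_partial hc _) ((tsupport_partial_subset _).trans hs)).integrableOn (s := U)
  have b1 := (integrableOn_mul_of_tsupport_subset h.2.1 hφ.continuous hc hs).integrableOn (s := U)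
  have b2 := (integrableOn_mul_of_tsupport_subset h'.2.1 hφ.continuous hc hs).integrableOn (s := U)
  simp only [sub_mul]
  rw [integral_sub a1 a2, integral_sub b1 b2, h.2.2 φ hφ hc hs, h'.2.2 φ hφ hc hs]
  ring

theorem HasWeakGrad.sub {v v' : Fin k → E k → ℝ} (h : HasWeakGrad U u v) (h' : HasWeakGrad U u' v') :
    HasWeakGrad U (fun x => u x - u' x) (fun i x => v i x - v' i x) := fun i => (h i).sub (h' i)

/-- Weak derivatives of almost everywhere equal functions are almost everywhere equal. -/
theorem HasWeakPartial.ae_unique (hU : IsOpen U) (h : HasWeakPartial U i u g)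
    (h' : HasWeakPartial U i u' g') (hu : ∀ᵐ x ∂(volume.restrict U), u x = u' x) :
    ∀ᵐ x ∂(volume.restrict U), g x = g' x := by
  have key := IsOpen.ae_eq_zero_of_integral_contDiff_smul_eq_zero (μ := volume) hU
    (f := fun x => g x - g' x) (h.2.1.sub h'.2.1) ?_
  · rw [ae_restrict_iff' hU.measurableSet]
    filter_upwards [key] with x hx hx'
    linarith [hx hx']
  · intro φ hφ hc hs
    rw [← setIntegral_eq_integral_of_forall_compl_eq_zero (s := U)]
    · have b1 := (integrableOn_mul_of_tsupport_subset h.2.1 hφ.continuous hc hs).integrableOn (s := U)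
      have b2 := (integrableOn_mul_of_tsupport_subset h'.2.1 hφ.continuous hc hs).integrableOn (s := U)
      have e : ∀ x, φ x • (g x - g' x) = g x * φ x - g' x * φ x := fun x => by
        rw [smul_eq_mul]; ring
      simp only [e]
      rw [integral_sub b1 b2]
      have e1 := h.2.2 φ hφ hc hs
      have e2 := h'.2.2 φ hφ hc hs
      have e3 : ∫ x in U, u x * fderiv ℝ φ x (EuclideanSpace.single i 1) =
          ∫ x in U, u' x * fderiv ℝ φ x (EuclideanSpace.single i 1) := by
        apply integral_congr_ae
        filter_upwards [hu] with x hx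
        rw [hx]
      linarith
    · intro x hx
      rw [image_eq_zero_of_notMem_tsupport (fun hh => hx (hs hh)), zero_smul]

theorem HasWeakGrad.ae_unique (hU : IsOpen U) {v v' : Fin k → E k → ℝ} (h : HasWeakGrad U u v)
    (h' : HasWeakGrad U u v') (i : Fin k) : ∀ᵐ x ∂(volume.restrict U), v i x = v' i x :=
  (h i).ae_unique hU (h' i) (Eventually.of_forall fun _ => rfl)

theorem HasWeakPartial.aestronglyMeasurable (h : HasWeakPartial U i u g) :
    AEStronglyMeasurable g (volume.restrict U) := h.2.1.aestronglyMeasurable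

theorem l2NormSq_congr {f f' : E k → ℝ} (h : ∀ᵐ x ∂(volume.restrict U), f x = f' x) :
    l2NormSq U f = l2NormSq U f' := by
  unfold l2NormSq
  apply lintegral_congr_ae
  filter_upwards [h] with x hx
  rw [hx]

theorem memLp_of_l2NormSq_lt_top {f : E k → ℝ} (hf : AEStronglyMeasurable f (volume.restrict U))
    (h : l2NormSq U f < ⊤) : MemLp f 2 (volume.restrict U) := by
  rw [memLp_two_iff_integrable_sq hf]
  refine ⟨hf.pow 2, ?_⟩
  unfold HasFiniteIntegral
  unfold l2NormSq at h
  simpa only [enorm_pow] using h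

theorem exists_of_h2NormSq_lt_top (h : h2NormSq U u < ⊤) :
    ∃ (v : Fin k → E k → ℝ) (w : Fin k → Fin k → E k → ℝ), HasWeakGrad U u v ∧
      (∀ i, HasWeakGrad U (v i) (w i)) ∧ (∀ i, MemLp (v i) 2 (volume.restrict U)) ∧
      ∀ i j, MemLp (w i j) 2 (volume.restrict U) := by
  unfold h2NormSq at h
  simp only [iInf_lt_iff] at h
  obtain ⟨v, w, hv, hw, hlt⟩ := h
  refine ⟨v, w, hv, hw, fun i => ?_, fun i j => ?_⟩
  · refine memLp_of_l2NormSq_lt_top (hv i).aestronglyMeasurable (lt_of_le_of_lt ?_ hlt)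
    have := Finset.single_le_sum (f := fun i => l2NormSq U (v i)) (fun _ _ => zero_le)
      (Finset.mem_univ i)
    exact this.trans (le_add_self.trans le_self_add)
  · refine memLp_of_l2NormSq_lt_top (hw i j).aestronglyMeasurable (lt_of_le_of_lt ?_ hlt)
    have h1 := Finset.single_le_sum (f := fun j => l2NormSq U (w i j)) (fun _ _ => zero_le)
      (Finset.mem_univ j)
    have h2 := Finset.single_le_sum (f := fun i => ∑ j, l2NormSq U (w i j)) (fun _ _ => zero_le)
      (Finset.mem_univ i)
    exact (h1.trans h2).trans le_add_self

/-- The derivatives of a function of class `H²` are square integrable, whatever their version. -/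
theorem memLp_of_h2NormSq_lt_top (hU : IsOpen U) (h : h2NormSq U u < ⊤) {v w : Fin k → E k → ℝ}
    (hv : HasWeakGrad U u v) (hw : ∀ i, HasWeakPartial U i (v i) (w i)) :
    (∀ i, MemLp (v i) 2 (volume.restrict U)) ∧ ∀ i, MemLp (w i) 2 (volume.restrict U) := by
  obtain ⟨v', w', hv', hw', h1, h2⟩ := exists_of_h2NormSq_lt_top h
  have e1 := fun i => hv'.ae_unique hU hv i
  exact ⟨fun i => (h1 i).ae_eq (e1 i), fun i =>
    (h2 i i).ae_eq ((hw' i i).ae_unique hU (hw i) (e1 i))⟩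

/-- The `L²` norm of any version of the weak gradient is controlled by the `H²` norm. -/
theorem sum_l2NormSq_le_h2NormSq (hU : IsOpen U) {v : Fin k → E k → ℝ} (hv : HasWeakGrad U u v) :
    ∑ i, l2NormSq U (v i) ≤ h2NormSq U u := by
  unfold h2NormSq
  refine le_iInf fun v' => le_iInf fun w' => le_iInf fun hv' => le_iInf fun hw' => ?_
  have : ∑ i, l2NormSq U (v i) = ∑ i, l2NormSq U (v' i) :=
    Finset.sum_congr rfl fun i _ => l2NormSq_congr (hv.ae_unique hU hv' i)
  rw [this]
  exact le_add_self.trans le_self_add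

theorem l2NormSq_le_two_mul (f f' : E k → ℝ) (hf : AEStronglyMeasurable f' (volume.restrict U)) :
    l2NormSq U f ≤ 2 * l2NormSq U (fun x => f x - f' x) + 2 * l2NormSq U f' := by
  unfold l2NormSq
  rw [← lintegral_const_mul' _ _ (by simp), ← lintegral_const_mul' _ _ (by simp),
    ← lintegral_add_right' _ ((hf.aemeasurable.enorm.pow_const 2).const_mul 2)]
  refine lintegral_mono fun x => ?_
  simp only [enorm_sq_eq_ofReal]
  have h2 : (2 : ℝ≥0∞) = ENNReal.ofReal 2 := by simp
  rw [h2, ← ENNReal.ofReal_mul (by norm_num), ← ENNReal.ofReal_mul (by norm_num),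
    ← ENNReal.ofReal_add (by positivity) (by positivity)]
  apply ENNReal.ofReal_le_ofReal
  nlinarith [sq_nonneg (f x - f' x - f' x)]

/-- The `L²` norms of the weak gradients along a path in `H²` are bounded. -/
theorem IsH2Path.exists_bound (hU : IsOpen U) {d : ℝ} {p : E k → ℝ → ℝ} (hp : IsH2Path U d p) :
    ∃ C : ℝ≥0∞, C ≠ ⊤ ∧ ∀ α ∈ Icc (-d) d, ∀ v : Fin k → E k → ℝ,
      HasWeakGrad U (fun x => p x α) v → ∑ i, l2NormSq U (v i) ≤ C := by
  -- Local boundedness on a compact interval is enough: near α₀ the H² distance to the function at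
  -- α₀ is below 1, and the bound follows from |f|² ≤ 2|f - f₀|² + 2|f₀|².
  refine isCompact_Icc.induction_on (s := Icc (-d) d) (p := fun S => ∃ C : ℝ≥0∞, C ≠ ⊤ ∧
    ∀ α ∈ S, ∀ v : Fin k → E k → ℝ,
      HasWeakGrad U (fun x => p x α) v → ∑ i, l2NormSq U (v i) ≤ C) ?_ ?_ ?_ ?_
  · exact ⟨0, by simp, by simp⟩
  · rintro s t hst ⟨C, hC, h⟩
    exact ⟨C, hC, fun α hα => h α (hst hα)⟩
  · rintro s t ⟨C, hC, h⟩ ⟨C', hC', h'⟩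
    refine ⟨max C C', by simp [hC, hC'], fun α hα v hv => ?_⟩
    rcases hα with hα | hα
    · exact (h α hα v hv).trans (le_max_left _ _)
    · exact (h' α hα v hv).trans (le_max_right _ _)
  · intro α₀ hα₀
    obtain ⟨v₀, w₀, hv₀, hw₀, h1, h2⟩ := exists_of_h2NormSq_lt_top (hp.1 α₀ hα₀)
    have hlim := hp.2 α₀ hα₀
    have hev := hlim.eventually_lt_const (show (0 : ℝ≥0∞) < 1 by norm_num)
    refine ⟨_, hev, 2 * 1 + 2 * ∑ i, l2NormSq U (v₀ i), ?_, fun α hα v hv => ?_⟩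
    · have : ∑ i, l2NormSq U (v₀ i) < ⊤ :=
        (sum_l2NormSq_le_h2NormSq hU hv₀).trans_lt (hp.1 α₀ hα₀)
      exact ENNReal.add_ne_top.2 ⟨by simp, ENNReal.mul_ne_top (by simp) this.ne⟩
    · have hd := sum_l2NormSq_le_h2NormSq hU (hv.sub hv₀)
      calc ∑ i, l2NormSq U (v i) ≤ ∑ i, (2 * l2NormSq U (fun x => v i x - v₀ i x) +
            2 * l2NormSq U (v₀ i)) := Finset.sum_le_sum fun i _ =>
              l2NormSq_le_two_mul _ _ (hv₀ i).aestronglyMeasurable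
        _ = 2 * ∑ i, l2NormSq U (fun x => v i x - v₀ i x) + 2 * ∑ i, l2NormSq U (v₀ i) := by
            rw [Finset.sum_add_distrib, Finset.mul_sum, Finset.mul_sum]
        _ ≤ _ := by
            gcongr
            exact hd.trans (le_of_lt hα)

end Weak

/-! ### The coefficients of the system -/

section Coefficients

variable {m : ℕ} {B a b d : ℝ}

/-- Compactness of the closed prism and of the line of sources. The distance ρ depends on Ω and d
only, so it may enter the final constant; it controls ∂_α ν. -/
theorem exists_dist_source_pos
    (hsource : Disjoint (sourceLine m d) (closure (prism m B a b))) :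
    ∃ ρ, 0 < ρ ∧ ∀ x ∈ closure (prism m B a b), ∀ α ∈ Icc (-d) d, ρ ≤ ‖x - source m α‖ := by
  have hc : Continuous fun p : E (m + 1) × ℝ => ‖p.1 - source m p.2‖ := by
    have : Continuous fun α : ℝ => source m α := by
      unfold source
      refine (PiLp.continuous_toLp 2 _).comp ?_
      exact (continuous_single (A := fun _ => ℝ) 0)
    fun_prop
  have hK : IsCompact (closure (prism m B a b) ×ˢ Icc (-d) d) :=
    isCompact_closure_prism.prod isCompact_Icc
  have hpos : ∀ p ∈ closure (prism m B a b) ×ˢ Icc (-d) d, 0 < ‖p.1 - source m p.2‖ := by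
    rintro ⟨x, α⟩ ⟨hx, hα⟩
    rw [norm_pos_iff, sub_ne_zero]
    rintro h
    exact hsource.ne_of_mem (mem_image_of_mem _ hα) hx h.symm
  obtain ⟨ρ, hρ, h⟩ := hK.exists_forall_le' hc.continuousOn hpos
  exact ⟨ρ, hρ, fun x hx α hα => h (x, α) ⟨hx, hα⟩⟩

theorem abs_coord_le_norm {k : ℕ} (x : E k) (i : Fin k) : |x i| ≤ ‖x‖ := PiLp.norm_apply_le x i

theorem norm_nu_le (x : E (m + 1)) (α : ℝ) : ‖nu x α‖ ≤ 1 := by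
  unfold nu
  rw [norm_smul, norm_inv, norm_norm]
  exact inv_mul_le_one

theorem continuous_source : Continuous fun α : ℝ => source m α := by
  unfold source
  exact (PiLp.continuous_toLp 2 _).comp (continuous_single (A := fun _ => ℝ) 0)

/-- The source moves with unit speed, and normalizing a vector based at w changes it by at most
2/‖w‖ times the displacement. The derivative is thus bounded by a local Lipschitz bound, without
being computed. -/
theorem norm_nuAlpha_le {ρ : ℝ} (hρ : 0 < ρ) {x : E (m + 1)} {α : ℝ} (h : ρ ≤ ‖x - source m α‖) :
    ‖nuAlpha x α‖ ≤ 2 / ρ := by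
  have hlip : ∀ t, ‖source m t - source m α‖ = |t - α| := by
    intro t
    unfold source
    have : EuclideanSpace.single (0 : Fin (m + 1)) t - EuclideanSpace.single 0 α =
        EuclideanSpace.single (0 : Fin (m + 1)) (t - α) := by
      ext j; simp; split_ifs <;> simp
    rw [this, PiLp.norm_single, Real.norm_eq_abs]
  unfold nuAlpha
  refine norm_deriv_le_of_lip' (by positivity) ?_
  have hne : ∀ᶠ t in 𝓝 α, x - source m t ≠ 0 := by
    have hc : Continuous fun t => x - source m t := continuous_const.sub continuous_source
    refine hc.continuousAt.eventually_ne ?_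
    rw [← norm_pos_iff]; linarith
  filter_upwards [hne] with t ht
  unfold nu
  set v := x - source m t with hv
  set w := x - source m α with hw
  have hv0 : 0 < ‖v‖ := norm_pos_iff.2 ht
  have hw0 : 0 < ‖w‖ := hρ.trans_le h
  have hvw : ‖v - w‖ = ‖t - α‖ := by
    rw [hv, hw, sub_sub_sub_cancel_left, ← norm_neg, neg_sub, hlip, Real.norm_eq_abs]
  clear_value v w
  -- Factoring out only ‖w‖⁻¹ leaves two terms of size at most ‖v - w‖, and no lower bound on ‖v‖ is
  -- required.
  have e : ‖v‖⁻¹ • v - ‖w‖⁻¹ • w = ‖w‖⁻¹ • ((v - w) + (‖w‖ - ‖v‖) • (‖v‖⁻¹ • v)) := by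
    have e1 : ‖v‖⁻¹ • v = ‖w‖⁻¹ • ‖w‖ • ‖v‖⁻¹ • v := by
      rw [smul_smul ‖w‖⁻¹, inv_mul_cancel₀ hw0.ne', one_smul]
    have e2 : v = ‖v‖ • ‖v‖⁻¹ • v := by
      rw [smul_smul, mul_inv_cancel₀ hv0.ne', one_smul]
    have e3 : v - w + (‖w‖ - ‖v‖) • ‖v‖⁻¹ • v = ‖w‖ • ‖v‖⁻¹ • v - w := by
      rw [sub_smul, ← e2]; abel
    rw [e3, smul_sub ‖w‖⁻¹, ← e1]
  rw [e, norm_smul, norm_inv, norm_norm]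
  have h1 : ‖(v - w) + (‖w‖ - ‖v‖) • (‖v‖⁻¹ • v)‖ ≤ 2 * ‖t - α‖ := by
    refine (norm_add_le _ _).trans ?_
    rw [norm_smul, norm_smul, norm_inv, norm_norm, inv_mul_cancel₀ hv0.ne', mul_one]
    have := abs_norm_sub_norm_le w v
    rw [Real.norm_eq_abs, ← hvw]
    rw [norm_sub_rev w v] at this
    linarith
  calc ‖w‖⁻¹ * _ ≤ ρ⁻¹ * (2 * ‖t - α‖) := by
        apply mul_le_mul _ h1 (norm_nonneg _) (by positivity)
        exact inv_anti₀ hρ h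
    _ = 2 / ρ * ‖t - α‖ := by ring

/-! ### Regularity of the kernel and its derivative in the source variable. -/

theorem bigPrism_eq_box : bigPrism m B b d =
    box (lowCorner m (max B d) 0) (highCorner m (max B d) b) := by
  ext x
  simp only [bigPrism, box, mem_ofPred_eq, Fin.forall_fin_succ', lowCorner, highCorner,
    Fin.snoc_castSucc, Fin.snoc_last, abs_lt, mem_Ioo]

theorem prism_subset_bigPrism (ha : 0 < a) : prism m B a b ⊆ bigPrism m B b d := by
  rintro x ⟨h1, h2⟩
  refine ⟨fun i => ?_, ⟨ha.trans h2.1, h2.2⟩⟩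
  exact (abs_lt.2 (h1 i)).trans_le (le_max_left _ _)

/-- The closed box is convex with nonempty interior. Unique differentiability makes the derivative
of the C¹ kernel within the closed domain continuous up to the boundary. -/
theorem uniqueDiffOn_closure_bigPrism (hB : 0 < B) (hb : 0 < b) :
    UniqueDiffOn ℝ (closure (bigPrism m B b d)) := by
  have hM : 0 < max B d := lt_max_of_lt_left hB
  rw [bigPrism_eq_box]
  refine uniqueDiffOn_convex ?_ ?_
  · rw [closure_box (lowCorner_lt_highCorner hM hb)]
    intro x hx y hy s t hs ht hst j
    have := convex_Icc (𝕜 := ℝ) (lowCorner m (max B d) 0 j) (highCorner m (max B d) b j)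
      (hx j) (hy j) hs ht hst
    simpa using this
  · refine Set.Nonempty.mono (interior_mono subset_closure) ?_
    rw [isOpen_box.interior_eq]
    refine ⟨WithLp.toLp 2 fun j => (lowCorner m (max B d) 0 j + highCorner m (max B d) b j) / 2,
      fun j => ?_⟩
    have := lowCorner_lt_highCorner (m := m) hM hb j
    constructor <;> simp only <;> linarith

variable {G : E (m + 1) → ℝ → ℝ → ℝ}

theorem KernelRegular.continuousOn_kernel (hG : KernelRegular B b d G) {x : E (m + 1)}
    (hx : x ∈ closure (bigPrism m B b d)) {α : ℝ} (hα : α ∈ Icc (-d) d) :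
    ContinuousOn (fun β => G x α β) (Icc (-d) d) := by
  have h := hG.continuousOn
  have hc : Continuous fun β : ℝ => ((x, α, β) : E (m + 1) × ℝ × ℝ) := by fun_prop
  exact h.comp hc.continuousOn fun β hβ => ⟨hx, hα, hβ⟩

/-- Along the segment in the α direction the chain rule identifies the one-sided partial derivative
with the total derivative applied to (0,1,0), and the latter is continuous. -/
theorem KernelRegular.continuousOn_kernelAlpha (hG : KernelRegular B b d G) (hB : 0 < B) (hb : 0 < b)
    (hd : 0 < d) {x : E (m + 1)} (hx : x ∈ closure (bigPrism m B b d)) {α : ℝ}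
    (hα : α ∈ Icc (-d) d) : ContinuousOn (fun β => kernelAlpha d G x α β) (Icc (-d) d) := by
  set K : Set (E (m + 1) × ℝ × ℝ) := closure (bigPrism m B b d) ×ˢ Icc (-d) d ×ˢ Icc (-d) d with hK
  set f : E (m + 1) × ℝ × ℝ → ℝ := fun y => G y.1 y.2.1 y.2.2 with hf
  have hI : UniqueDiffOn ℝ (Icc (-d) d) := uniqueDiffOn_Icc (by linarith)
  have hU : UniqueDiffOn ℝ K := (uniqueDiffOn_closure_bigPrism hB hb).prod (hI.prod hI)
  have hcont : ContinuousOn (fderivWithin ℝ f K) K := ContDiffOn.continuousOn_fderivWithin hG hU le_rfl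
  have hc : Continuous fun β : ℝ => ((x, α, β) : E (m + 1) × ℝ × ℝ) := by fun_prop
  have h1 : ContinuousOn (fun β => fderivWithin ℝ f K (x, α, β) (0, 1, 0)) (Icc (-d) d) :=
    (hcont.comp hc.continuousOn fun β hβ => ⟨hx, hα, hβ⟩).clm_apply continuousOn_const
  refine h1.congr fun β hβ => ?_
  have hdiff : HasFDerivWithinAt f (fderivWithin ℝ f K (x, α, β)) K (x, α, β) :=
    (ContDiffOn.differentiableOn (hG : ContDiffOn ℝ 1 f K) one_ne_zero (x, α, β)
      (show (x, α, β) ∈ K from ⟨hx, hα, hβ⟩)).hasFDerivWithinAt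
  have hline : HasDerivWithinAt (fun t : ℝ => ((x, t, β) : E (m + 1) × ℝ × ℝ)) (0, 1, 0)
      (Icc (-d) d) α :=
    (hasDerivWithinAt_const _ _ _).prodMk ((hasDerivWithinAt_id _ _).prodMk
      (hasDerivWithinAt_const _ _ _))
  have hmaps : MapsTo (fun t : ℝ => ((x, t, β) : E (m + 1) × ℝ × ℝ)) (Icc (-d) d) K :=
    fun t ht => ⟨hx, ht, hβ⟩
  have := hdiff.comp_hasDerivWithinAt α hline hmaps
  exact this.derivWithin (hI α hα)

/-! ### The Lipschitz bound for the nonlinear terms -/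

theorem abs_exp_sub_exp_le {s t M : ℝ} (hs : s ≤ M) (ht : t ≤ M) :
    |Real.exp s - Real.exp t| ≤ Real.exp M * |s - t| := by
  wlog h : t ≤ s generalizing s t
  · rw [abs_sub_comm, abs_sub_comm s]
    exact this ht hs (le_of_not_ge h)
  rw [abs_of_nonneg (sub_nonneg.2 (Real.exp_le_exp.2 h)), abs_of_nonneg (sub_nonneg.2 h)]
  have h1 : 1 - Real.exp (t - s) ≤ s - t := by
    have := Real.add_one_le_exp (t - s); linarith
  have h2 : Real.exp s - Real.exp t = Real.exp s * (1 - Real.exp (t - s)) := by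
    rw [mul_sub, ← Real.exp_add]; ring_nf
  rw [h2]
  calc Real.exp s * (1 - Real.exp (t - s)) ≤ Real.exp s * (s - t) := by gcongr
    _ ≤ Real.exp M * (s - t) := by
        have : 0 ≤ s - t := sub_nonneg.2 h
        gcongr

/-- Lipschitz bound for `∫ k e^p`. -/
theorem abs_integral_kernel_sub_le (hd : 0 < d) {k p₁ p₂ : ℝ → ℝ} {K M : ℝ}
    (hk : ContinuousOn k (Icc (-d) d)) (hp₁ : ContinuousOn p₁ (Icc (-d) d))
    (hp₂ : ContinuousOn p₂ (Icc (-d) d)) (hK : ∀ β ∈ Icc (-d) d, |k β| ≤ K)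
    (h₁ : ∀ β ∈ Icc (-d) d, |p₁ β| ≤ M) (h₂ : ∀ β ∈ Icc (-d) d, |p₂ β| ≤ M) :
    |(∫ β in (-d)..d, k β * Real.exp (p₁ β)) - ∫ β in (-d)..d, k β * Real.exp (p₂ β)| ≤
      K * Real.exp M * ∫ β in (-d)..d, |p₁ β - p₂ β| := by
  have hle : -d ≤ d := by linarith
  have i1 : IntervalIntegrable (fun β => k β * Real.exp (p₁ β)) volume (-d) d :=
    ContinuousOn.intervalIntegrable (by rw [uIcc_of_le hle]; exact hk.mul hp₁.rexp)
  have i2 : IntervalIntegrable (fun β => k β * Real.exp (p₂ β)) volume (-d) d :=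
    ContinuousOn.intervalIntegrable (by rw [uIcc_of_le hle]; exact hk.mul hp₂.rexp)
  have i3 : IntervalIntegrable (fun β => K * Real.exp M * |p₁ β - p₂ β|) volume (-d) d :=
    ContinuousOn.intervalIntegrable (by
      rw [uIcc_of_le hle]; exact continuousOn_const.mul (hp₁.sub hp₂).abs)
  rw [← intervalIntegral.integral_sub i1 i2, ← intervalIntegral.integral_const_mul]
  refine (intervalIntegral.abs_integral_le_integral_abs hle).trans ?_
  refine intervalIntegral.integral_mono_on hle (i1.sub i2).abs i3 fun β hβ => ?_
  have hK' := hK β hβ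
  rw [← mul_sub, abs_mul, mul_assoc]
  exact mul_le_mul hK' (abs_exp_sub_exp_le ((le_abs_self _).trans (h₁ β hβ))
    ((le_abs_self _).trans (h₂ β hβ))) (abs_nonneg _) ((abs_nonneg _).trans hK')

theorem abs_integral_kernel_le (hd : 0 < d) {k p : ℝ → ℝ} {K M : ℝ}
    (hK : ∀ β ∈ Icc (-d) d, |k β| ≤ K) (h : ∀ β ∈ Icc (-d) d, |p β| ≤ M) :
    |∫ β in (-d)..d, k β * Real.exp (p β)| ≤ K * Real.exp M * (2 * d) := by
  have hle : -d ≤ d := by linarith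
  have := intervalIntegral.norm_integral_le_of_norm_le_const (a := -d) (b := d)
    (f := fun β => k β * Real.exp (p β)) (C := K * Real.exp M) ?_
  · rw [Real.norm_eq_abs] at this
    refine this.trans_eq ?_
    rw [abs_of_pos (by linarith)]; ring
  · intro β hβ
    rw [uIoc_of_le hle] at hβ
    have hβ' := Ioc_subset_Icc_self hβ
    rw [norm_mul, Real.norm_eq_abs, Real.norm_eq_abs, Real.abs_exp]
    have hK' := hK β hβ'
    exact mul_le_mul hK' (Real.exp_le_exp.2 ((le_abs_self _).trans (h β hβ')))
      (Real.exp_pos _).le ((abs_nonneg _).trans hK')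

/-- Lipschitz bound for `e^{-p} s J`. -/
theorem abs_exp_mul_sub_le {p₁ p₂ s₁ s₂ J₁ J₂ M S J : ℝ} (hp₁ : |p₁| ≤ M) (hp₂ : |p₂| ≤ M)
    (hs₁ : |s₁| ≤ S) (hs₂ : |s₂| ≤ S) (hJ₁ : |J₁| ≤ J) :
    |Real.exp (-p₁) * s₁ * J₁ - Real.exp (-p₂) * s₂ * J₂| ≤
      Real.exp M * (S * J * |p₁ - p₂| + J * |s₁ - s₂| + S * |J₁ - J₂|) := by
  have e : Real.exp (-p₁) * s₁ * J₁ - Real.exp (-p₂) * s₂ * J₂ =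
      (Real.exp (-p₁) - Real.exp (-p₂)) * (s₁ * J₁) + Real.exp (-p₂) * ((s₁ - s₂) * J₁) +
        Real.exp (-p₂) * (s₂ * (J₁ - J₂)) := by ring
  have hE : Real.exp (-p₂) ≤ Real.exp M := Real.exp_le_exp.2 ((neg_le_abs _).trans hp₂)
  have hD : |Real.exp (-p₁) - Real.exp (-p₂)| ≤ Real.exp M * |p₁ - p₂| := by
    have := abs_exp_sub_exp_le (s := -p₁) (t := -p₂) ((neg_le_abs _).trans hp₁)
      ((neg_le_abs _).trans hp₂)
    rwa [neg_sub_neg, abs_sub_comm p₂] at this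
  have hS : 0 ≤ S := (abs_nonneg _).trans hs₁
  have hJ : 0 ≤ J := (abs_nonneg _).trans hJ₁
  rw [e]
  refine (abs_add_three _ _ _).trans ?_
  simp only [abs_mul, Real.abs_exp]
  have t1 : |Real.exp (-p₁) - Real.exp (-p₂)| * (|s₁| * |J₁|) ≤
      (Real.exp M * |p₁ - p₂|) * (S * J) := by gcongr
  have t2 : Real.exp (-p₂) * (|s₁ - s₂| * |J₁|) ≤ Real.exp M * (|s₁ - s₂| * J) := by gcongr
  have t3 : Real.exp (-p₂) * (|s₂| * |J₁ - J₂|) ≤ Real.exp M * (S * |J₁ - J₂|) := by gcongr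
  linarith

theorem abs_sum_mul_le {k : ℕ} (ν : E k) {c : ℝ} (hc : ‖ν‖ ≤ c) (f : Fin k → ℝ) :
    |∑ i, ν i * f i| ≤ c * ∑ i, |f i| := by
  refine (Finset.abs_sum_le_sum_abs _ _).trans ?_
  rw [Finset.mul_sum]
  refine Finset.sum_le_sum fun i _ => ?_
  rw [abs_mul]
  exact mul_le_mul_of_nonneg_right ((abs_coord_le_norm ν i).trans hc) (abs_nonneg _)

end Coefficients

/-! ### Absorption -/

/-- The lower order terms are absorbed by a large Carleman parameter. -/
theorem le_of_carleman_le {N R T : ℝ≥0∞} {κ δ c D : ℝ} (hN : N ≠ ⊤) (hR : R ≠ ⊤) (hκ : 0 ≤ κ)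
    (hδ : 0 ≤ δ) (hc : 0 < c) (hD : 0 < D)
    (h : ENNReal.ofReal (κ + δ * κ + 1) * (ENNReal.ofReal c * N) ≤
      ENNReal.ofReal κ * (ENNReal.ofReal c * (N + R)) + ENNReal.ofReal D * T) :
    N ≤ ENNReal.ofReal (κ / (δ * κ + 1)) * R + ENNReal.ofReal (D / c) * T := by
  rcases eq_or_ne T ⊤ with rfl | hT
  · rw [ENNReal.mul_top (by rw [ne_eq, ENNReal.ofReal_eq_zero, not_le]; positivity)]
    simp
  rw [← ENNReal.ofReal_toReal hN, ← ENNReal.ofReal_toReal hR, ← ENNReal.ofReal_toReal hT] at h ⊢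
  set n := N.toReal
  set r := R.toReal
  set t := T.toReal
  have hn : 0 ≤ n := ENNReal.toReal_nonneg
  have hr : 0 ≤ r := ENNReal.toReal_nonneg
  have ht : 0 ≤ t := ENNReal.toReal_nonneg
  rw [← ENNReal.ofReal_add hn hr, ← ENNReal.ofReal_mul hc.le, ← ENNReal.ofReal_mul hc.le,
    ← ENNReal.ofReal_mul (by positivity), ← ENNReal.ofReal_mul hκ, ← ENNReal.ofReal_mul hD.le,
    ← ENNReal.ofReal_add (by positivity) (by positivity),
    ENNReal.ofReal_le_ofReal_iff (by positivity)] at h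
  rw [← ENNReal.ofReal_mul (by positivity), ← ENNReal.ofReal_mul (by positivity),
    ← ENNReal.ofReal_add (by positivity) (by positivity)]
  apply ENNReal.ofReal_le_ofReal
  -- Of the Carleman parameter κ + δκ + 1, the part κ absorbs the energy on the right-hand side and
  -- δκ + 1 is left over to divide by.
  have h1 : (δ * κ + 1) * n ≤ κ * r + D / c * t := by
    have : c * ((δ * κ + 1) * n) ≤ c * (κ * r + D / c * t) := by
      have e : c * (D / c * t) = D * t := by field_simp
      rw [mul_add, e]; linarith
    exact le_of_mul_le_mul_left this hc
  have hpos : 1 ≤ δ * κ + 1 := by have := mul_nonneg hδ hκ; linarith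
  have h2 : n ≤ (κ * r + D / c * t) / (δ * κ + 1) := by
    rw [le_div_iff₀ (by linarith)]; linarith
  refine h2.trans ?_
  rw [add_div]
  have h3 : D / c * t / (δ * κ + 1) ≤ D / c * t := div_le_self (by positivity) hpos
  have h4 : κ * r / (δ * κ + 1) = κ / (δ * κ + 1) * r := by ring
  linarith

/-- Absorption by subtraction, which is legitimate because R is finite. -/
theorem le_two_mul_of_le_half {R S : ℝ≥0∞} {θ : ℝ} (hR : R ≠ ⊤) (hθ0 : 0 ≤ θ) (hθ : θ ≤ 1 / 2)
    (h : R ≤ ENNReal.ofReal θ * R + S) : R ≤ 2 * S := by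
  rcases eq_or_ne S ⊤ with rfl | hS
  · simp
  rw [← ENNReal.ofReal_toReal hR, ← ENNReal.ofReal_toReal hS] at h ⊢
  have hr : 0 ≤ R.toReal := ENNReal.toReal_nonneg
  have hs : 0 ≤ S.toReal := ENNReal.toReal_nonneg
  rw [← ENNReal.ofReal_mul hθ0, ← ENNReal.ofReal_add (by positivity) hs,
    ENNReal.ofReal_le_ofReal_iff (by positivity)] at h
  rw [show (2 : ℝ≥0∞) = ENNReal.ofReal 2 by simp, ← ENNReal.ofReal_mul (by norm_num)]
  apply ENNReal.ofReal_le_ofReal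
  nlinarith

/-! ### The estimate for coupled paths -/

section Coupled

variable {m : ℕ} {B a b d l : ℝ}

theorem measurable_carlemanWeight_last (l : ℝ) :
    Measurable fun x : E (m + 1) => carlemanWeight l (x (Fin.last m)) := by
  have h1 := (contDiff_carlemanWeight l).continuous
  have h2 : Continuous fun x : E (m + 1) => x (Fin.last m) := by fun_prop
  exact (h1.comp h2).measurable

theorem aemeasurable_weight_sq {f : E (m + 1) → ℝ}
    (hf : AEStronglyMeasurable f (volume.restrict (prism m B a b))) :
    AEMeasurable (fun x => ENNReal.ofReal (carlemanWeight l (x (Fin.last m)) * f x ^ 2))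
      (volume.restrict (prism m B a b)) :=
  ((measurable_carlemanWeight_last l).aemeasurable.mul
    (hf.aemeasurable.pow_const 2)).ennreal_ofReal

theorem carlemanWeight_le (hl : 0 ≤ l) {x : E (m + 1)} (ha : 0 < a) (hx : x ∈ prism m B a b) :
    carlemanWeight l (x (Fin.last m)) ≤ carlemanWeight l b := by
  unfold carlemanWeight
  have h1 := hx.2.1
  have h2 := hx.2.2
  apply Real.exp_le_exp.2
  apply mul_le_mul_of_nonneg_left _ hl
  nlinarith

theorem one_le_carlemanWeight (hl : 0 ≤ l) (z : ℝ) : 1 ≤ carlemanWeight l z := by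
  unfold carlemanWeight
  exact Real.one_le_exp (by positivity)

theorem l2NormSq_le_weightedSq (hl : 0 ≤ l) (f : E (m + 1) → ℝ) :
    l2NormSq (prism m B a b) f ≤ weightedSq B a b l f := by
  unfold l2NormSq weightedSq
  refine lintegral_mono fun x => ?_
  simp only [enorm_sq_eq_ofReal]
  apply ENNReal.ofReal_le_ofReal
  nlinarith [one_le_carlemanWeight hl (x (Fin.last m)), sq_nonneg (f x)]

theorem weightedSq_le (hl : 0 ≤ l) (ha : 0 < a) (f : E (m + 1) → ℝ) :
    weightedSq B a b l f ≤ ENNReal.ofReal (carlemanWeight l b) * l2NormSq (prism m B a b) f := by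
  unfold l2NormSq weightedSq
  rw [← lintegral_const_mul' _ _ ENNReal.ofReal_ne_top]
  refine setLIntegral_mono' measurableSet_prism fun x hx => ?_
  rw [enorm_sq_eq_ofReal, ← ENNReal.ofReal_mul (carlemanWeight_pos l b).le]
  apply ENNReal.ofReal_le_ofReal
  exact mul_le_mul_of_nonneg_right (carlemanWeight_le hl ha hx) (sq_nonneg _)

theorem l2NormSq_lt_top_of_memLp {k : ℕ} {U : Set (E k)} {f : E k → ℝ}
    (hf : MemLp f 2 (volume.restrict U)) : l2NormSq U f < ⊤ := by
  have := lintegral_rpow_enorm_lt_top_of_eLpNorm_lt_top (p := 2) (by norm_num) (by norm_num) hf.2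
  simpa [l2NormSq] using this

theorem weightedSq_lt_top (hl : 0 ≤ l) (ha : 0 < a) {f : E (m + 1) → ℝ}
    (hf : MemLp f 2 (volume.restrict (prism m B a b))) : weightedSq B a b l f < ⊤ :=
  (weightedSq_le hl ha f).trans_lt
    (ENNReal.mul_lt_top ENNReal.ofReal_lt_top (l2NormSq_lt_top_of_memLp hf))

theorem continuousOn_section {p : E (m + 1) → ℝ → ℝ}
    (hp : ContinuousOn (Function.uncurry p) (closure (prism m B a b) ×ˢ Icc (-d) d)) {α : ℝ}
    (hα : α ∈ Icc (-d) d) : ContinuousOn (fun x => p x α) (closure (prism m B a b)) := by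
  have hc : Continuous fun x : E (m + 1) => (x, α) := by fun_prop
  exact hp.comp hc.continuousOn fun x hx => ⟨hx, hα⟩

theorem continuousOn_path {p : E (m + 1) → ℝ → ℝ}
    (hp : ContinuousOn (Function.uncurry p) (closure (prism m B a b) ×ˢ Icc (-d) d))
    {x : E (m + 1)} (hx : x ∈ closure (prism m B a b)) : ContinuousOn (p x) (Icc (-d) d) := by
  have hc : Continuous fun α : ℝ => (x, α) := by fun_prop
  exact hp.comp hc.continuousOn fun α hα => ⟨hx, hα⟩

theorem aemeasurable_uncurry {p : E (m + 1) → ℝ → ℝ}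
    (hp : ContinuousOn (Function.uncurry p) (closure (prism m B a b) ×ˢ Icc (-d) d)) :
    AEMeasurable (Function.uncurry p)
      ((volume.restrict (prism m B a b)).prod (volume.restrict (Ioo (-d) d))) := by
  rw [Measure.prod_restrict]
  exact (hp.mono (prod_mono subset_closure Ioo_subset_Icc_self)).aemeasurable
    (measurableSet_prism.prod measurableSet_Ioo)

/-- The weighted energy of a function and a gradient. -/
def energy (B a b l : ℝ) (u : E (m + 1) → ℝ) (g : Fin (m + 1) → E (m + 1) → ℝ) : ℝ≥0∞ :=
  weightedSq B a b l u + ∑ i, weightedSq B a b l (g i)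

/-- A square is bounded by first order terms and an integral term. -/
def LowerOrderBound (B a b d K : ℝ) (F : E (m + 1) → ℝ) (u v : E (m + 1) → ℝ)
    (gu gv : Fin (m + 1) → E (m + 1) → ℝ) (P : E (m + 1) → ℝ → ℝ) : Prop :=
  ∀ᵐ x ∂(volume.restrict (prism m B a b)), ENNReal.ofReal (F x ^ 2) ≤
    ENNReal.ofReal K * (ENNReal.ofReal (u x ^ 2) + ∑ i, ENNReal.ofReal (gu i x ^ 2) +
      (ENNReal.ofReal (v x ^ 2) + ∑ i, ENNReal.ofReal (gv i x ^ 2)) +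
      ∫⁻ β in Ioo (-d) d, ENNReal.ofReal (P x β ^ 2))

/-- The weight does not depend on β, so Tonelli's theorem turns the nonlocal term into the average
energy of the slices. -/
theorem lintegral_weight_path {P : E (m + 1) → ℝ → ℝ}
    (hP : ContinuousOn (Function.uncurry P) (closure (prism m B a b) ×ˢ Icc (-d) d)) :
    ∫⁻ x in prism m B a b, (∫⁻ β in Ioo (-d) d,
      ENNReal.ofReal (carlemanWeight l (x (Fin.last m)) * P x β ^ 2)) =
    ∫⁻ β in Ioo (-d) d, weightedSq B a b l (fun x => P x β) := by
  unfold weightedSq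
  refine lintegral_lintegral_swap ?_
  have h1 : Measurable fun y : E (m + 1) × ℝ => carlemanWeight l (y.1 (Fin.last m)) :=
    (measurable_carlemanWeight_last l).comp measurable_fst
  exact (h1.aemeasurable.mul ((aemeasurable_uncurry hP).pow_const 2)).ennreal_ofReal

/-- Multiply the pointwise bound by the weight and integrate. The nonlocal term becomes a quantity
that does not depend on the source position at which the bound is used. -/
theorem LowerOrderBound.weightedSq_le {K : ℝ} {F u v : E (m + 1) → ℝ}
    {gu gv : Fin (m + 1) → E (m + 1) → ℝ} {P : E (m + 1) → ℝ → ℝ}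
    (h : LowerOrderBound B a b d K F u v gu gv P)
    (hu : AEStronglyMeasurable u (volume.restrict (prism m B a b)))
    (hv : AEStronglyMeasurable v (volume.restrict (prism m B a b)))
    (hgu : ∀ i, AEStronglyMeasurable (gu i) (volume.restrict (prism m B a b)))
    (hgv : ∀ i, AEStronglyMeasurable (gv i) (volume.restrict (prism m B a b)))
    (hP : ContinuousOn (Function.uncurry P) (closure (prism m B a b) ×ˢ Icc (-d) d)) :
    weightedSq B a b l F ≤ ENNReal.ofReal K * (energy B a b l u gu + energy B a b l v gv +
      ∫⁻ β in Ioo (-d) d, weightedSq B a b l (fun x => P x β)) := by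
  have hw : ∀ x : E (m + 1), 0 ≤ carlemanWeight l (x (Fin.last m)) :=
    fun x => (carlemanWeight_pos l _).le
  have mE : ∀ {f : E (m + 1) → ℝ} {g : Fin (m + 1) → E (m + 1) → ℝ},
      AEStronglyMeasurable f (volume.restrict (prism m B a b)) →
      (∀ i, AEStronglyMeasurable (g i) (volume.restrict (prism m B a b))) →
      AEMeasurable (fun x => ENNReal.ofReal (carlemanWeight l (x (Fin.last m)) * f x ^ 2) +
        ∑ i, ENNReal.ofReal (carlemanWeight l (x (Fin.last m)) * g i x ^ 2))
        (volume.restrict (prism m B a b)) := fun hf hg =>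
    (aemeasurable_weight_sq hf).add
      (Finset.aemeasurable_fun_sum _ fun i _ => aemeasurable_weight_sq (hg i))
  rw [← lintegral_weight_path hP]
  unfold energy
  conv_rhs => simp only [weightedSq]
  rw [← lintegral_finsetSum' _ fun i _ => aemeasurable_weight_sq (hgu i),
    ← lintegral_finsetSum' _ fun i _ => aemeasurable_weight_sq (hgv i),
    ← lintegral_add_left' (aemeasurable_weight_sq hu),
    ← lintegral_add_left' (aemeasurable_weight_sq hv),
    ← lintegral_add_left' (mE hu hgu), ← lintegral_add_left' ((mE hu hgu).fun_add (mE hv hgv)),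
    ← lintegral_const_mul' _ _ ENNReal.ofReal_ne_top]
  unfold weightedSq
  refine lintegral_mono_ae ?_
  filter_upwards [h] with x hx
  have hm := mul_le_mul_right hx (ENNReal.ofReal (carlemanWeight l (x (Fin.last m))))
  simp only [ENNReal.ofReal_mul (hw x)]
  refine hm.trans (le_of_eq ?_)
  rw [lintegral_const_mul' _ _ ENNReal.ofReal_ne_top, ← Finset.mul_sum, ← Finset.mul_sum]
  ring

/-- **Stability for coupled paths.** If the Laplacians of `P(·,α)` and `Q(·,α)` are bounded by first
order terms and by the integral of `P` over `α`, then the `H¹` norms are controlled by the Cauchy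
data on the top face. -/
theorem exists_stability (hB : 0 < B) (ha : 0 < a) (hab : a < b) (hd : 0 < d) {K : ℝ} (hK : 0 ≤ K) :
    ∃ C : ℝ, 0 < C ∧ ∀ P Q : E (m + 1) → ℝ → ℝ,
      ContinuousOn (Function.uncurry P) (closure (prism m B a b) ×ˢ Icc (-d) d) →
      ContinuousOn (Function.uncurry Q) (closure (prism m B a b) ×ˢ Icc (-d) d) →
      (∀ α ∈ Ioo (-d) d, ∃ gP hP gQ hQ : Fin (m + 1) → E (m + 1) → ℝ,
        IsAdmissible B a b (fun x => P x α) gP hP ∧ IsAdmissible B a b (fun x => Q x α) gQ hQ ∧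
        LowerOrderBound B a b d K (fun x => ∑ i, hP i x) (fun x => P x α) (fun x => Q x α) gP gQ P ∧
        LowerOrderBound B a b d K (fun x => ∑ i, hQ i x) (fun x => P x α) (fun x => Q x α) gP gQ P) →
      ∀ α ∈ Ioo (-d) d,
        h1NormSq (prism m B a b) (fun x => P x α) + h1NormSq (prism m B a b) (fun x => Q x α) ≤
        ENNReal.ofReal C * (∫⁻ β in Ioo (-d) d,
          (topData B a b (fun x => P x β) + topData B a b (fun x => Q x β))) +
        ENNReal.ofReal C * (topData B a b (fun x => P x α) + topData B a b (fun x => Q x α)) := by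
  have hb : 0 < b := ha.trans hab
  -- The factor 2 accounts for adding the estimates of P and Q, each of which contributes the same
  -- lower order bound.
  set κ : ℝ := 2 * carlemanConst a b * K with hκdef
  have hcc := carlemanConst_pos (a := a) (b := b)
  have hκ : 0 ≤ κ := by positivity
  -- Here κ absorbs the first order terms for fixed α. The extra 4dκ leaves the coefficient κ/(4dκ +
  -- 1) in front of R, and integrating over a length 2d turns it into at most 1/2.
  set l : ℝ := κ + 4 * d * κ + 1 with hl
  have hl1 : 1 ≤ l := by have : 0 ≤ κ + 4 * d * κ := by positivity
                         linarith
  have hl0 : 0 ≤ l := by linarith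
  set D : ℝ := carlemanDataConst a b l with hD
  have hD0 : 0 < D := carlemanDataConst_pos hb hl1
  set c : ℝ := (2 * B) ^ m with hc
  have hc0 : 0 < c := by positivity
  refine ⟨2 * κ * (D / c) + D / c, by positivity, fun P Q hPc hQc H α hα => ?_⟩
  set R : ℝ≥0∞ := ∫⁻ β in Ioo (-d) d, weightedSq B a b l (fun x => P x β) with hR
  set T : ℝ → ℝ≥0∞ := fun β => topData B a b (fun x => P x β) + topData B a b (fun x => Q x β) with hT
  -- R can be absorbed only because it is finite; this follows from the boundedness of P on the
  -- compact closure, whatever the data are.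
  have hRtop : R ≠ ⊤ := by
    have hcpt : IsCompact (closure (prism m B a b) ×ˢ Icc (-d) d) :=
      isCompact_closure_prism.prod isCompact_Icc
    obtain ⟨M, hM⟩ := hcpt.exists_bound_of_continuousOn hPc
    refine ne_of_lt ((setLIntegral_mono' measurableSet_Ioo
      (g := fun _ => ENNReal.ofReal (carlemanWeight l b) *
        (ENNReal.ofReal (M ^ 2) * volume (prism m B a b))) fun β hβ => ?_).trans_lt ?_)
    · refine (RTEStability.weightedSq_le hl0 ha _).trans ?_
      gcongr
      unfold l2NormSq
      rw [← setLIntegral_const]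
      refine setLIntegral_mono' measurableSet_prism fun x hx => ?_
      rw [enorm_sq_eq_ofReal]
      apply ENNReal.ofReal_le_ofReal
      have := hM (x, β) ⟨subset_closure hx, Ioo_subset_Icc_self hβ⟩
      simp only [Function.uncurry, Real.norm_eq_abs] at this
      exact sq_le_sq' (abs_le.1 this).1 (abs_le.1 this).2
    · rw [setLIntegral_const, Real.volume_Ioo]
      exact ENNReal.mul_lt_top (ENNReal.mul_lt_top ENNReal.ofReal_lt_top
        (ENNReal.mul_lt_top ENNReal.ofReal_lt_top volume_prism_lt_top)) ENNReal.ofReal_lt_top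
  have key : ∀ β ∈ Ioo (-d) d, ∃ gP gQ : Fin (m + 1) → E (m + 1) → ℝ,
      HasWeakGrad (prism m B a b) (fun x => P x β) gP ∧
      HasWeakGrad (prism m B a b) (fun x => Q x β) gQ ∧
      energy B a b l (fun x => P x β) gP + energy B a b l (fun x => Q x β) gQ ≤
        ENNReal.ofReal (κ / (4 * d * κ + 1)) * R + ENNReal.ofReal (D / c) * T β := by
    intro β hβ
    obtain ⟨gP, hP, gQ, hQ, AP, AQ, LP, LQ⟩ := H β hβ
    refine ⟨gP, gQ, AP.grad, AQ.grad, ?_⟩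
    have mP := memLp_of_continuousOn_closure AP.cont
    have mQ := memLp_of_continuousOn_closure AQ.cont
    have fin : ∀ {u : E (m + 1) → ℝ} {g h : Fin (m + 1) → E (m + 1) → ℝ}, IsAdmissible B a b u g h →
        energy B a b l u g ≠ ⊤ := fun A => ENNReal.add_ne_top.2
      ⟨(weightedSq_lt_top hl0 ha (memLp_of_continuousOn_closure A.cont)).ne,
        (ENNReal.sum_lt_top.2 fun i _ => weightedSq_lt_top hl0 ha (A.grad_memLp i)).ne⟩
    refine le_of_carleman_le (ENNReal.add_ne_top.2 ⟨fin AP, fin AQ⟩) hRtop hκ (by positivity) hc0 hD0 ?_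
    have bP := LP.weightedSq_le (l := l) mP.1 mQ.1 (fun i => (AP.grad_memLp i).1)
      (fun i => (AQ.grad_memLp i).1) hPc
    have bQ := LQ.weightedSq_le (l := l) mP.1 mQ.1 (fun i => (AP.grad_memLp i).1)
      (fun i => (AQ.grad_memLp i).1) hPc
    have cP := AP.carleman hB ha hab hl1
    have cQ := AQ.carleman hB ha hab hl1
    rw [← hR] at bP bQ
    have e : ENNReal.ofReal κ = 2 * ENNReal.ofReal (carlemanConst a b) * ENNReal.ofReal K := by
      rw [hκdef, ENNReal.ofReal_mul (by positivity), ENNReal.ofReal_mul (by positivity)]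
      simp
    set N := energy B a b l (fun x => P x β) gP + energy B a b l (fun x => Q x β) gQ with hN
    calc ENNReal.ofReal l * (ENNReal.ofReal c * N)
        = ENNReal.ofReal l * (ENNReal.ofReal c * energy B a b l (fun x => P x β) gP) +
          ENNReal.ofReal l * (ENNReal.ofReal c * energy B a b l (fun x => Q x β) gQ) := by
          rw [hN]; ring
      _ ≤ _ := add_le_add cP cQ
      _ ≤ (ENNReal.ofReal (carlemanConst a b) * (ENNReal.ofReal c *
            (ENNReal.ofReal K * (N + R))) + ENNReal.ofReal D * topData B a b (fun x => P x β)) +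
          (ENNReal.ofReal (carlemanConst a b) * (ENNReal.ofReal c *
            (ENNReal.ofReal K * (N + R))) + ENNReal.ofReal D * topData B a b (fun x => Q x β)) := by
          gcongr
      _ = _ := by rw [e, hT]; ring
  -- R is the integral over β of a part of the energy just estimated, so integrating that estimate
  -- bounds R by at most half of itself plus data.
  have hRle : R ≤ 2 * (ENNReal.ofReal (D / c) * ∫⁻ β in Ioo (-d) d, T β) := by
    refine le_two_mul_of_le_half (θ := κ / (4 * d * κ + 1) * (2 * d)) hRtop (by positivity) ?_ ?_
    · have h4 : 0 ≤ d * κ := by positivity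
      rw [div_mul_eq_mul_div, div_le_div_iff₀ (by positivity) (by norm_num)]
      linarith
    · calc R ≤ ∫⁻ β in Ioo (-d) d,
            (ENNReal.ofReal (κ / (4 * d * κ + 1)) * R + ENNReal.ofReal (D / c) * T β) := by
            refine setLIntegral_mono' measurableSet_Ioo fun β hβ => ?_
            obtain ⟨gP, gQ, -, -, h⟩ := key β hβ
            exact (le_self_add.trans le_self_add).trans h
        _ = _ := by
            rw [lintegral_add_left measurable_const, setLIntegral_const, Real.volume_Ioo,
              lintegral_const_mul' _ _ ENNReal.ofReal_ne_top, ENNReal.ofReal_mul (by positivity)]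
            rw [show d - -d = 2 * d by ring]
            ring
  obtain ⟨gP, gQ, hgP, hgQ, h⟩ := key α hα
  have t1 : ∀ {u : E (m + 1) → ℝ} {g : Fin (m + 1) → E (m + 1) → ℝ}, HasWeakGrad (prism m B a b) u g →
      h1NormSq (prism m B a b) u ≤ energy B a b l u g := by
    intro u g hg
    refine (iInf₂_le g hg).trans ?_
    unfold energy
    gcongr <;> exact l2NormSq_le_weightedSq hl0 _
  refine (add_le_add (t1 hgP) (t1 hgQ)).trans (h.trans ?_)
  have k1 : ENNReal.ofReal (κ / (4 * d * κ + 1)) ≤ ENNReal.ofReal κ := by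
    apply ENNReal.ofReal_le_ofReal
    refine div_le_self hκ ?_
    have : 0 ≤ 4 * d * κ := by positivity
    linarith
  have k2 : ENNReal.ofReal κ * (2 * ENNReal.ofReal (D / c)) ≤
      ENNReal.ofReal (2 * κ * (D / c) + D / c) := by
    rw [show (2 : ℝ≥0∞) = ENNReal.ofReal 2 by simp, ← ENNReal.ofReal_mul (by norm_num),
      ← ENNReal.ofReal_mul hκ]
    apply ENNReal.ofReal_le_ofReal
    have : 0 < D / c := by positivity
    nlinarith
  have k3 : ENNReal.ofReal (D / c) ≤ ENNReal.ofReal (2 * κ * (D / c) + D / c) := by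
    apply ENNReal.ofReal_le_ofReal
    have : 0 ≤ 2 * κ * (D / c) := by positivity
    linarith
  refine add_le_add ?_ (mul_le_mul_left k3 _)
  calc ENNReal.ofReal (κ / (4 * d * κ + 1)) * R
      ≤ ENNReal.ofReal κ * (2 * (ENNReal.ofReal (D / c) * ∫⁻ β in Ioo (-d) d, T β)) :=
        mul_le_mul' k1 hRle
    _ = (ENNReal.ofReal κ * (2 * ENNReal.ofReal (D / c))) * ∫⁻ β in Ioo (-d) d, T β := by ring
    _ ≤ _ := mul_le_mul_left k2 _

end Coupled

/-! ### Measurability of the Cauchy data with respect to the source position -/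

section Data

variable {m : ℕ} {B a b d : ℝ} {p q : E (m + 1) → ℝ → ℝ}

theorem continuousOn_coef_path (hB : 0 < B) (hab : a < b)
    (hp : ContinuousOn (Function.uncurry p) (closure (prism m B a b) ×ˢ Icc (-d) d))
    (σ : Fin m → Bool) (n : Fin m → ℤ) {z : ℝ} (hz : z ∈ Icc a b) :
    ContinuousOn (fun α => coef B σ n (fun x => p x α) z) (Icc (-d) d) := by
  have hcpt : IsCompact (closure (prism m B a b) ×ˢ Icc (-d) d) :=
    isCompact_closure_prism.prod isCompact_Icc
  obtain ⟨C, hC⟩ := hcpt.exists_bound_of_continuousOn hp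
  unfold coef
  refine continuousOn_of_dominated (bound := fun _ => C) ?_ ?_ (integrable_const _) ?_
  · intro α hα
    exact (memLp_slice_of_continuousOn hB hab (continuousOn_section hp hα) hz).aestronglyMeasurable.mul
      (continuous_trigProd B σ n).aestronglyMeasurable
  · intro α hα
    filter_upwards [ae_restrict_mem (measurableSet_cube m B)] with y hy
    rw [norm_mul]
    have h1 := hC (topPoint z y, α) ⟨topPoint_mem_closure hB hab hz (subset_closure hy), hα⟩
    simp only [Function.uncurry] at h1
    have h2 : ‖trigProd B σ n y‖ ≤ 1 := abs_trigProd_le_one B σ n y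
    have := mul_le_mul h1 h2 (norm_nonneg _) ((norm_nonneg _).trans h1)
    linarith
  · filter_upwards [ae_restrict_mem (measurableSet_cube m B)] with y hy
    exact (continuousOn_path hp (topPoint_mem_closure hB hab hz (subset_closure hy))).mul
      continuousOn_const

/-- Certifies that `topDeriv` is a genuine derivative here and not the default value of
`derivWithin`. -/
theorem IsAdmissible.hasDerivWithinAt_coef (hB : 0 < B) (hab : a < b) {u : E (m + 1) → ℝ}
    {g h : Fin (m + 1) → E (m + 1) → ℝ} (H : IsAdmissible B a b u g h) (n : Fin m → ℤ) :
    HasDerivWithinAt (coef B noCos n u) (topDeriv B a b n u) (Icc a b) b := by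
  obtain ⟨C, -, -, h3⟩ := exists_double_primitive hab (continuousOn_coef hB hab H.cont noCos n)
    (integrableOn_coef hB (H.grad_memLp (Fin.last m)))
    (integrableOn_coef hB (H.second_memLp (Fin.last m)))
    (coef_vertical (H.grad (Fin.last m)) (memLp_of_continuousOn_closure H.cont)
      (H.grad_memLp (Fin.last m)) noCos n)
    (coef_vertical (H.second (Fin.last m)) (H.grad_memLp (Fin.last m))
      (H.second_memLp (Fin.last m)) noCos n)
  exact h3.differentiableWithinAt.hasDerivWithinAt

/-- The derivative at b is a limit of difference quotients at the heights b - (b - a)/(j + 1), all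
of which lie in [a,b). Each quotient is continuous in α because the coefficients are. -/
theorem aemeasurable_topDeriv_path (hB : 0 < B) (hab : a < b)
    (hp : ContinuousOn (Function.uncurry p) (closure (prism m B a b) ×ˢ Icc (-d) d))
    (H : ∀ α ∈ Ioo (-d) d, ∃ g h, IsAdmissible B a b (fun x => p x α) g h) (n : Fin m → ℤ) :
    AEMeasurable (fun α => topDeriv B a b n (fun x => p x α)) (volume.restrict (Ioo (-d) d)) := by
  have hpos : ∀ j : ℕ, 0 < (b - a) / ((j : ℝ) + 1) := fun j => by
    have : 0 < b - a := sub_pos.2 hab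
    positivity
  have hle : ∀ j : ℕ, (b - a) / ((j : ℝ) + 1) ≤ b - a := fun j => by
    refine div_le_self (sub_pos.2 hab).le ?_
    have : (0 : ℝ) ≤ j := j.cast_nonneg
    linarith
  have hz : Tendsto (fun j : ℕ => b - (b - a) / ((j : ℝ) + 1)) atTop (𝓝[Icc a b \ {b}] b) := by
    refine tendsto_nhdsWithin_iff.2 ⟨?_, Eventually.of_forall fun j => ?_⟩
    · have h0 : Tendsto (fun j : ℕ => (b - a) * (1 / ((j : ℝ) + 1))) atTop (𝓝 ((b - a) * 0)) :=
        tendsto_one_div_add_atTop_nhds_zero_nat.const_mul _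
      have h1 := h0.const_sub b
      simpa [div_eq_mul_inv] using h1
    · have h1 := hpos j
      have h2 := hle j
      exact ⟨⟨by linarith, by linarith⟩, by simp only [mem_singleton_iff]; linarith⟩
  refine aemeasurable_of_tendsto_metrizable_ae (u := atTop) (f := fun (j : ℕ) α =>
    slope (coef B noCos n (fun x => p x α)) b (b - (b - a) / ((j : ℝ) + 1))) (fun j => ?_) ?_
  · have hc : ∀ z ∈ Icc a b, AEMeasurable (fun α => coef B noCos n (fun x => p x α) z)
        (volume.restrict (Ioo (-d) d)) := fun z hz =>
      ((continuousOn_coef_path hB hab hp noCos n hz).mono Ioo_subset_Icc_self).aemeasurable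
        measurableSet_Ioo
    simp only [slope, vsub_eq_sub, smul_eq_mul]
    have h1 := hpos j
    have h2 := hle j
    exact ((hc _ ⟨by linarith, by linarith⟩).sub (hc b (right_mem_Icc.2 hab.le))).const_mul _
  · filter_upwards [ae_restrict_mem measurableSet_Ioo] with α hα
    obtain ⟨g, h, A⟩ := H α hα
    exact (hasDerivWithinAt_iff_tendsto_slope.1 (A.hasDerivWithinAt_coef hB hab n)).comp hz

theorem topData_eq_add (u : E (m + 1) → ℝ) : topData B a b u =
    (∑' n : Fin m → ℤ, ENNReal.ofReal (coef B noCos n u b ^ 2)) +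
      ∑' n : Fin m → ℤ, ENNReal.ofReal (topDeriv B a b n u ^ 2) := by
  rw [topData, ← ENNReal.tsum_add]
  exact tsum_congr fun n => ENNReal.ofReal_add (sq_nonneg _) (sq_nonneg _)

/-- The integral over the sources of the Cauchy data. -/
theorem aemeasurable_topData_path (hB : 0 < B) (hab : a < b)
    (hp : ContinuousOn (Function.uncurry p) (closure (prism m B a b) ×ˢ Icc (-d) d))
    (H : ∀ α ∈ Ioo (-d) d, ∃ g h, IsAdmissible B a b (fun x => p x α) g h) :
    AEMeasurable (fun α => topData B a b (fun x => p x α)) (volume.restrict (Ioo (-d) d)) ∧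
    ∫⁻ α in Ioo (-d) d, topData B a b (fun x => p x α) ≤ ENNReal.ofReal ((2 * B) ^ m) *
      ((∫⁻ α in Ioo (-d) d, dirichletNormSq B b (fun x => p x α)) +
        ∫⁻ α in Ioo (-d) d, neumannNormSq B a b (fun x => p x α)) := by
  have m1 : AEMeasurable (fun α => ∑' n : Fin m → ℤ,
      ENNReal.ofReal (coef B noCos n (fun x => p x α) b ^ 2)) (volume.restrict (Ioo (-d) d)) :=
    AEMeasurable.tsum fun n => ((((continuousOn_coef_path hB hab hp noCos n
      (right_mem_Icc.2 hab.le)).mono Ioo_subset_Icc_self).aemeasurable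
        measurableSet_Ioo).pow_const 2).ennreal_ofReal
  have m2 : AEMeasurable (fun α => ∑' n : Fin m → ℤ,
      ENNReal.ofReal (topDeriv B a b n (fun x => p x α) ^ 2)) (volume.restrict (Ioo (-d) d)) :=
    AEMeasurable.tsum fun n =>
      ((aemeasurable_topDeriv_path hB hab hp H n).pow_const 2).ennreal_ofReal
  simp only [topData_eq_add]
  refine ⟨m1.add m2, ?_⟩
  -- Additivity is applied only to the Fourier sums, whose measurability is known. The Dirichlet and
  -- Neumann norms are infima and enter solely as upper bounds, so their measurability in α is never
  -- needed.
  rw [lintegral_add_left' m1, mul_add, ← lintegral_const_mul' _ _ ENNReal.ofReal_ne_top,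
    ← lintegral_const_mul' _ _ ENNReal.ofReal_ne_top]
  refine add_le_add (setLIntegral_mono' measurableSet_Ioo fun α hα => ?_)
    (setLIntegral_mono' measurableSet_Ioo fun α hα => ?_)
  · exact tsum_coef_top_le hB hab (continuousOn_section hp (Ioo_subset_Icc_self hα))
  · exact tsum_topDeriv_le hB hab (continuousOn_section hp (Ioo_subset_Icc_self hα))

theorem coef_sub (hB : 0 < B) (hab : a < b) {u v : E (m + 1) → ℝ}
    (hu : ContinuousOn u (closure (prism m B a b))) (hv : ContinuousOn v (closure (prism m B a b)))
    (n : Fin m → ℤ) {z : ℝ} (hz : z ∈ Icc a b) :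
    coef B noCos n (fun x => u x - v x) z = coef B noCos n u z - coef B noCos n v z := by
  have hi : ∀ {f : E (m + 1) → ℝ}, ContinuousOn f (closure (prism m B a b)) →
      Integrable (fun y => f (topPoint z y) * trigProd B noCos n y) (volume.restrict (cube m B)) :=
    fun hf => ((memLp_slice_of_continuousOn hB hab hf hz).integrable (by norm_num)).mul_bdd (c := 1)
      (continuous_trigProd B noCos n).aestronglyMeasurable
      (Eventually.of_forall fun y => abs_trigProd_le_one B noCos n y)
  unfold coef
  rw [← integral_sub (hi hu) (hi hv)]
  simp only [sub_mul]

/-- The Cauchy data of the difference of two functions with the same Cauchy data vanish. -/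
theorem topData_sub_eq_zero (hB : 0 < B) (hab : a < b) {u v : E (m + 1) → ℝ}
    (hu : ContinuousOn u (closure (prism m B a b))) (hv : ContinuousOn v (closure (prism m B a b)))
    (hD : ∀ x ∈ topFace m B b, u x = v x)
    {γ : E m → ℝ} (hγu : IsTopNormalDeriv B a b u γ) (hγv : IsTopNormalDeriv B a b v γ) :
    topData B a b (fun x => u x - v x) = 0 := by
  have hbm : b ∈ Icc a b := right_mem_Icc.2 hab.le
  -- Both functions have the same trace γ, so the derivatives of their coefficients at b are the
  -- same number; the trace of the difference is not needed.
  have hw : ∀ {f : E (m + 1) → ℝ}, ContinuousOn f (closure (prism m B a b)) →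
      IsTopNormalDeriv B a b f γ → ∀ n, HasDerivWithinAt (coef B noCos n f)
        (∫ y in cube m B, γ y * trigProd B noCos n y) (Icc a b) b := by
    intro f hf hγ n
    rw [← topDeriv_eq hB hab hf hγ n]
    obtain ⟨v, huv, w, hvw, hv, hw, -, -⟩ := hγ
    obtain ⟨C, -, -, h3⟩ := exists_double_primitive hab (continuousOn_coef hB hab hf noCos n)
      (integrableOn_coef hB hv) (integrableOn_coef hB hw)
      (coef_vertical huv (memLp_of_continuousOn_closure hf) hv noCos n)
      (coef_vertical hvw hv hw noCos n)
    exact h3.differentiableWithinAt.hasDerivWithinAt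
  refine ENNReal.tsum_eq_zero.2 fun n => ?_
  have e1 : coef B noCos n (fun x => u x - v x) b = 0 := by
    unfold coef
    refine (setIntegral_congr_fun (measurableSet_cube m B) fun y hy => ?_).trans
      (integral_zero (E m) ℝ)
    have : topPoint b y ∈ topFace m B b :=
      ⟨fun i => by rw [topPoint_castSucc]; exact hy i, topPoint_last b y⟩
    simp [hD _ this]
  have e2 : topDeriv B a b n (fun x => u x - v x) = 0 := by
    have h := (hw hu hγu n).sub (hw hv hγv n)
    rw [sub_self] at h
    have h' : HasDerivWithinAt (coef B noCos n (fun x => u x - v x)) 0 (Icc a b) b :=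
      h.congr (fun z hz => coef_sub hB hab hu hv n hz) (coef_sub hB hab hu hv n hbm)
    exact h'.derivWithin (uniqueDiffOn_Icc hab b hbm)
  simp [e1, e2]

end Data

/-! ### The bound for the lower order terms -/

theorem lintegral_sq_le {X : Type*} [MeasurableSpace X] {μ : Measure X} {f : X → ℝ≥0∞}
    (hf : AEMeasurable f μ) : (∫⁻ x, f x ∂μ) ^ 2 ≤ μ univ * ∫⁻ x, f x ^ 2 ∂μ := by
  have h := ENNReal.lintegral_mul_le_Lp_mul_Lq μ (p := 2) (q := 2) Real.HolderConjugate.two_two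
    (aemeasurable_const (b := (1 : ℝ≥0∞))) hf
  simp only [Pi.mul_apply, one_mul, lintegral_const, ENNReal.rpow_two] at h
  have h2 := pow_le_pow_left₀ (by simp) h 2
  refine h2.trans (le_of_eq ?_)
  have hs : ∀ t : ℝ≥0∞, (t ^ (1 / 2 : ℝ)) ^ 2 = t := fun t => by
    rw [← ENNReal.rpow_natCast, ← ENNReal.rpow_mul]; norm_num
  rw [mul_pow, hs, hs, one_pow, one_mul]

section LowerOrder

variable {m : ℕ} {B a b d ρ KG Ks M : ℝ}

/-- The uniform bounds for the coefficients and for two functions of the variables `(x,α)`. -/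
structure UniformBounds (B a b d ρ KG Ks M : ℝ) (G : E (m + 1) → ℝ → ℝ → ℝ) (μs : E (m + 1) → ℝ)
    (p₁ q₁ p₂ q₂ : E (m + 1) → ℝ → ℝ) : Prop where
  dist : ∀ x ∈ closure (prism m B a b), ∀ α ∈ Icc (-d) d, ρ ≤ ‖x - source m α‖
  regular : KernelRegular B b d G
  kernel : KernelNormLE B a b d G KG
  scattering : SupNormLE (closure (prism m B a b)) μs Ks
  cont_fst : ContinuousOn (Function.uncurry p₁) (closure (prism m B a b) ×ˢ Icc (-d) d)
  cont_snd : ContinuousOn (Function.uncurry p₂) (closure (prism m B a b) ×ˢ Icc (-d) d)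
  fst : ∀ x ∈ closure (prism m B a b), ∀ α ∈ Icc (-d) d, |p₁ x α| ≤ M ∧ |q₁ x α| ≤ M
  snd : ∀ x ∈ closure (prism m B a b), ∀ α ∈ Icc (-d) d, |p₂ x α| ≤ M ∧ |q₂ x α| ≤ M

variable {G : E (m + 1) → ℝ → ℝ → ℝ} {μs : E (m + 1) → ℝ} {p₁ q₁ p₂ q₂ : E (m + 1) → ℝ → ℝ}

theorem closure_prism_subset_closure_bigPrism (ha : 0 < a) :
    closure (prism m B a b) ⊆ closure (bigPrism m B b d) :=
  closure_mono (prism_subset_bigPrism ha)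

/-- The Lipschitz constant of the lower order terms. -/
def lowerOrderConst (d ρ KG Ks M : ℝ) : ℝ :=
  1 + 2 / ρ + Real.exp M * (M * Ks * (KG * Real.exp M * (2 * d)) + KG * Real.exp M * (2 * d) * Ks +
    M * Ks * (KG * Real.exp M) + Ks * (KG * Real.exp M * (2 * d)) + Ks * (KG * Real.exp M))

theorem lowerOrderConst_nonneg (hd : 0 < d) (hρ : 0 < ρ) (hKG : 0 ≤ KG) (hKs : 0 ≤ Ks)
    (hM : 0 ≤ M) : 0 ≤ lowerOrderConst d ρ KG Ks M := by
  unfold lowerOrderConst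
  positivity

/-- The gradient terms are linear with |ν| ≤ 1 and |∂_α ν| ≤ 2/ρ. Each exponential term is a product
of bounded factors that are Lipschitz in (p,q), the integral factor contributing ∫|p₁ - p₂| dβ. All
constants come from the prescribed upper bounds. -/
theorem abs_lowerOrder_sub_le (hB : 0 < B) (ha : 0 < a) (hab : a < b) (hd : 0 < d) (hρ : 0 < ρ)
    (hKG : 0 ≤ KG) (hKs : 0 ≤ Ks) (hM : 0 ≤ M) (H : UniformBounds B a b d ρ KG Ks M G μs p₁ q₁ p₂ q₂)
    {x : E (m + 1)} (hx : x ∈ closure (prism m B a b)) {α : ℝ} (hα : α ∈ Icc (-d) d)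
    (gp₁ gq₁ gp₂ gq₂ : Fin (m + 1) → ℝ) :
    |lowerOrder d G μs p₁ q₁ gp₁ gq₁ x α - lowerOrder d G μs p₂ q₂ gp₂ gq₂ x α| ≤
      lowerOrderConst d ρ KG Ks M * ((∑ i, |gp₁ i - gp₂ i|) + (∑ i, |gq₁ i - gq₂ i|) +
        |p₁ x α - p₂ x α| + |q₁ x α - q₂ x α| + ∫ β in (-d)..d, |p₁ x β - p₂ x β|) := by
  have hb : 0 < b := ha.trans hab
  have hx' := closure_prism_subset_closure_bigPrism (d := d) ha hx
  have c1 := continuousOn_path H.cont_fst hx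
  have c2 := continuousOn_path H.cont_snd hx
  have k1 := H.regular.continuousOn_kernel hx' hα
  have k2 := H.regular.continuousOn_kernelAlpha hB hb hd hx' hα
  have b1 : ∀ β ∈ Icc (-d) d, |p₁ x β| ≤ M := fun β hβ => (H.fst x hx β hβ).1
  have b2 : ∀ β ∈ Icc (-d) d, |p₂ x β| ≤ M := fun β hβ => (H.snd x hx β hβ).1
  have n1 : ∀ β ∈ Icc (-d) d, |G x α β| ≤ KG := fun β hβ => (H.kernel x hx α hα β hβ).1
  have n2 : ∀ β ∈ Icc (-d) d, |kernelAlpha d G x α β| ≤ KG := fun β hβ => (H.kernel x hx α hα β hβ).2.1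
  have hs := H.scattering x hx
  have q1 := (H.fst x hx α hα).2
  have q2 := (H.snd x hx α hα).2
  -- J bounds the integrals of the kernels against the exponential, and L is their Lipschitz
  -- constant with respect to ∫|p₁ - p₂|.
  set J := KG * Real.exp M * (2 * d) with hJ
  set L := KG * Real.exp M with hL
  have hJ0 : 0 ≤ J := by positivity
  have hL0 : 0 ≤ L := by positivity
  have t1 := abs_sum_mul_le (nu x α) (norm_nu_le x α) fun i => gq₁ i - gq₂ i
  have t2 := abs_sum_mul_le (nuAlpha x α) (norm_nuAlpha_le hρ (H.dist x hx α hα))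
    fun i => gp₁ i - gp₂ i
  have hsq : ∀ {q : ℝ}, |q| ≤ M → |q * μs x| ≤ M * Ks := fun h => by
    rw [abs_mul]; exact mul_le_mul h hs (abs_nonneg _) hM
  have t3 := abs_exp_mul_sub_le (b1 α hα) (b2 α hα) (hsq q1) (hsq q2)
    (abs_integral_kernel_le hd n1 b1) (J₂ := ∫ β in (-d)..d, G x α β * Real.exp (p₂ x β))
  have t4 := abs_exp_mul_sub_le (b1 α hα) (b2 α hα) hs hs
    (abs_integral_kernel_le hd n2 b1) (J₂ := ∫ β in (-d)..d, kernelAlpha d G x α β * Real.exp (p₂ x β))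
  have i3 := abs_integral_kernel_sub_le hd k1 c1 c2 n1 b1 b2
  have i4 := abs_integral_kernel_sub_le hd k2 c1 c2 n2 b1 b2
  set I := ∫ β in (-d)..d, |p₁ x β - p₂ x β| with hI
  have hI0 : 0 ≤ I := intervalIntegral.integral_nonneg (by linarith) fun _ _ => abs_nonneg _
  have e5 : |q₁ x α * μs x - q₂ x α * μs x| ≤ Ks * |q₁ x α - q₂ x α| := by
    rw [← sub_mul, abs_mul, mul_comm]; gcongr
  -- In the term with ∂_α G the middle factor is μₛ for both solutions, so it contributes no
  -- difference.
  rw [sub_self, abs_zero, mul_zero, add_zero] at t4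
  have e : lowerOrder d G μs p₁ q₁ gp₁ gq₁ x α - lowerOrder d G μs p₂ q₂ gp₂ gq₂ x α =
      (∑ i, nu x α i * (gq₁ i - gq₂ i)) + (∑ i, nuAlpha x α i * (gp₁ i - gp₂ i)) +
      (Real.exp (-p₁ x α) * (q₁ x α * μs x) * (∫ β in (-d)..d, G x α β * Real.exp (p₁ x β)) -
        Real.exp (-p₂ x α) * (q₂ x α * μs x) * (∫ β in (-d)..d, G x α β * Real.exp (p₂ x β))) -
      (Real.exp (-p₁ x α) * μs x * (∫ β in (-d)..d, kernelAlpha d G x α β * Real.exp (p₁ x β)) -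
        Real.exp (-p₂ x α) * μs x *
          (∫ β in (-d)..d, kernelAlpha d G x α β * Real.exp (p₂ x β))) := by
    simp only [lowerOrder, mul_sub, Finset.sum_sub_distrib]
    ring
  rw [e]
  have tri : ∀ r s t u : ℝ, |r + s + t - u| ≤ |r| + |s| + |t| + |u| := fun r s t u => by
    refine (abs_sub _ _).trans ?_
    have := abs_add_three r s t
    linarith
  refine (tri _ _ _ _).trans ?_
  set SP := ∑ i, |gp₁ i - gp₂ i|
  set SQ := ∑ i, |gq₁ i - gq₂ i|
  have hSP : 0 ≤ SP := Finset.sum_nonneg fun _ _ => abs_nonneg _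
  have hSQ : 0 ≤ SQ := Finset.sum_nonneg fun _ _ => abs_nonneg _
  set P := |p₁ x α - p₂ x α|
  set Q := |q₁ x α - q₂ x α|
  have hP : 0 ≤ P := abs_nonneg _
  have hQ : 0 ≤ Q := abs_nonneg _
  have hE := Real.exp_pos M
  set X := Real.exp M
  have u3 := t3.trans (mul_le_mul_of_nonneg_left
    (add_le_add (add_le_add le_rfl (mul_le_mul_of_nonneg_left e5 hJ0))
      (mul_le_mul_of_nonneg_left i3 (by positivity : 0 ≤ M * Ks))) hE.le)
  have u4 := t4.trans (mul_le_mul_of_nonneg_left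
    (add_le_add le_rfl (mul_le_mul_of_nonneg_left i4 hKs)) hE.le)
  have hc1 : 1 ≤ lowerOrderConst d ρ KG Ks M := by
    unfold lowerOrderConst
    have : 0 ≤ 2 / ρ + X * (M * Ks * J + J * Ks + M * Ks * L + Ks * J + Ks * L) := by positivity
    linarith
  have hc2 : 2 / ρ ≤ lowerOrderConst d ρ KG Ks M := by
    unfold lowerOrderConst
    have : 0 ≤ 1 + X * (M * Ks * J + J * Ks + M * Ks * L + Ks * J + Ks * L) := by positivity
    linarith
  have hc3 : X * (M * Ks * J + J * Ks + M * Ks * L + Ks * J + Ks * L) ≤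
      lowerOrderConst d ρ KG Ks M := by
    unfold lowerOrderConst
    have : 0 ≤ 1 + 2 / ρ := by positivity
    linarith
  have f1 := mul_le_mul_of_nonneg_right hc1 hSQ
  have f2 := mul_le_mul_of_nonneg_right hc2 hSP
  have f3 := mul_le_mul_of_nonneg_right hc3 (by positivity : 0 ≤ P + Q + I)
  have f4 : X * (M * Ks * J * P + J * (Ks * Q) + M * Ks * (L * I)) + X * (Ks * J * P + Ks * (L * I)) ≤
      X * (M * Ks * J + J * Ks + M * Ks * L + Ks * J + Ks * L) * (P + Q + I) := by
    have z1 : 0 ≤ X * (M * Ks * J) := by positivity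
    have z2 : 0 ≤ X * (J * Ks) := by positivity
    have z3 : 0 ≤ X * (M * Ks * L) := by positivity
    have z4 : 0 ≤ X * (Ks * J) := by positivity
    have z5 : 0 ≤ X * (Ks * L) := by positivity
    have s1 : P ≤ P + Q + I := by linarith
    have s2 : Q ≤ P + Q + I := by linarith
    have s3 : I ≤ P + Q + I := by linarith
    have y1 := mul_le_mul_of_nonneg_left s1 z1
    have y2 := mul_le_mul_of_nonneg_left s2 z2
    have y3 := mul_le_mul_of_nonneg_left s3 z3
    have y4 := mul_le_mul_of_nonneg_left s1 z4
    have y5 := mul_le_mul_of_nonneg_left s3 z5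
    generalize P + Q + I = W at *
    calc _ = X * (M * Ks * J) * P + X * (J * Ks) * Q + X * (M * Ks * L) * I + X * (Ks * J) * P +
          X * (Ks * L) * I := by ring
      _ ≤ _ := add_le_add (add_le_add (add_le_add (add_le_add y1 y2) y3) y4) y5
      _ = _ := by ring
  calc _ ≤ 1 * SQ + 2 / ρ * SP + X * (M * Ks * J * P + J * (Ks * Q) + M * Ks * (L * I)) +
        X * (Ks * J * P + Ks * (L * I)) := add_le_add (add_le_add (add_le_add t1 t2) u3) u4
    _ ≤ lowerOrderConst d ρ KG Ks M * SQ + lowerOrderConst d ρ KG Ks M * SP +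
        lowerOrderConst d ρ KG Ks M * (P + Q + I) := by
        rw [add_assoc _ (X * _) (X * _)]
        exact add_le_add (add_le_add f1 f2) (f4.trans f3)
    _ = _ := by ring

theorem ofReal_intervalIntegral_sq_le (hd : 0 < d) {f : ℝ → ℝ} (hf : IntegrableOn f (Ioo (-d) d))
    (h0 : ∀ β, 0 ≤ f β) : ENNReal.ofReal ((∫ β in (-d)..d, f β) ^ 2) ≤
      ENNReal.ofReal (2 * d) * ∫⁻ β in Ioo (-d) d, ENNReal.ofReal (f β ^ 2) := by
  have hle : -d ≤ d := by linarith
  have hi : 0 ≤ ∫ β in Ioo (-d) d, f β := integral_nonneg h0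
  rw [intervalIntegral.integral_of_le hle, integral_Ioc_eq_integral_Ioo, ENNReal.ofReal_pow hi,
    ofReal_integral_eq_lintegral_ofReal hf (Eventually.of_forall h0)]
  refine (lintegral_sq_le hf.aestronglyMeasurable.aemeasurable.ennreal_ofReal).trans (le_of_eq ?_)
  rw [Measure.restrict_apply_univ, Real.volume_Ioo]
  congr 1
  · ring_nf
  · exact lintegral_congr fun β => (ENNReal.ofReal_pow (h0 β) 2).symm

/-- The bound for the square of the difference of the lower order terms. -/
theorem ofReal_lowerOrder_sub_sq_le (hB : 0 < B) (ha : 0 < a) (hab : a < b) (hd : 0 < d) (hρ : 0 < ρ)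
    (hKG : 0 ≤ KG) (hKs : 0 ≤ Ks) (hM : 0 ≤ M) (H : UniformBounds B a b d ρ KG Ks M G μs p₁ q₁ p₂ q₂)
    {x : E (m + 1)} (hx : x ∈ closure (prism m B a b)) {α : ℝ} (hα : α ∈ Icc (-d) d)
    (gp₁ gq₁ gp₂ gq₂ : Fin (m + 1) → ℝ) :
    ENNReal.ofReal ((lowerOrder d G μs p₁ q₁ gp₁ gq₁ x α - lowerOrder d G μs p₂ q₂ gp₂ gq₂ x α) ^ 2) ≤
      ENNReal.ofReal (5 * lowerOrderConst d ρ KG Ks M ^ 2 * (m + 1 + 2 * d)) *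
      (ENNReal.ofReal ((p₁ x α - p₂ x α) ^ 2) + ∑ i, ENNReal.ofReal ((gp₁ i - gp₂ i) ^ 2) +
        (ENNReal.ofReal ((q₁ x α - q₂ x α) ^ 2) + ∑ i, ENNReal.ofReal ((gq₁ i - gq₂ i) ^ 2)) +
        ∫⁻ β in Ioo (-d) d, ENNReal.ofReal ((p₁ x β - p₂ x β) ^ 2)) := by
  have hC := lowerOrderConst_nonneg hd hρ hKG hKs hM
  have h := abs_lowerOrder_sub_le hB ha hab hd hρ hKG hKs hM H hx hα gp₁ gq₁ gp₂ gq₂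
  set C := lowerOrderConst d ρ KG Ks M
  set F := lowerOrder d G μs p₁ q₁ gp₁ gq₁ x α - lowerOrder d G μs p₂ q₂ gp₂ gq₂ x α
  have hI := ofReal_intervalIntegral_sq_le hd
    (((continuousOn_path H.cont_fst hx).sub (continuousOn_path H.cont_snd hx)).abs.integrableOn_Icc.mono_set
      Ioo_subset_Icc_self) fun _ => abs_nonneg _
  simp only [Pi.sub_apply, sq_abs] at hI
  set I := ∫ β in (-d)..d, |p₁ x β - p₂ x β|
  set Z := ∫⁻ β in Ioo (-d) d, ENNReal.ofReal ((p₁ x β - p₂ x β) ^ 2)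
  have hsum : ∀ f : Fin (m + 1) → ℝ, (∑ i, |f i|) ^ 2 ≤ (m + 1) * ∑ i, f i ^ 2 := fun f => by
    have := sq_sum_le_card_mul_sum_sq (s := Finset.univ) (f := fun i : Fin (m + 1) => |f i|)
    simpa using this
  have s1 := hsum fun i => gp₁ i - gp₂ i
  have s2 := hsum fun i => gq₁ i - gq₂ i
  set SP := ∑ i, |gp₁ i - gp₂ i|
  set SQ := ∑ i, |gq₁ i - gq₂ i|
  set P := p₁ x α - p₂ x α
  set Q := q₁ x α - q₂ x α
  -- The 5 comes from the Cauchy-Schwarz inequality for the five summands of the pointwise bound;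
  -- the dimension m + 1 comes from the two gradient sums.
  have h5 : F ^ 2 ≤ C ^ 2 * (5 * (SP ^ 2 + SQ ^ 2 + P ^ 2 + Q ^ 2 + I ^ 2)) := by
    have h1 : F ^ 2 ≤ (C * (SP + SQ + |P| + |Q| + I)) ^ 2 := sq_le_sq' (abs_le.1 h).1 (abs_le.1 h).2
    refine h1.trans ?_
    rw [mul_pow]
    refine mul_le_mul_of_nonneg_left ?_ (sq_nonneg _)
    rw [← sq_abs P, ← sq_abs Q]
    have := sq_sum_le_card_mul_sum_sq (s := Finset.univ) (f := ![SP, SQ, |P|, |Q|, I])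
    simpa [Fin.sum_univ_succ, add_assoc] using this
  have hm : (1 : ℝ) ≤ m + 1 := by have : (0 : ℝ) ≤ m := m.cast_nonneg
                                  linarith
  have h6 : F ^ 2 ≤ 5 * C ^ 2 * (m + 1) * (P ^ 2 + (∑ i, (gp₁ i - gp₂ i) ^ 2) +
      (Q ^ 2 + ∑ i, (gq₁ i - gq₂ i) ^ 2)) + 5 * C ^ 2 * I ^ 2 := by
    have hP : P ^ 2 ≤ (m + 1) * P ^ 2 := le_mul_of_one_le_left (sq_nonneg _) hm
    have hQ : Q ^ 2 ≤ (m + 1) * Q ^ 2 := le_mul_of_one_le_left (sq_nonneg _) hm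
    have := mul_le_mul_of_nonneg_left (add_le_add (add_le_add s1 s2) (add_le_add hP hQ))
      (by positivity : 0 ≤ 5 * C ^ 2)
    linarith
  set Y := P ^ 2 + (∑ i, (gp₁ i - gp₂ i) ^ 2) + (Q ^ 2 + ∑ i, (gq₁ i - gq₂ i) ^ 2) with hY
  have hYe : ENNReal.ofReal Y = ENNReal.ofReal (P ^ 2) + ∑ i, ENNReal.ofReal ((gp₁ i - gp₂ i) ^ 2) +
      (ENNReal.ofReal (Q ^ 2) + ∑ i, ENNReal.ofReal ((gq₁ i - gq₂ i) ^ 2)) := by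
    rw [hY, ENNReal.ofReal_add (by positivity) (by positivity),
      ENNReal.ofReal_add (by positivity) (by positivity),
      ENNReal.ofReal_add (by positivity) (by positivity),
      ENNReal.ofReal_sum_of_nonneg fun _ _ => sq_nonneg _,
      ENNReal.ofReal_sum_of_nonneg fun _ _ => sq_nonneg _]
  rw [← hYe, mul_add]
  have hY0 : 0 ≤ Y := by positivity
  refine (ENNReal.ofReal_le_ofReal h6).trans ?_
  rw [ENNReal.ofReal_add (by positivity) (by positivity), ENNReal.ofReal_mul (by positivity),
    ENNReal.ofReal_mul (p := 5 * C ^ 2) (q := I ^ 2) (by positivity)]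
  refine add_le_add (mul_le_mul_left (ENNReal.ofReal_le_ofReal ?_) _) ?_
  · have : 0 ≤ 5 * C ^ 2 * (2 * d) := by positivity
    linarith
  · refine (mul_le_mul_right hI _).trans ?_
    rw [← mul_assoc, ← ENNReal.ofReal_mul (by positivity)]
    refine mul_le_mul_left (ENNReal.ofReal_le_ofReal ?_) _
    have : 0 ≤ 5 * C ^ 2 * (m + 1) := by positivity
    linarith

end LowerOrder

/-! ### The difference of two solutions -/

section Difference

variable {m : ℕ} {B a b d ε ρ KG Ks M : ℝ} {G : E (m + 1) → ℝ → ℝ → ℝ} {μs : E (m + 1) → ℝ}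
  {p₁ q₁ p₂ q₂ : E (m + 1) → ℝ → ℝ}

/-- The difference of two solutions satisfies the hypotheses of the stability estimate. -/
theorem exists_admissible_sub (hB : 0 < B) (ha : 0 < a) (hab : a < b) (hd : 0 < d) (hε : 0 < ε)
    (hρ : 0 < ρ) (hKG : 0 ≤ KG) (hKs : 0 ≤ Ks) (hM : 0 ≤ M) {M' : ℝ}
    (H : UniformBounds B a b d ρ KG Ks M G μs p₁ q₁ p₂ q₂)
    (S₁ : IsSolutionPair B a b d ε M' G μs p₁ q₁) (S₂ : IsSolutionPair B a b d ε M' G μs p₂ q₂)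
    {α : ℝ} (hα : α ∈ Ioo (-d) d)
    (h0 : ∀ x ∈ frontier (prism m B a b) \ topFace m B b, p₁ x α = p₂ x α ∧ q₁ x α = q₂ x α) :
    ∃ gP hP gQ hQ : Fin (m + 1) → E (m + 1) → ℝ,
      IsAdmissible B a b (fun x => p₁ x α - p₂ x α) gP hP ∧
      IsAdmissible B a b (fun x => q₁ x α - q₂ x α) gQ hQ ∧
      LowerOrderBound B a b d ((ε⁻¹) ^ 2 * (5 * lowerOrderConst d ρ KG Ks M ^ 2 * (m + 1 + 2 * d)))
        (fun x => ∑ i, hP i x) (fun x => p₁ x α - p₂ x α) (fun x => q₁ x α - q₂ x α) gP gQ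
        (fun x β => p₁ x β - p₂ x β) ∧
      LowerOrderBound B a b d ((ε⁻¹) ^ 2 * (5 * lowerOrderConst d ρ KG Ks M ^ 2 * (m + 1 + 2 * d)))
        (fun x => ∑ i, hQ i x) (fun x => p₁ x α - p₂ x α) (fun x => q₁ x α - q₂ x α) gP gQ
        (fun x β => p₁ x β - p₂ x β) := by
  obtain ⟨Hp₁, Hq₁, Cp₁, Cq₁, -, -, E₁⟩ := S₁
  obtain ⟨Hp₂, Hq₂, Cp₂, Cq₂, -, -, E₂⟩ := S₂
  obtain ⟨gp₁, gq₁, hp₁, hq₁, a₁, b₁, c₁, d₁, e₁⟩ := E₁ α hα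
  obtain ⟨gp₂, gq₂, hp₂, hq₂, a₂, b₂, c₂, d₂, e₂⟩ := E₂ α hα
  have hα' := Ioo_subset_Icc_self hα
  have Lp₁ := memLp_of_h2NormSq_lt_top isOpen_prism (Hp₁.1 α hα') a₁ c₁
  have Lp₂ := memLp_of_h2NormSq_lt_top isOpen_prism (Hp₂.1 α hα') a₂ c₂
  have Lq₁ := memLp_of_h2NormSq_lt_top isOpen_prism (Hq₁.1 α hα') b₁ d₁
  have Lq₂ := memLp_of_h2NormSq_lt_top isOpen_prism (Hq₂.1 α hα') b₂ d₂
  refine ⟨fun i x => gp₁ i x - gp₂ i x, fun i x => hp₁ i x - hp₂ i x,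
    fun i x => gq₁ i x - gq₂ i x, fun i x => hq₁ i x - hq₂ i x, ?_, ?_, ?_, ?_⟩
  · exact ⟨(continuousOn_section Cp₁ hα').sub (continuousOn_section Cp₂ hα'),
      fun x hx => sub_eq_zero.2 (h0 x hx).1, a₁.sub a₂, fun i => (Lp₁.1 i).sub (Lp₂.1 i),
      fun i => (c₁ i).sub (c₂ i), fun i => (Lp₁.2 i).sub (Lp₂.2 i)⟩
  · exact ⟨(continuousOn_section Cq₁ hα').sub (continuousOn_section Cq₂ hα'),
      fun x hx => sub_eq_zero.2 (h0 x hx).2, b₁.sub b₂, fun i => (Lq₁.1 i).sub (Lq₂.1 i),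
      fun i => (d₁ i).sub (d₂ i), fun i => (Lq₁.2 i).sub (Lq₂.2 i)⟩
  -- The two equations share the operator S, so ε times the Laplacian of either difference is the
  -- difference of the two values of S. One bound, scaled by ε⁻², serves both.
  all_goals
    filter_upwards [e₁, e₂, ae_restrict_mem measurableSet_prism] with x h₁ h₂ hx
    have hb := ofReal_lowerOrder_sub_sq_le hB ha hab hd hρ hKG hKs hM H (subset_closure hx) hα'
      (fun i => gp₁ i x) (fun i => gq₁ i x) (fun i => gp₂ i x) (fun i => gq₂ i x)
    rw [ENNReal.ofReal_mul (sq_nonneg _), mul_assoc]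
    refine le_trans (le_of_eq ?_) (mul_le_mul_right hb _)
    rw [← ENNReal.ofReal_mul (sq_nonneg _), ← mul_pow, Finset.sum_sub_distrib]
    congr 2
    field_simp
    linarith [h₁.1, h₁.2, h₂.1, h₂.2]

/-- The prescribed bounds are arbitrary reals. Passing to absolute values weakens them and makes
them nonnegative, as the constants require. -/
theorem UniformBounds.of_isSolutionPair {Ks' KG' M' : ℝ}
    (hρ : ∀ x ∈ closure (prism m B a b), ∀ α ∈ Icc (-d) d, ρ ≤ ‖x - source m α‖)
    (hG : KernelRegular B b d G) (hKG : KernelNormLE B a b d G KG')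
    (hKs : SupNormLE (closure (prism m B a b)) μs Ks')
    (S₁ : IsSolutionPair B a b d ε M' G μs p₁ q₁) (S₂ : IsSolutionPair B a b d ε M' G μs p₂ q₂) :
    UniformBounds B a b d ρ |KG'| |Ks'| |M'| G μs p₁ q₁ p₂ q₂ := by
  obtain ⟨-, -, Cp₁, Cq₁, Np₁, Nq₁, -⟩ := S₁
  obtain ⟨-, -, Cp₂, Cq₂, Np₂, Nq₂, -⟩ := S₂
  have le : ∀ {s t : ℝ}, s ≤ t → s ≤ |t| := fun h => h.trans (le_abs_self _)
  exact ⟨hρ, hG, fun x hx α hα β hβ => ⟨le (hKG x hx α hα β hβ).1, le (hKG x hx α hα β hβ).2.1,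
    le (hKG x hx α hα β hβ).2.2⟩, fun x hx => le (hKs x hx), Cp₁, Cp₂,
    fun x hx α hα => ⟨le (Np₁ (x, α) ⟨hx, hα⟩), le (Nq₁ (x, α) ⟨hx, hα⟩)⟩,
    fun x hx α hα => ⟨le (Np₂ (x, α) ⟨hx, hα⟩), le (Nq₂ (x, α) ⟨hx, hα⟩)⟩⟩

/-! ### The reconstructed coefficient -/

theorem measurable_nu_coord (x : E (m + 1)) (i : Fin (m + 1)) : Measurable fun α => nu x α i := by
  have h1 : Measurable fun α => x - source m α :=
    (continuous_const.sub continuous_source).measurable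
  have h2 : Measurable fun α => nu x α := h1.norm.inv.smul h1
  have h3 : Continuous fun y : E (m + 1) => y i := by fun_prop
  exact h3.measurable.comp h2

/-- Dominated convergence with the constant bound KG e^M; this supplies the integrability in α of
the scattering term of the reconstruction. -/
theorem continuousOn_kernel_integral (hd : 0 < d) (ha : 0 < a) (hG : KernelRegular B b d G)
    (hK : KernelNormLE B a b d G KG) {p : E (m + 1) → ℝ → ℝ}
    (hp : ContinuousOn (Function.uncurry p) (closure (prism m B a b) ×ˢ Icc (-d) d))
    (hM : ∀ x ∈ closure (prism m B a b), ∀ α ∈ Icc (-d) d, |p x α| ≤ M) {x : E (m + 1)}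
    (hx : x ∈ closure (prism m B a b)) :
    ContinuousOn (fun α => ∫ β in (-d)..d, G x α β * Real.exp (p x β)) (Icc (-d) d) := by
  have hle : -d ≤ d := by linarith
  have hx' := closure_prism_subset_closure_bigPrism (d := d) ha hx
  simp only [intervalIntegral.integral_of_le hle]
  refine continuousOn_of_dominated (bound := fun _ => KG * Real.exp M) ?_ ?_ (integrable_const _) ?_
  · intro α hα
    exact (((hG.continuousOn_kernel hx' hα).mul (continuousOn_path hp hx).rexp).mono
      Ioc_subset_Icc_self).aestronglyMeasurable measurableSet_Ioc
  · intro α hα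
    filter_upwards [ae_restrict_mem measurableSet_Ioc] with β hβ
    have hβ' := Ioc_subset_Icc_self hβ
    rw [norm_mul, Real.norm_eq_abs, Real.norm_eq_abs, Real.abs_exp]
    have hK' := (hK x hx α hα β hβ').1
    exact mul_le_mul hK' (Real.exp_le_exp.2 ((le_abs_self _).trans (hM x hx β hβ')))
      (Real.exp_pos _).le ((abs_nonneg _).trans hK')
  · filter_upwards [ae_restrict_mem measurableSet_Ioc] with β hβ
    have hc : Continuous fun α : ℝ => ((x, α, β) : E (m + 1) × ℝ × ℝ) := by fun_prop
    have h := hG.continuousOn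
    exact (h.comp hc.continuousOn fun α hα => ⟨hx', hα, Ioc_subset_Icc_self hβ⟩).mul
      continuousOn_const

/-- A jointly measurable gradient along a path in `H²` is integrable. -/
theorem integrable_uncurry_gradient {p : E (m + 1) → ℝ → ℝ} (hp : IsH2Path (prism m B a b) d p)
    {V : Fin (m + 1) → E (m + 1) → ℝ → ℝ}
    (hV : ∀ i, AEStronglyMeasurable (Function.uncurry (V i))
      ((volume.restrict (prism m B a b)).prod (volume.restrict (Ioo (-d) d))))
    (hg : ∀ᵐ α ∂(volume.restrict (Ioo (-d) d)),
      HasWeakGrad (prism m B a b) (fun x => p x α) (fun i x => V i x α)) (i : Fin (m + 1)) :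
    Integrable (Function.uncurry (V i))
      ((volume.restrict (prism m B a b)).prod (volume.restrict (Ioo (-d) d))) := by
  -- Continuity of the path into H² bounds the slice norms uniformly in α, hence the L² norm on the
  -- product.
  obtain ⟨C, hC, hb⟩ := hp.exists_bound isOpen_prism
  have hL : MemLp (Function.uncurry (V i)) 2
      ((volume.restrict (prism m B a b)).prod (volume.restrict (Ioo (-d) d))) := by
    rw [memLp_two_iff_integrable_sq (hV i)]
    refine ⟨(hV i).pow 2, ?_⟩
    unfold HasFiniteIntegral
    have hm : AEMeasurable (fun y => ‖Function.uncurry (V i) y ^ 2‖ₑ)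
        ((volume.restrict (prism m B a b)).prod (volume.restrict (Ioo (-d) d))) :=
      ((hV i).pow 2).enorm
    refine (lintegral_prod_symm _ hm).trans_lt ?_
    calc ∫⁻ α in Ioo (-d) d, ∫⁻ x in prism m B a b, ‖Function.uncurry (V i) (x, α) ^ 2‖ₑ
        ≤ ∫⁻ α in Ioo (-d) d, C := by
          refine lintegral_mono_ae ?_
          filter_upwards [hg, ae_restrict_mem measurableSet_Ioo] with α h hα
          have := hb α (Ioo_subset_Icc_self hα) _ h
          simp only [enorm_pow, Function.uncurry]
          exact (Finset.single_le_sum (f := fun i => l2NormSq (prism m B a b) fun x => V i x α)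
            (fun _ _ => zero_le) (Finset.mem_univ i)).trans this
      _ < ⊤ := by
          rw [setLIntegral_const, Real.volume_Ioo]
          exact ENNReal.mul_lt_top hC.lt_top ENNReal.ofReal_lt_top
  exact hL.integrable (by norm_num)

/-- The Lipschitz constant of the reconstruction. -/
def reconstructionConst (d KG Ks M : ℝ) : ℝ :=
  1 / (2 * d) * (1 + 2 * (Real.exp M * (Ks * (KG * Real.exp M * (2 * d)))))

/-- The pointwise bound for the difference of two reconstructions. -/
theorem abs_reconstruction_sub_le (ha : 0 < a) (hd : 0 < d)
    (hKG : 0 ≤ KG) (hKs : 0 ≤ Ks) (H : UniformBounds B a b d ρ KG Ks M G μs p₁ q₁ p₂ q₂)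
    {x : E (m + 1)} (hx : x ∈ closure (prism m B a b)) {v₁ v₂ : Fin (m + 1) → ℝ → ℝ}
    (h₁ : ∀ i, IntegrableOn (v₁ i) (Ioo (-d) d)) (h₂ : ∀ i, IntegrableOn (v₂ i) (Ioo (-d) d)) :
    |(-(1 / (2 * d)) * (∫ α in (-d)..d, ∑ i, nu x α i * v₁ i α) + 1 / (2 * d) * ∫ α in (-d)..d,
        Real.exp (-p₁ x α) * (μs x * ∫ β in (-d)..d, G x α β * Real.exp (p₁ x β))) -
      (-(1 / (2 * d)) * (∫ α in (-d)..d, ∑ i, nu x α i * v₂ i α) + 1 / (2 * d) * ∫ α in (-d)..d,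
        Real.exp (-p₂ x α) * (μs x * ∫ β in (-d)..d, G x α β * Real.exp (p₂ x β)))| ≤
      reconstructionConst d KG Ks M *
        ∫ α in (-d)..d, ((∑ i, |v₁ i α - v₂ i α|) + |p₁ x α - p₂ x α|) := by
  have hle : -d ≤ d := by linarith
  have hx' := closure_prism_subset_closure_bigPrism (d := d) ha hx
  have c1 := continuousOn_path H.cont_fst hx
  have c2 := continuousOn_path H.cont_snd hx
  have hv : ∀ {v : Fin (m + 1) → ℝ → ℝ}, (∀ i, IntegrableOn (v i) (Ioo (-d) d)) →
      IntervalIntegrable (fun α => ∑ i, nu x α i * v i α) volume (-d) d := fun h => by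
    rw [intervalIntegrable_iff_integrableOn_Ioo_of_le hle]
    exact integrable_finsetSum _ fun i _ => (h i).bdd_mul (c := 1)
      (measurable_nu_coord x i).aestronglyMeasurable
      (Eventually.of_forall fun α => (abs_coord_le_norm _ i).trans (norm_nu_le x α))
  have hS : IntervalIntegrable (fun α => ∑ i, |v₁ i α - v₂ i α|) volume (-d) d := by
    rw [intervalIntegrable_iff_integrableOn_Ioo_of_le hle]
    exact integrable_finsetSum _ fun i _ => ((h₁ i).sub (h₂ i)).abs
  have hPc : ContinuousOn (fun α => |p₁ x α - p₂ x α|) (Icc (-d) d) := (c1.sub c2).abs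
  have hP : IntervalIntegrable (fun α => |p₁ x α - p₂ x α|) volume (-d) d :=
    ContinuousOn.intervalIntegrable (by rwa [uIcc_of_le hle])
  have hf : ∀ {p : E (m + 1) → ℝ → ℝ},
      ContinuousOn (Function.uncurry p) (closure (prism m B a b) ×ˢ Icc (-d) d) →
      (∀ x ∈ closure (prism m B a b), ∀ α ∈ Icc (-d) d, |p x α| ≤ M) →
      IntervalIntegrable (fun α => Real.exp (-p x α) *
        (μs x * ∫ β in (-d)..d, G x α β * Real.exp (p x β))) volume (-d) d := fun hp hM =>
    ContinuousOn.intervalIntegrable (by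
      rw [uIcc_of_le hle]
      exact (continuousOn_path hp hx).neg.rexp.mul (continuousOn_const.mul
        (continuousOn_kernel_integral hd ha H.regular H.kernel hp hM hx)))
  have b1 : ∀ x ∈ closure (prism m B a b), ∀ β ∈ Icc (-d) d, |p₁ x β| ≤ M :=
    fun x hx β hβ => (H.fst x hx β hβ).1
  have b2 : ∀ x ∈ closure (prism m B a b), ∀ β ∈ Icc (-d) d, |p₂ x β| ≤ M :=
    fun x hx β hβ => (H.snd x hx β hβ).1
  have T1 : |(∫ α in (-d)..d, ∑ i, nu x α i * v₁ i α) - ∫ α in (-d)..d, ∑ i, nu x α i * v₂ i α| ≤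
      ∫ α in (-d)..d, ∑ i, |v₁ i α - v₂ i α| := by
    rw [← intervalIntegral.integral_sub (hv h₁) (hv h₂)]
    refine (intervalIntegral.abs_integral_le_integral_abs hle).trans
      (intervalIntegral.integral_mono_on hle ((hv h₁).sub (hv h₂)).abs hS fun α hα => ?_)
    rw [← Finset.sum_sub_distrib]
    simp only [← mul_sub]
    simpa using abs_sum_mul_le (nu x α) (norm_nu_le x α) fun i => v₁ i α - v₂ i α
  set J := KG * Real.exp M * (2 * d) with hJ
  set I := ∫ α in (-d)..d, |p₁ x α - p₂ x α| with hI
  have T2 : |(∫ α in (-d)..d,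
        Real.exp (-p₁ x α) * (μs x * ∫ β in (-d)..d, G x α β * Real.exp (p₁ x β))) -
      ∫ α in (-d)..d,
        Real.exp (-p₂ x α) * (μs x * ∫ β in (-d)..d, G x α β * Real.exp (p₂ x β))| ≤
      2 * (Real.exp M * (Ks * J)) * I := by
    rw [← intervalIntegral.integral_sub (hf H.cont_fst b1) (hf H.cont_snd b2)]
    have hbd : IntervalIntegrable (fun α => Real.exp M * (Ks * J) * |p₁ x α - p₂ x α| +
        Real.exp M * (Ks * (KG * Real.exp M * I))) volume (-d) d :=
      (hP.const_mul _).add intervalIntegrable_const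
    -- Integrating in α, the local term gives J times the integral I of |p₁ - p₂|, and the nonlocal
    -- term, constant in α, gives KG e^M · 2d = J times I again. Hence the factor 2.
    have hval : ∫ α in (-d)..d, (Real.exp M * (Ks * J) * |p₁ x α - p₂ x α| +
        Real.exp M * (Ks * (KG * Real.exp M * I))) = 2 * (Real.exp M * (Ks * J)) * I := by
      rw [intervalIntegral.integral_add (hP.const_mul _) intervalIntegrable_const,
        intervalIntegral.integral_const_mul, intervalIntegral.integral_const, smul_eq_mul, hJ]
      ring
    rw [← hval]
    refine (intervalIntegral.abs_integral_le_integral_abs hle).trans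
      (intervalIntegral.integral_mono_on hle ((hf H.cont_fst b1).sub (hf H.cont_snd b2)).abs hbd
        fun α hα => ?_)
    have k1 := H.regular.continuousOn_kernel hx' hα
    have n1 : ∀ β ∈ Icc (-d) d, |G x α β| ≤ KG := fun β hβ => (H.kernel x hx α hα β hβ).1
    have hs := H.scattering x hx
    have t := abs_exp_mul_sub_le (b1 x hx α hα) (b2 x hx α hα) hs hs
      (abs_integral_kernel_le hd n1 (b1 x hx)) (J₂ := ∫ β in (-d)..d, G x α β * Real.exp (p₂ x β))
    have i := abs_integral_kernel_sub_le hd k1 c1 c2 n1 (b1 x hx) (b2 x hx)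
    rw [sub_self, abs_zero, mul_zero, add_zero] at t
    rw [← mul_assoc, ← mul_assoc]
    refine t.trans ?_
    rw [mul_assoc (Real.exp M), ← mul_add]
    gcongr
  rw [intervalIntegral.integral_add hS hP, ← hI]
  have hS0 : 0 ≤ ∫ α in (-d)..d, ∑ i, |v₁ i α - v₂ i α| :=
    intervalIntegral.integral_nonneg hle fun _ _ => Finset.sum_nonneg fun _ _ => abs_nonneg _
  have hI0 : 0 ≤ I := intervalIntegral.integral_nonneg hle fun _ _ => abs_nonneg _
  set S := ∫ α in (-d)..d, ∑ i, |v₁ i α - v₂ i α|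
  set X := Real.exp M * (Ks * J) with hX
  have hX0 : 0 ≤ X := by positivity
  have alg : ∀ s t u v : ℝ, |(-(1 / (2 * d)) * s + 1 / (2 * d) * t) -
      (-(1 / (2 * d)) * u + 1 / (2 * d) * v)| ≤ 1 / (2 * d) * (|s - u| + |t - v|) := by
    intro s t u v
    have e : (-(1 / (2 * d)) * s + 1 / (2 * d) * t) - (-(1 / (2 * d)) * u + 1 / (2 * d) * v) =
        1 / (2 * d) * ((t - v) - (s - u)) := by ring
    rw [e, abs_mul, abs_of_pos (by positivity : 0 < 1 / (2 * d)), add_comm]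
    exact mul_le_mul_of_nonneg_left (abs_sub _ _) (by positivity)
  refine (alg _ _ _ _).trans ?_
  rw [reconstructionConst, ← hJ, ← hX, mul_assoc]
  refine mul_le_mul_of_nonneg_left ((add_le_add T1 T2).trans ?_) (by positivity)
  nlinarith [mul_nonneg hX0 hS0]

/-- The reconstructed coefficients depend Lipschitz continuously on the solutions. -/
theorem exists_reconstruction_bound (ha : 0 < a) (hd : 0 < d)
    (hKG : 0 ≤ KG) (hKs : 0 ≤ Ks) (H : UniformBounds B a b d ρ KG Ks M G μs p₁ q₁ p₂ q₂)
    (hp₁ : IsH2Path (prism m B a b) d p₁) (hp₂ : IsH2Path (prism m B a b) d p₂)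
    {A₁ A₂ : E (m + 1) → ℝ} (R₁ : IsReconstruction B a b d G μs p₁ A₁)
    (R₂ : IsReconstruction B a b d G μs p₂ A₂) :
    ∃ f : E (m + 1) → ℝ≥0∞, AEMeasurable f (volume.restrict (prism m B a b)) ∧
      (∀ᵐ x ∂(volume.restrict (prism m B a b)), ‖A₁ x - A₂ x‖ₑ ^ 2 ≤ f x) ∧
      ∫⁻ x in prism m B a b, f x ≤
        ENNReal.ofReal (reconstructionConst d KG Ks M ^ 2 * (2 * d) * (m + 2)) *
        ∫⁻ α in Ioo (-d) d, h1NormSq (prism m B a b) (fun x => p₁ x α - p₂ x α) := by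
  obtain ⟨V₁, hV₁, g₁, e₁⟩ := R₁
  obtain ⟨V₂, hV₂, g₂, e₂⟩ := R₂
  have hle : -d ≤ d := by linarith
  set ν := (volume.restrict (prism m B a b)).prod (volume.restrict (Ioo (-d) d))
  have mP : AEMeasurable (fun y : E (m + 1) × ℝ => ENNReal.ofReal ((p₁ y.1 y.2 - p₂ y.1 y.2) ^ 2)) ν :=
    (((aemeasurable_uncurry H.cont_fst).sub (aemeasurable_uncurry H.cont_snd)).pow_const
      2).ennreal_ofReal
  have mV : ∀ i, AEMeasurable
      (fun y : E (m + 1) × ℝ => ENNReal.ofReal ((V₁ i y.1 y.2 - V₂ i y.1 y.2) ^ 2)) ν := fun i =>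
    (((hV₁ i).aemeasurable.sub (hV₂ i).aemeasurable).pow_const 2).ennreal_ofReal
  have mF : AEMeasurable (fun y : E (m + 1) × ℝ => ENNReal.ofReal ((p₁ y.1 y.2 - p₂ y.1 y.2) ^ 2) +
      ∑ i, ENNReal.ofReal ((V₁ i y.1 y.2 - V₂ i y.1 y.2) ^ 2)) ν :=
    mP.add (Finset.aemeasurable_fun_sum _ fun i _ => mV i)
  set F : E (m + 1) → ℝ → ℝ≥0∞ := fun x α => ENNReal.ofReal ((p₁ x α - p₂ x α) ^ 2) +
      ∑ i, ENNReal.ofReal ((V₁ i x α - V₂ i x α) ^ 2) with hF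
  have hm0 : (0 : ℝ) ≤ m := m.cast_nonneg
  -- Nothing is assumed about the measurability of the reconstructed coefficients. The explicit
  -- majorant is measurable, so its vanishing integral can later be turned into vanishing almost
  -- everywhere.
  refine ⟨fun x => ENNReal.ofReal (reconstructionConst d KG Ks M ^ 2 * (2 * d) * (m + 2)) *
    ∫⁻ α in Ioo (-d) d, F x α, mF.lintegral_prod_right'.const_mul _, ?_, ?_⟩
  · have i₁ : ∀ᵐ x ∂(volume.restrict (prism m B a b)), ∀ i, IntegrableOn (V₁ i x) (Ioo (-d) d) :=
      ae_all_iff.2 fun i => (integrable_uncurry_gradient hp₁ hV₁ g₁ i).prod_right_ae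
    have i₂ : ∀ᵐ x ∂(volume.restrict (prism m B a b)), ∀ i, IntegrableOn (V₂ i x) (Ioo (-d) d) :=
      ae_all_iff.2 fun i => (integrable_uncurry_gradient hp₂ hV₂ g₂ i).prod_right_ae
    filter_upwards [e₁, e₂, i₁, i₂, ae_restrict_mem measurableSet_prism] with x e₁ e₂ i₁ i₂ hx
    have hx := subset_closure hx
    have key := abs_reconstruction_sub_le ha hd hKG hKs H hx i₁ i₂
    rw [← e₁, ← e₂] at key
    set c := reconstructionConst d KG Ks M
    set S : ℝ → ℝ := fun α => (∑ i, |V₁ i x α - V₂ i x α|) + |p₁ x α - p₂ x α| with hS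
    have hSi : IntegrableOn S (Ioo (-d) d) :=
      (integrable_finsetSum _ fun i _ => ((i₁ i).sub (i₂ i)).abs).add
        (((continuousOn_path H.cont_fst hx).sub
          (continuousOn_path H.cont_snd hx)).abs.integrableOn_Icc.mono_set Ioo_subset_Icc_self)
    have hS0 : ∀ α, 0 ≤ S α := fun α =>
      add_nonneg (Finset.sum_nonneg fun _ _ => abs_nonneg _) (abs_nonneg _)
    have hsq := ofReal_intervalIntegral_sq_le hd hSi hS0
    have hSF : ∀ α, ENNReal.ofReal (S α ^ 2) ≤ ENNReal.ofReal (m + 2) * F x α := fun α => by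
      have h2 : F x α = ENNReal.ofReal ((p₁ x α - p₂ x α) ^ 2 + ∑ i, (V₁ i x α - V₂ i x α) ^ 2) := by
        rw [ENNReal.ofReal_add (by positivity) (by positivity),
          ENNReal.ofReal_sum_of_nonneg fun _ _ => sq_nonneg _]
      rw [h2, ← ENNReal.ofReal_mul (by positivity)]
      apply ENNReal.ofReal_le_ofReal
      have h3 := sq_sum_le_card_mul_sum_sq (s := Finset.univ)
        (f := (Fin.cons |p₁ x α - p₂ x α| fun i => |V₁ i x α - V₂ i x α| : Fin (m + 2) → ℝ))
      simp only [Fin.sum_univ_succ (n := m + 1), Fin.cons_zero, Fin.cons_succ, sq_abs,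
        Finset.card_univ, Fintype.card_fin] at h3
      have h5 : S α = |p₁ x α - p₂ x α| + ∑ i, |V₁ i x α - V₂ i x α| := add_comm _ _
      rw [h5]
      push_cast at h3
      refine h3.trans (le_of_eq ?_)
      ring
    rw [enorm_sq_eq_ofReal]
    have h4 : (A₁ x - A₂ x) ^ 2 ≤ c ^ 2 * (∫ α in (-d)..d, S α) ^ 2 := by
      rw [← mul_pow]
      exact sq_le_sq' (abs_le.1 key).1 (abs_le.1 key).2
    refine (ENNReal.ofReal_le_ofReal h4).trans ?_
    rw [ENNReal.ofReal_mul (sq_nonneg _), ENNReal.ofReal_mul (by positivity),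
      ENNReal.ofReal_mul (sq_nonneg _), mul_assoc, mul_assoc]
    refine mul_le_mul_right (hsq.trans (mul_le_mul_right ?_ _)) _
    rw [← lintegral_const_mul' _ _ ENNReal.ofReal_ne_top]
    exact lintegral_mono hSF
  · rw [lintegral_const_mul' _ _ ENNReal.ofReal_ne_top, lintegral_lintegral_swap mF]
    refine mul_le_mul_right (lintegral_mono_ae ?_) _
    filter_upwards [g₁, g₂, ae_restrict_mem measurableSet_Ioo] with α g₁ g₂ hα
    have hα' := Ioo_subset_Icc_self hα
    have hg := g₁.sub g₂
    unfold h1NormSq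
    -- Any gradient competing in the H¹ infimum agrees almost everywhere with the slice of V₁ - V₂,
    -- so the choice of version is immaterial.
    refine le_iInf fun v => le_iInf fun hv => ?_
    have hm : AEMeasurable (fun x => ENNReal.ofReal ((p₁ x α - p₂ x α) ^ 2))
        (volume.restrict (prism m B a b)) :=
      (((memLp_of_continuousOn_closure ((continuousOn_section H.cont_fst hα').sub
        (continuousOn_section H.cont_snd hα'))).1.aemeasurable).pow_const 2).ennreal_ofReal
    simp only [hF]
    rw [lintegral_add_left' hm, lintegral_finsetSum' _ fun i _ =>
      ((hg i).aestronglyMeasurable.aemeasurable.pow_const 2).ennreal_ofReal]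
    refine add_le_add (le_of_eq ?_) (Finset.sum_le_sum fun i _ => le_of_eq ?_)
    · simp only [l2NormSq, enorm_sq_eq_ofReal]
    · rw [l2NormSq_congr (hv.ae_unique isOpen_prism hg i)]
      simp only [l2NormSq, enorm_sq_eq_ofReal]

end Difference

/-! ### Lipschitz stability -/

section Stability

variable {m : ℕ} {B a b d : ℝ}

/-- Subadditivity of the square root passes from squared norms to the sums of norms in the
statement. -/
theorem rpow_half_le_of_le {X d₁ n₁ d₂ n₂ : ℝ≥0∞} {k c : ℝ} (hk : 0 ≤ k) (hc : √k ≤ c)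
    (h : X ≤ ENNReal.ofReal k * ((d₁ + n₁) + (d₂ + n₂))) :
    X ^ (1 / 2 : ℝ) ≤ ENNReal.ofReal c * (d₁ ^ (1 / 2 : ℝ) + n₁ ^ (1 / 2 : ℝ)) +
      ENNReal.ofReal c * (d₂ ^ (1 / 2 : ℝ) + n₂ ^ (1 / 2 : ℝ)) := by
  have add : ∀ s t : ℝ≥0∞, (s + t) ^ (1 / 2 : ℝ) ≤ s ^ (1 / 2 : ℝ) + t ^ (1 / 2 : ℝ) := fun s t =>
    ENNReal.rpow_add_le_add_rpow s t (by norm_num) (by norm_num)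
  have hk' : ENNReal.ofReal k ^ (1 / 2 : ℝ) ≤ ENNReal.ofReal c := by
    rw [ENNReal.ofReal_rpow_of_nonneg hk (by norm_num), ← Real.sqrt_eq_rpow]
    exact ENNReal.ofReal_le_ofReal hc
  rw [← mul_add]
  refine (ENNReal.rpow_le_rpow h (by norm_num)).trans ?_
  rw [ENNReal.mul_rpow_of_nonneg _ _ (by norm_num)]
  exact mul_le_mul' hk' ((add _ _).trans (add_le_add (add _ _) (add _ _)))

/-- The integrated form of the stability estimate. -/
theorem lintegral_h1NormSq_le (hB : 0 < B) (hab : a < b) (hd : 0 < d) {C : ℝ} (hC : 0 < C)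
    {P Q : E (m + 1) → ℝ → ℝ}
    (hP : ContinuousOn (Function.uncurry P) (closure (prism m B a b) ×ˢ Icc (-d) d))
    (hQ : ContinuousOn (Function.uncurry Q) (closure (prism m B a b) ×ˢ Icc (-d) d))
    (AP : ∀ α ∈ Ioo (-d) d, ∃ g h, IsAdmissible B a b (fun x => P x α) g h)
    (AQ : ∀ α ∈ Ioo (-d) d, ∃ g h, IsAdmissible B a b (fun x => Q x α) g h)
    (h : ∀ α ∈ Ioo (-d) d,
        h1NormSq (prism m B a b) (fun x => P x α) + h1NormSq (prism m B a b) (fun x => Q x α) ≤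
        ENNReal.ofReal C * (∫⁻ β in Ioo (-d) d,
          (topData B a b (fun x => P x β) + topData B a b (fun x => Q x β))) +
        ENNReal.ofReal C * (topData B a b (fun x => P x α) + topData B a b (fun x => Q x α))) :
    ∫⁻ α in Ioo (-d) d,
        (h1NormSq (prism m B a b) (fun x => P x α) + h1NormSq (prism m B a b) (fun x => Q x α)) ≤
      ENNReal.ofReal (C * (2 * d + 1) * (2 * B) ^ m) *
        (((∫⁻ α in Ioo (-d) d, dirichletNormSq B b (fun x => P x α)) +
          ∫⁻ α in Ioo (-d) d, neumannNormSq B a b (fun x => P x α)) +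
        ((∫⁻ α in Ioo (-d) d, dirichletNormSq B b (fun x => Q x α)) +
          ∫⁻ α in Ioo (-d) d, neumannNormSq B a b (fun x => Q x α))) := by
  obtain ⟨mP, bP⟩ := aemeasurable_topData_path hB hab hP AP
  obtain ⟨-, bQ⟩ := aemeasurable_topData_path hB hab hQ AQ
  refine (setLIntegral_mono' measurableSet_Ioo h).trans ?_
  rw [lintegral_add_left measurable_const, setLIntegral_const, Real.volume_Ioo,
    lintegral_const_mul' _ _ ENNReal.ofReal_ne_top, lintegral_add_left' mP,
    ENNReal.ofReal_mul (by positivity), ENNReal.ofReal_mul hC.le,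
    ENNReal.ofReal_add (by positivity) (by norm_num), show d - -d = 2 * d by ring,
    ENNReal.ofReal_one]
  calc _ = ENNReal.ofReal C * (ENNReal.ofReal (2 * d) + 1) *
        ((∫⁻ α in Ioo (-d) d, topData B a b (fun x => P x α)) +
          ∫⁻ α in Ioo (-d) d, topData B a b (fun x => Q x α)) := by ring
    _ ≤ _ := mul_le_mul_right (add_le_add bP bQ) _
    _ = _ := by ring

/-- Continuity upgrades equality almost everywhere to equality at every point of the open prism. -/
theorem eqOn_prism_of_l2NormSq_eq_zero {u v : E (m + 1) → ℝ}
    (hu : ContinuousOn u (closure (prism m B a b))) (hv : ContinuousOn v (closure (prism m B a b)))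
    (h : l2NormSq (prism m B a b) (fun x => u x - v x) = 0) : EqOn u v (prism m B a b) := by
  have hm := (memLp_of_continuousOn_closure (hu.sub hv)).1.enorm.pow_const 2
  have h' := (lintegral_eq_zero_iff' hm).1 h
  refine Measure.eqOn_open_of_ae_eq (μ := volume) ?_ isOpen_prism (hu.mono subset_closure)
    (hv.mono subset_closure)
  filter_upwards [h'] with x hx
  simpa [sub_eq_zero] using hx

end Stability

end
end RTEStability

/-! ### Stability, reconstruction and uniqueness: the theorem. -/

open RTEStability

theorem theorem4p1 (m : ℕ) (B a b d ε : ℝ) (hB : 0 < B) (ha : 0 < a) (hab : a < b) (hd : 0 < d)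
    (hsource : Disjoint (RTEStability.sourceLine m d) (closure (RTEStability.prism m B a b)))
    (hε : 0 < ε) (KG Ka Ks M : ℝ) :
    ∃ C₁ : ℝ, 0 < C₁ ∧
      ∀ (G : RTEStability.E (m + 1) → ℝ → ℝ → ℝ) (μa μs : RTEStability.E (m + 1) → ℝ)
        (p₁ q₁ p₂ q₂ : RTEStability.E (m + 1) → ℝ → ℝ),
        RTEStability.KernelRegular B b d G →
        RTEStability.CoefficientAdmissible B a b d μa →
        RTEStability.CoefficientAdmissible B a b d μs →
        RTEStability.KernelNormLE B a b d G KG →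
        RTEStability.SupNormLE (closure (RTEStability.prism m B a b)) μa Ka →
        RTEStability.SupNormLE (closure (RTEStability.prism m B a b)) μs Ks →
        RTEStability.IsSolutionPair B a b d ε M G μs p₁ q₁ →
        RTEStability.IsSolutionPair B a b d ε M G μs p₂ q₂ →
        (∀ x ∈ frontier (RTEStability.prism m B a b) \ RTEStability.topFace m B b,
          ∀ α ∈ Set.Ioo (-d) d, p₁ x α = p₂ x α ∧ q₁ x α = q₂ x α) →
        -- the stability estimate for the solutions
        RTEStability.pairNorm B a b d (p₁ - p₂) (q₁ - q₂) ≤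
            ENNReal.ofReal C₁ * RTEStability.cauchyDataNorm B a b d (p₁ - p₂) +
            ENNReal.ofReal C₁ * RTEStability.cauchyDataNorm B a b d (q₁ - q₂) ∧
        -- the stability estimate for the reconstructed attenuation coefficients
        (∀ A₁ A₂ : RTEStability.E (m + 1) → ℝ,
          RTEStability.IsReconstruction B a b d G μs p₁ A₁ →
          RTEStability.IsReconstruction B a b d G μs p₂ A₂ →
          MeasureTheory.eLpNorm (A₁ - A₂) 2
              (MeasureTheory.volume.restrict (RTEStability.prism m B a b)) ≤
            ENNReal.ofReal C₁ * RTEStability.cauchyDataNorm B a b d (p₁ - p₂) +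
            ENNReal.ofReal C₁ * RTEStability.cauchyDataNorm B a b d (q₁ - q₂)) ∧
        -- uniqueness, if the Dirichlet and Neumann data on the top face coincide as well
        ((∀ x ∈ RTEStability.topFace m B b, ∀ α ∈ Set.Ioo (-d) d,
            p₁ x α = p₂ x α ∧ q₁ x α = q₂ x α) →
          (∀ α ∈ Set.Ioo (-d) d,
            (∃ g, RTEStability.IsTopNormalDeriv B a b (fun x => p₁ x α) g ∧
              RTEStability.IsTopNormalDeriv B a b (fun x => p₂ x α) g) ∧
            ∃ g, RTEStability.IsTopNormalDeriv B a b (fun x => q₁ x α) g ∧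
              RTEStability.IsTopNormalDeriv B a b (fun x => q₂ x α) g) →
          (∀ x ∈ RTEStability.prism m B a b, ∀ α ∈ Set.Ioo (-d) d,
            p₁ x α = p₂ x α ∧ q₁ x α = q₂ x α) ∧
          ∀ A₁ A₂ : RTEStability.E (m + 1) → ℝ,
            RTEStability.IsReconstruction B a b d G μs p₁ A₁ →
            RTEStability.IsReconstruction B a b d G μs p₂ A₂ →
            ∀ᵐ x ∂(MeasureTheory.volume.restrict (RTEStability.prism m B a b)),
              A₁ x = A₂ x) := by
  -- Everything entering the constant is fixed before the kernel, the coefficients and the solutions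
  -- are introduced.
  obtain ⟨ρ, hρ, hdist⟩ := exists_dist_source_pos hsource
  set K : ℝ := (ε⁻¹) ^ 2 * (5 * lowerOrderConst d ρ |KG| |Ks| |M| ^ 2 * (m + 1 + 2 * d)) with hK
  obtain ⟨C, hC, hst⟩ := exists_stability (m := m) hB ha hab hd (K := K) (by positivity)
  set k : ℝ := C * (2 * d + 1) * (2 * B) ^ m with hk
  have hk0 : 0 ≤ k := by positivity
  set k' : ℝ := reconstructionConst d |KG| |Ks| |M| ^ 2 * (2 * d) * (m + 2) with hk'
  have hk0' : 0 ≤ k' := by positivity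
  -- The root of k serves the estimate of the solutions, that of k'k the reconstruction, which
  -- passes through the former; adding 1 guarantees positivity.
  refine ⟨√k + √(k' * k) + 1, by positivity, ?_⟩
  intro G μa μs p₁ q₁ p₂ q₂ hG _ _ hKG _ hKs S₁ S₂ h0
  have H := UniformBounds.of_isSolutionPair hdist hG hKG hKs S₁ S₂
  have cp₁ := S₁.2.2.1
  have cq₁ := S₁.2.2.2.1
  have cp₂ := S₂.2.2.1
  have cq₂ := S₂.2.2.2.1
  have cP : ContinuousOn (Function.uncurry fun x α => p₁ x α - p₂ x α)
      (closure (prism m B a b) ×ˢ Icc (-d) d) := cp₁.sub cp₂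
  have cQ : ContinuousOn (Function.uncurry fun x α => q₁ x α - q₂ x α)
      (closure (prism m B a b) ×ˢ Icc (-d) d) := cq₁.sub cq₂
  have adm := fun α (hα : α ∈ Ioo (-d) d) => exists_admissible_sub hB ha hab hd hε hρ (abs_nonneg KG)
    (abs_nonneg Ks) (abs_nonneg M) H S₁ S₂ hα fun x hx => h0 x hx α hα
  have est := hst _ _ cP cQ adm
  have AP : ∀ α ∈ Ioo (-d) d, ∃ g h, IsAdmissible B a b (fun x => p₁ x α - p₂ x α) g h :=
    fun α hα => by
      obtain ⟨g, h, -, -, h', -⟩ := adm α hα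
      exact ⟨g, h, h'⟩
  have AQ : ∀ α ∈ Ioo (-d) d, ∃ g h, IsAdmissible B a b (fun x => q₁ x α - q₂ x α) g h :=
    fun α hα => by
      obtain ⟨-, -, g, h, -, h', -⟩ := adm α hα
      exact ⟨g, h, h'⟩
  have tot := lintegral_h1NormSq_le hB hab hd hC cP cQ AP AQ est
  have hrec := fun A₁ A₂ (R₁ : IsReconstruction B a b d G μs p₁ A₁)
    (R₂ : IsReconstruction B a b d G μs p₂ A₂) => exists_reconstruction_bound ha hd (abs_nonneg KG)
      (abs_nonneg Ks) H S₁.1 S₂.1 R₁ R₂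
  refine ⟨?_, fun A₁ A₂ R₁ R₂ => ?_, fun hD hN => ?_⟩
  · refine rpow_half_le_of_le hk0 ?_ tot
    have := Real.sqrt_nonneg (k' * k)
    linarith
  · obtain ⟨f, -, hf, hfi⟩ := hrec A₁ A₂ R₁ R₂
    have e : eLpNorm (A₁ - A₂) 2 (volume.restrict (prism m B a b)) =
        (∫⁻ x in prism m B a b, ‖A₁ x - A₂ x‖ₑ ^ 2) ^ (1 / 2 : ℝ) := by
      rw [eLpNorm_eq_lintegral_rpow_enorm_toReal (by norm_num) (by norm_num)]
      simp
    rw [e]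
    refine rpow_half_le_of_le (mul_nonneg hk0' hk0) (c := √k + √(k' * k) + 1) ?_ ?_
    · have := Real.sqrt_nonneg k
      linarith
    · rw [ENNReal.ofReal_mul hk0', mul_assoc]
      refine ((lintegral_mono_ae hf).trans hfi).trans (mul_le_mul_right (le_trans ?_ tot) _)
      exact lintegral_mono fun α => le_self_add
  -- Uniqueness is read off from the estimate for each single α, in terms of the Fourier data. The
  -- integrated estimate would give equality only for almost every α.
  · have T : ∀ α ∈ Ioo (-d) d, topData B a b (fun x => p₁ x α - p₂ x α) +
        topData B a b (fun x => q₁ x α - q₂ x α) = 0 := fun α hα => by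
      have hα' := Ioo_subset_Icc_self hα
      obtain ⟨⟨γ, hγ₁, hγ₂⟩, δ, hδ₁, hδ₂⟩ := hN α hα
      rw [topData_sub_eq_zero hB hab (continuousOn_section cp₁ hα') (continuousOn_section cp₂ hα')
        (fun x hx => (hD x hx α hα).1) hγ₁ hγ₂,
        topData_sub_eq_zero hB hab (continuousOn_section cq₁ hα') (continuousOn_section cq₂ hα')
        (fun x hx => (hD x hx α hα).2) hδ₁ hδ₂, add_zero]
    have T0 : ∫⁻ β in Ioo (-d) d, (topData B a b (fun x => p₁ x β - p₂ x β) +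
        topData B a b (fun x => q₁ x β - q₂ x β)) = 0 := by
      rw [setLIntegral_congr_fun measurableSet_Ioo T]
      simp
    have Z : ∀ α ∈ Ioo (-d) d, h1NormSq (prism m B a b) (fun x => p₁ x α - p₂ x α) = 0 ∧
        h1NormSq (prism m B a b) (fun x => q₁ x α - q₂ x α) = 0 := fun α hα => by
      have := est α hα
      rw [T0, T α hα, mul_zero, add_zero, nonpos_iff_eq_zero, add_eq_zero] at this
      exact this
    refine ⟨fun x hx α hα => ?_, fun A₁ A₂ R₁ R₂ => ?_⟩
    · have hα' := Ioo_subset_Icc_self hα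
      have z : ∀ {u : E (m + 1) → ℝ}, h1NormSq (prism m B a b) u = 0 →
          l2NormSq (prism m B a b) u = 0 := fun h =>
        nonpos_iff_eq_zero.1 ((l2NormSq_le_h1NormSq _ _).trans h.le)
      exact ⟨eqOn_prism_of_l2NormSq_eq_zero (continuousOn_section cp₁ hα')
        (continuousOn_section cp₂ hα') (z (Z α hα).1) hx,
        eqOn_prism_of_l2NormSq_eq_zero (continuousOn_section cq₁ hα')
        (continuousOn_section cq₂ hα') (z (Z α hα).2) hx⟩
    · obtain ⟨f, hfm, hf, hfi⟩ := hrec A₁ A₂ R₁ R₂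
      rw [setLIntegral_congr_fun measurableSet_Ioo fun α hα => (Z α hα).1, lintegral_zero, mul_zero,
        nonpos_iff_eq_zero, lintegral_eq_zero_iff' hfm] at hfi
      filter_upwards [hf, hfi] with x hx hx'
      rw [hx', Pi.zero_apply, nonpos_iff_eq_zero] at hx
      simpa [sub_eq_zero] using hx
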